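/- Let $K\ge 0$, $\mathbb{T}^1=\mathbb{R}/2\pi\mathbb{Z}$, and let $t\mapsto f(t)$, $t\ge 0$, be a global solution, in the space of probability measures on $\mathbb{T}^1\times\mathbb{R}$, of the Kuramoto equation $$\partial_t f+\partial_\theta\big(fV[f]\big)=0,\qquad V[f](\theta,\omega)=\omega+K\int_{\mathbb{T}^1\times\mathbb{R}}\sin(\theta'-\theta)\,f(d\theta',d\omega'),$$ that is, $f$ is weakly continuous in $t$ and $\int\chi\,df(t)=\int\chi\,df(0)+\int_0^t\int V[f(s)]\,\partial_\theta\chi\,df(s)\,ds$ for all $t\ge0$ and all $\chi\in C_c^\infty(\mathbb{T}^1\times\mathbb{R})$. Assume that the frequency marginal of $f(0)$ is absolutely continuous, with density $g$. Write $\mathbb{N}=\{1,2,\dots\}$ and $$\widehat g(\tau)=\int_{\mathbb{R}}g(\omega)e^{-i\tau\omega}d\omega,\qquad \widehat{f}_\ell(\tau)=\int_{\mathbb{T}^1\times\mathbb{R}}e^{-i(\ell\theta+\tau\omega)}f(d\theta,d\omega)\quad(\ell\in\mathbb{N}\cup\{0\},\ \tau\in\mathbb{R}),$$ and, with primes denoting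 weak derivatives (a norm being $+\infty$ when one of them does not exist), $$\|\widehat g\|^2_{\mathcal{H}^1_{e^{a\tau}}(\mathbb{R}^+)}=\int_{\mathbb{R}^+}e^{2a\tau}\big(|\widehat g|^2+|\widehat g'|^2\big)d\tau,\qquad \|\widehat f\|^2_{\mathcal{H}^1_{e^{a\tau}}(\mathbb{N}\times\mathbb{R})}=\sum_{\ell\in\mathbb{N}}\int_{\mathbb{R}}e^{2a\tau}\big(|\widehat f_\ell|^2+|\widehat f_\ell'|^2\big)d\tau .$$ Let $a>0$ and $\epsilon>0$, and suppose that $\|\widehat g\|_{\mathcal{H}^1_{e^{a'\tau}}(\mathbb{R}^+)}<+\infty$ and $\|\widehat{f(0)}\|_{\mathcal{H}^1_{e^{a'\tau}}(\mathbb{N}\times\mathbb{R})}<+\infty$ for all $a'\in[a-\epsilon,a+\epsilon]$. Then, for every $t>0$, $f(t)$ satisfies the following conditions (which are the hypotheses, on an initial datum, of the proposition asserting exponential convergence at rate $e^{-at}$ to the Ott–Antonsen manifold): $f(t)$ has frequency density $g$; all the convolutions over $\mathbb{R}$ in $$w_{n,m}(t)=\widehat{f(t)}_{n+m}\ast\widehat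 g-\widehat{f(t)}_n\ast\widehat{f(t)}_m,\qquad n,m\in\mathbb{N}\cup\{0\},$$ converge absolutely; $$\|w(t)\|^2_{\mathcal{H}^1_{e^{a\tau}}(\mathbb{N}^2\times\mathbb{R})}=\sum_{n,m\in\mathbb{N}}\int_{\mathbb{R}}\frac{e^{2a\tau}}{nm}\Big(|w_{n,m}(t,\tau)|^2+|w_{n,m}'(t,\tau)|^2\Big)d\tau<+\infty ;$$ and there is a global solution of the Kuramoto equation with initial condition $f(t)$. -/

import Mathlib

open MeasureTheory Set
open scoped ENNReal NNReal

noncomputable section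

/-- The cylinder `𝕋¹ × ℝ` with `𝕋¹ = ℝ / 2πℤ`; a point is `(θ, ω)`. -/
abbrev Cylinder : Type := AddCircle (2 * Real.pi) × ℝ

/-! ### The Kuramoto equation -/

/-- The velocity field
`V[μ](θ, ω) = ω + K ∫ sin (θ' - θ) μ(dθ', dω')`. -/
def kuramotoVelocity (K : ℝ) (μ : ProbabilityMeasure Cylinder) (p : Cylinder) : ℝ :=
  p.2 + K * ∫ q : Cylinder, Real.Angle.sin (q.1 - p.1) ∂(μ : Measure Cylinder)

/-- Smooth compactly supported real functions on the cylinder. Smoothness is tested on the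
universal cover `ℝ × ℝ`. -/
structure IsCylinderTest (χ : Cylinder → ℝ) : Prop where
  smooth : ContDiff ℝ ((⊤ : ℕ∞) : WithTop ℕ∞)
    (fun x : ℝ × ℝ => χ ((x.1 : AddCircle (2 * Real.pi)), x.2))
  compact : HasCompactSupport χ

/-- The angular derivative `∂_θ χ`. -/
def angularDeriv (χ : Cylinder → ℝ) (p : Cylinder) : ℝ :=
  deriv (fun s : ℝ => χ (p.1 + (s : AddCircle (2 * Real.pi)), p.2)) 0

/-- Global (weak, measure-valued) solutions of `∂_t f + ∂_θ (f V[f]) = 0` on `t ≥ 0`: weakly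
continuous curves of probability measures satisfying the equation against every test function. -/
structure IsKuramotoSolution (K : ℝ) (f : ℝ≥0 → ProbabilityMeasure Cylinder) : Prop where
  continuous : Continuous f
  weak_eq : ∀ χ : Cylinder → ℝ, IsCylinderTest χ → ∀ t : ℝ≥0,
    ∫ p, χ p ∂(f t : Measure Cylinder) = ∫ p, χ p ∂(f 0 : Measure Cylinder) +
      ∫ s in (0 : ℝ)..(t : ℝ), ∫ p, kuramotoVelocity K (f s.toNNReal) p * angularDeriv χ p
        ∂(f s.toNNReal : Measure Cylinder)

/-- `g` is the density of the frequency marginal of `μ`. -/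
structure HasFrequencyDensity (μ : ProbabilityMeasure Cylinder) (g : ℝ → ℝ) : Prop where
  integrable : Integrable g
  nonneg : ∀ᵐ ω, 0 ≤ g ω
  marginal : (μ : Measure Cylinder).map Prod.snd =
    volume.withDensity (fun ω => ENNReal.ofReal (g ω))

/-! ### Fourier transforms -/

/-- `ĝ(τ) = ∫ g(ω) e^{-iτω} dω`. -/
def densityFourier (g : ℝ → ℝ) (τ : ℝ) : ℂ :=
  ∫ ω : ℝ, (g ω : ℂ) * Complex.exp (-(Complex.I * τ * ω))

/-- `μ̂_ℓ(τ) = ∫ e^{-i(ℓθ + τω)} μ(dθ, dω)`. On `ℝ / 2πℤ`, `fourier (-ℓ) θ` is `e^{-iℓθ}`. -/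
def cylinderFourier (μ : ProbabilityMeasure Cylinder) (ℓ : ℤ) (τ : ℝ) : ℂ :=
  ∫ p : Cylinder, fourier (-ℓ) p.1 * Complex.exp (-(Complex.I * τ * p.2)) ∂(μ : Measure Cylinder)

/-! ### Weighted `H¹` norms -/

/-- `v` is the weak derivative of `u` on the open set `Ω ⊆ ℝ`. -/
structure HasWeakDerivOn (Ω : Set ℝ) (u v : ℝ → ℂ) : Prop where
  locInt_fun : LocallyIntegrableOn u Ω
  locInt_deriv : LocallyIntegrableOn v Ω
  integral_eq : ∀ χ : ℝ → ℝ, ContDiff ℝ ((⊤ : ℕ∞) : WithTop ℕ∞) χ → HasCompactSupport χ →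
    tsupport χ ⊆ Ω →
    ∫ τ in Ω, ((deriv χ τ : ℝ) : ℂ) * u τ = -∫ τ in Ω, (χ τ : ℂ) * v τ

/-- `∫_Ω φ(τ)² (|u(τ)|² + |u'(τ)|²) dτ`, where `u'` is the weak derivative (which is unique almost
everywhere); the value is `∞` if `u` has no weak derivative on `Ω`. -/
def weightedH1Sq (Ω : Set ℝ) (φ : ℝ → ℝ) (u : ℝ → ℂ) : ℝ≥0∞ :=
  ⨅ (v : ℝ → ℂ) (_ : HasWeakDerivOn Ω u v),
    ∫⁻ τ in Ω, ENNReal.ofReal (φ τ ^ 2 * (‖u τ‖ ^ 2 + ‖v τ‖ ^ 2))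

/-- The weight `τ ↦ e^{aτ}`. -/
def expWeight (a τ : ℝ) : ℝ := Real.exp (a * τ)

/-- The norm of `H¹_φ(ℝ⁺)`. -/
def normH1HalfLine (φ : ℝ → ℝ) (u : ℝ → ℂ) : ℝ≥0∞ :=
  weightedH1Sq (Ioi 0) φ u ^ (1 / 2 : ℝ)

/-- The norm of `H¹_φ(ℕ × ℝ)`, where `ℕ = {1, 2, …}`. -/
def normH1Seq (φ : ℝ → ℝ) (u : ℕ+ → ℝ → ℂ) : ℝ≥0∞ :=
  (∑' ℓ : ℕ+, weightedH1Sq univ φ (u ℓ)) ^ (1 / 2 : ℝ)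

/-- The norm of `H¹_φ(ℕ² × ℝ)`, with the factor `1 / (nm)`. -/
def normH1Pair (φ : ℝ → ℝ) (w : ℕ+ → ℕ+ → ℝ → ℂ) : ℝ≥0∞ :=
  (∑' (n : ℕ+) (m : ℕ+), weightedH1Sq univ φ (w n m) / ((n : ℝ≥0∞) * (m : ℝ≥0∞))) ^ (1 / 2 : ℝ)

/-! ### The defect from the Ott–Antonsen manifold -/

/-- `w_{n,m} = μ̂_{n+m} ∗ ĝ - μ̂_n ∗ μ̂_m`, with the convolution over `ℝ`. -/
def oaDefect (g : ℝ → ℝ) (μ : ProbabilityMeasure Cylinder) (n m : ℕ) : ℝ → ℂ :=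
  convolution (cylinderFourier μ (n + m)) (densityFourier g) (ContinuousLinearMap.mul ℂ ℂ) volume
    - convolution (cylinderFourier μ n) (cylinderFourier μ m) (ContinuousLinearMap.mul ℂ ℂ) volume

/-- The hypotheses on the initial datum `μ` (with frequency density `g`) under which the
Ott–Antonsen manifold attracts its trajectory at rate `e^{-at}`: the convolutions that define `w`
converge absolutely, `‖w‖` is finite, and there is a global solution starting at `μ`. -/
structure SatisfiesOAHypotheses (K a : ℝ) (g : ℝ → ℝ) (μ : ProbabilityMeasure Cylinder) :
    Prop where
  rate_pos : 0 < a
  density : HasFrequencyDensity μ g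
  convolution_density : ∀ n m : ℕ, ConvolutionExists (cylinderFourier μ (n + m))
    (densityFourier g) (ContinuousLinearMap.mul ℂ ℂ) volume
  convolution_modes : ∀ n m : ℕ, ConvolutionExists (cylinderFourier μ n)
    (cylinderFourier μ m) (ContinuousLinearMap.mul ℂ ℂ) volume
  norm_lt_top : normH1Pair (expWeight a) (fun n m => oaDefect g μ n m) < ⊤
  global_solution : ∃ F : ℝ≥0 → ProbabilityMeasure Cylinder, IsKuramotoSolution K F ∧ F 0 = μ

end

/-!
The Fourier coefficients `u_ℓ(t, τ)` of a solution satisfy, for `ℓ ≥ 1`, the hierarchy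
`∂_t u_ℓ = ℓ ∂_τ u_ℓ + (Kℓ/2) (z̄ u_{ℓ-1} - z u_{ℓ+1})`, where `z` is the order parameter and
`|z| ≤ 1`, while `u_0 = ĝ` does not depend on time. As a measure-valued solution only gives
continuous coefficients, the hierarchy is established in integrated form along the characteristics
`τ = ξ - ℓ t` (`IsKuramotoSolution.isModeHierarchy`).

*Propagation of weighted norms.* Multiply the equation for `u_ℓ` by `e^{2aτ} ū_ℓ` and integrate
over `τ`. With `a > 0` the transport term contributes `-aℓ ‖u_ℓ‖²` to `½ d/dt ‖u_ℓ‖²`, which has a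
favourable sign, and the interaction terms, summed over `ℓ`, telescope up to a multiple of the
energy and of `‖u_0‖²`, because the coupling coefficients of neighbouring modes differ by `K/2`. To
justify this without assuming that the energy is finite at positive times, the weight `e^{2aτ}` is
truncated to an integrable one, whose decay rate is at most `η`, and mode `ℓ` is given the weight
`e^{-ℓ q(t)}` with `q(t) = η e^{(2K+1)t}`; the growth of `q` absorbs all the errors, and `η → 0` is
taken at the end (`IsModeHierarchy.sum_integral_le`, `IsModeHierarchy.tsum_weightedL2Sq_le`). The
difference quotients in `τ` solve the same hierarchy, so they satisfy the same bound, uniformly in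
the step, and weak compactness in `L²` gives the bound for the weak derivatives
(`IsModeHierarchy.tsum_weightedH1Sq_lt_top`). The hypothesis on `ĝ` on the half line controls it
on the whole line since `ĝ(-τ)` is the conjugate of `ĝ(τ)`.

*The defect.* The previous step holds at the rates `a` and `a ± δ` for small `δ`. The two outer
rates bound the `L¹(e^{aτ} dτ)` norms of the modes (`exists_weightedL1_sq_le`), and Young's
inequality `L¹ ∗ H¹ ⊆ H¹`, which the exponential weight respects, bounds both convolutions
(`weightedH1Sq_convolution_le`). In `u_{n+m} ∗ u_0` the summability over `(n, m)` comes from the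
factor `1/(nm)`: there are `k - 1` pairs with `n + m = k`, and `nm ≥ k - 1` for each of them
(`tsum_weightedH1Sq_defect_lt_top`).

Translating the given solution in time yields the solution that starts from `f(t)`
(`IsKuramotoSolution.shift`).
-/

open Filter Topology ComplexConjugate

/-! ### An integrable truncation of the exponential weight -/

/-- The integrable weight `(e^{-2aτ} + η e^{ητ})⁻¹`: it lies below `e^{2aτ}`, tends to
it as `η → 0`, and decays like `e^{-ητ}` at `+∞`. -/
noncomputable def cutoffWeight (a η τ : ℝ) : ℝ :=
  (Real.exp (-(2 * a) * τ) + η * Real.exp (η * τ))⁻¹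

/-- The derivative of `cutoffWeight`. -/
noncomputable def cutoffWeightDeriv (a η τ : ℝ) : ℝ :=
  (2 * a * Real.exp (-(2 * a) * τ) - η ^ 2 * Real.exp (η * τ)) * cutoffWeight a η τ ^ 2

section CutoffWeight

variable {a η : ℝ}

lemma cutoffWeight_denom_pos (hη : 0 ≤ η) (τ : ℝ) :
    0 < Real.exp (-(2 * a) * τ) + η * Real.exp (η * τ) := by positivity

lemma cutoffWeight_pos (hη : 0 ≤ η) (τ : ℝ) : 0 < cutoffWeight a η τ :=
  inv_pos.2 (cutoffWeight_denom_pos hη τ)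

lemma hasDerivAt_cutoffWeight (hη : 0 ≤ η) (τ : ℝ) :
    HasDerivAt (cutoffWeight a η) (cutoffWeightDeriv a η τ) τ := by
  have h1 : HasDerivAt (fun τ : ℝ => Real.exp (-(2 * a) * τ))
      (Real.exp (-(2 * a) * τ) * (-(2 * a) * 1)) τ :=
    ((hasDerivAt_id τ).const_mul (-(2 * a))).exp
  have h2 : HasDerivAt (fun τ : ℝ => Real.exp (η * τ)) (Real.exp (η * τ) * (η * 1)) τ :=
    ((hasDerivAt_id τ).const_mul η).exp
  have h3 := (h1.add (h2.const_mul η)).inv (cutoffWeight_denom_pos hη τ).ne'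
  refine h3.congr_deriv ?_
  simp only [cutoffWeightDeriv, cutoffWeight, Pi.add_apply, inv_pow]
  rw [div_eq_mul_inv]
  ring

lemma continuous_cutoffWeight (hη : 0 ≤ η) : Continuous (cutoffWeight a η) :=
  continuous_iff_continuousAt.2 fun τ => (hasDerivAt_cutoffWeight hη τ).continuousAt

lemma continuous_cutoffWeightDeriv (hη : 0 ≤ η) : Continuous (cutoffWeightDeriv a η) := by
  have := continuous_cutoffWeight (a := a) hη
  unfold cutoffWeightDeriv
  fun_prop

lemma cutoffWeightDeriv_eq (hη : 0 ≤ η) (τ : ℝ) : cutoffWeightDeriv a η τ =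
    2 * a * cutoffWeight a η τ -
      (2 * a + η) * (η * Real.exp (η * τ) * cutoffWeight a η τ) * cutoffWeight a η τ := by
  have h : (Real.exp (-(2 * a) * τ) + η * Real.exp (η * τ)) * cutoffWeight a η τ = 1 :=
    mul_inv_cancel₀ (cutoffWeight_denom_pos hη τ).ne'
  unfold cutoffWeightDeriv
  linear_combination (2 * a * cutoffWeight a η τ) * h

lemma cutoffWeight_fraction_le (hη : 0 ≤ η) (τ : ℝ) :
    η * Real.exp (η * τ) * cutoffWeight a η τ ≤ 1 := by
  rw [cutoffWeight, ← div_eq_mul_inv, div_le_one (cutoffWeight_denom_pos hη τ)]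
  linarith [Real.exp_pos (-(2 * a) * τ)]

/-- The only loss in replacing `e^{2aτ}`, which is increasing, by the truncated weight: it may
decrease, but at a relative rate of at most `η`. -/
lemma neg_mul_cutoffWeight_le_deriv (ha : 0 ≤ a) (hη : 0 ≤ η) (τ : ℝ) :
    -η * cutoffWeight a η τ ≤ cutoffWeightDeriv a η τ := by
  have h0 := cutoffWeight_pos (a := a) hη τ
  have h1 := cutoffWeight_fraction_le (a := a) hη τ
  rw [cutoffWeightDeriv_eq hη]
  nlinarith [mul_le_mul_of_nonneg_left h1 (mul_nonneg (by linarith : 0 ≤ 2 * a + η) h0.le)]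

lemma abs_cutoffWeightDeriv_le (ha : 0 ≤ a) (hη : 0 ≤ η) (τ : ℝ) :
    |cutoffWeightDeriv a η τ| ≤ (2 * a + η) * cutoffWeight a η τ := by
  have h0 := cutoffWeight_pos (a := a) hη τ
  have h2 : 0 ≤ (2 * a + η) * (η * Real.exp (η * τ) * cutoffWeight a η τ) * cutoffWeight a η τ := by
    positivity
  rw [abs_le]
  refine ⟨?_, ?_⟩
  · have := neg_mul_cutoffWeight_le_deriv ha hη τ
    nlinarith [mul_nonneg ha h0.le]
  · rw [cutoffWeightDeriv_eq hη]
    nlinarith [mul_nonneg hη h0.le]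

lemma cutoffWeight_le_exp (hη : 0 ≤ η) (τ : ℝ) : cutoffWeight a η τ ≤ Real.exp (2 * a * τ) := by
  rw [cutoffWeight, show 2 * a * τ = -(-(2 * a) * τ) by ring, Real.exp_neg]
  exact inv_anti₀ (Real.exp_pos _) (le_add_of_nonneg_right (by positivity))

lemma integrable_cutoffWeight (ha : 0 < a) (hη : 0 < η) : Integrable (cutoffWeight a η) := by
  have hc := continuous_cutoffWeight (a := a) hη.le
  rw [← integrableOn_univ, ← Iic_union_Ioi (a := (0 : ℝ)), integrableOn_union]
  constructor
  · refine (integrableOn_exp_mul_Iic (a := 2 * a) (by positivity) 0).mono'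
      hc.aestronglyMeasurable (ae_of_all _ fun τ => ?_)
    rw [Real.norm_of_nonneg (cutoffWeight_pos hη.le τ).le]
    exact cutoffWeight_le_exp hη.le τ
  · refine ((integrableOn_exp_mul_Ioi (a := -η) (by linarith) 0).const_mul η⁻¹).mono'
      hc.aestronglyMeasurable (ae_of_all _ fun τ => ?_)
    rw [Real.norm_of_nonneg (cutoffWeight_pos hη.le τ).le, neg_mul, Real.exp_neg, ← mul_inv]
    exact inv_anti₀ (by positivity) (le_add_of_nonneg_left (Real.exp_pos _).le)

lemma tendsto_cutoffWeight (a τ : ℝ) :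
    Tendsto (fun η => cutoffWeight a η τ) (𝓝 0) (𝓝 (Real.exp (2 * a * τ))) := by
  have h : ContinuousAt (fun η => cutoffWeight a η τ) 0 := by
    unfold cutoffWeight
    refine ContinuousAt.inv₀ (by fun_prop) ?_
    exact (cutoffWeight_denom_pos le_rfl τ).ne'
  have h0 : cutoffWeight a 0 τ = Real.exp (2 * a * τ) := by
    rw [cutoffWeight, show 2 * a * τ = -(-(2 * a) * τ) by ring, Real.exp_neg]
    simp
  rw [← h0]
  exact h

end CutoffWeight

/-! ### Energy estimates for hierarchies of transport equations -/

/-- A continuous function dominated by `C φ(τ)` is integrable on `(0, t] × ℝ` after any shear. -/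
lemma integrable_shear_of_le {P : ℝ → ℝ → ℝ} {φ : ℝ → ℝ} {C t : ℝ}
    (hP : Continuous (Function.uncurry P)) (hφ : Integrable φ)
    (hPb : ∀ s ∈ Icc 0 t, ∀ τ, ‖P s τ‖ ≤ C * φ τ) (κ : ℝ) :
    Integrable (Function.uncurry fun s τ => P s (τ - κ * s))
      ((volume.restrict (Ioc 0 t)).prod volume) := by
  have hP2 : Continuous fun x : ℝ × ℝ => P x.1 x.2 := hP
  have hslice : ∀ s ∈ Icc 0 t, Integrable (P s) := fun s hs =>
    (hφ.const_mul C).mono' (by fun_prop) (ae_of_all _ (hPb s hs))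
  have hae : ∀ᵐ s ∂(volume.restrict (Ioc 0 t)), s ∈ Icc 0 t :=
    (ae_restrict_mem measurableSet_Ioc).mono fun s hs => Ioc_subset_Icc_self hs
  have hmeas : AEStronglyMeasurable (Function.uncurry fun s τ => P s (τ - κ * s))
      ((volume.restrict (Ioc 0 t)).prod volume) := by
    refine Continuous.aestronglyMeasurable ?_
    exact hP2.comp (f := fun x : ℝ × ℝ => (x.1, x.2 - κ * x.1)) (by fun_prop)
  refine (integrable_prod_iff hmeas).2 ⟨hae.mono fun s hs => ?_, ?_⟩
  · exact (hslice s hs).comp_sub_right (κ * s)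
  refine (integrable_const (C * ∫ τ, φ τ)).mono' hmeas.norm.integral_prod_right'
    (hae.mono fun s hs => ?_)
  have hshift : ∫ τ, ‖Function.uncurry (fun s τ => P s (τ - κ * s)) (s, τ)‖ = ∫ τ, ‖P s τ‖ :=
    integral_sub_right_eq_self (fun τ => ‖P s τ‖) (κ * s)
  rw [hshift, Real.norm_of_nonneg (integral_nonneg fun _ => norm_nonneg _), ← integral_const_mul]
  exact integral_mono (hslice s hs).norm (hφ.const_mul C) (hPb s hs)

/-- The energy density `W |v|²` of a solution `v` of `∂_s v = m ∂_τ v + r`, integrated along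
characteristics and over space. -/
lemma integral_weight_norm_sq_sub_eq {v r : ℝ → ℝ → ℂ} {m B R M t : ℝ} {c c' φ φ' : ℝ → ℝ}
    (ht : 0 ≤ t)
    (hv : Continuous (Function.uncurry v)) (hr : Continuous (Function.uncurry r))
    (hvB : ∀ s τ, ‖v s τ‖ ≤ B) (hrB : ∀ s τ, ‖r s τ‖ ≤ R)
    (hder : ∀ s ξ, 0 < s → HasDerivAt (fun σ => v σ (ξ - m * σ)) (r s (ξ - m * s)) s)
    (hc : ∀ s, HasDerivAt c (c' s) s) (hc' : Continuous c')
    (hφ : ∀ τ, HasDerivAt φ (φ' τ) τ) (hφ' : Continuous φ') (hφ0 : ∀ τ, 0 ≤ φ τ)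
    (hM : ∀ τ, |φ' τ| ≤ M * φ τ) (hint : Integrable φ) :
    Continuous (Function.uncurry fun s τ => (c' s * φ τ - m * c s * φ' τ) * ‖v s τ‖ ^ 2 +
          c s * φ τ * (2 * inner ℝ (v s τ) (r s τ))) ∧
    Integrable (Function.uncurry fun s τ => (c' s * φ τ - m * c s * φ' τ) * ‖v s τ‖ ^ 2 +
          c s * φ τ * (2 * inner ℝ (v s τ) (r s τ)))
        ((volume.restrict (Ioc 0 t)).prod volume) ∧
    (∫ τ, c t * φ τ * ‖v t τ‖ ^ 2) - ∫ τ, c 0 * φ τ * ‖v 0 τ‖ ^ 2 =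
      ∫ s in Ioc 0 t, ∫ τ, ((c' s * φ τ - m * c s * φ' τ) * ‖v s τ‖ ^ 2 +
          c s * φ τ * (2 * inner ℝ (v s τ) (r s τ))) := by
  have hcc : Continuous c := continuous_iff_continuousAt.2 fun s => (hc s).continuousAt
  have hφc : Continuous φ := continuous_iff_continuousAt.2 fun s => (hφ s).continuousAt
  have hv2 : Continuous fun x : ℝ × ℝ => v x.1 x.2 := hv
  have hr2 : Continuous fun x : ℝ × ℝ => r x.1 x.2 := hr
  set P : ℝ → ℝ → ℝ := fun s τ => (c' s * φ τ - m * c s * φ' τ) * ‖v s τ‖ ^ 2 +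
          c s * φ τ * (2 * inner ℝ (v s τ) (r s τ)) with hP
  have hPc : Continuous (Function.uncurry P) := by
    simp only [hP, Function.uncurry_def]
    fun_prop
  have hPc2 : Continuous fun x : ℝ × ℝ => P x.1 x.2 := hPc
  have hB0 : 0 ≤ B := (norm_nonneg _).trans (hvB 0 0)
  have hR0 : 0 ≤ R := (norm_nonneg _).trans (hrB 0 0)
  obtain ⟨C₁, hC₁⟩ := isCompact_Icc.exists_bound_of_continuousOn (s := Icc 0 t) hcc.continuousOn
  obtain ⟨C₂, hC₂⟩ := isCompact_Icc.exists_bound_of_continuousOn (s := Icc 0 t) hc'.continuousOn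
  set C := (C₂ + |m| * C₁ * M) * B ^ 2 + C₁ * (2 * (B * R)) with hC
  have hPb : ∀ s ∈ Icc 0 t, ∀ τ, ‖P s τ‖ ≤ C * φ τ := by
    intro s hs τ
    have h1 := hC₁ s hs
    have h2 := hC₂ s hs
    rw [Real.norm_eq_abs] at h1 h2
    have hC1 : 0 ≤ C₁ := (abs_nonneg _).trans h1
    have hC2 : 0 ≤ C₂ := (abs_nonneg _).trans h2
    have h3 : |inner ℝ (v s τ) (r s τ)| ≤ B * R :=
      (abs_real_inner_le_norm _ _).trans (mul_le_mul (hvB s τ) (hrB s τ) (norm_nonneg _) hB0)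
    have h4 : ‖v s τ‖ ^ 2 ≤ B ^ 2 := pow_le_pow_left₀ (norm_nonneg _) (hvB s τ) 2
    have h0 := hφ0 τ
    have hM0 : 0 ≤ M * φ τ := (abs_nonneg _).trans (hM τ)
    calc ‖P s τ‖ ≤ |(c' s * φ τ - m * c s * φ' τ) * ‖v s τ‖ ^ 2| +
          |c s * φ τ * (2 * inner ℝ (v s τ) (r s τ))| := abs_add_le _ _
      _ = |c' s * φ τ - m * c s * φ' τ| * ‖v s τ‖ ^ 2 +
          |c s| * φ τ * (2 * |inner ℝ (v s τ) (r s τ)|) := by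
        simp only [abs_mul, abs_of_nonneg h0, abs_pow, abs_norm, abs_two]
      _ ≤ (|c' s| * φ τ + |m| * |c s| * |φ' τ|) * ‖v s τ‖ ^ 2 +
          |c s| * φ τ * (2 * |inner ℝ (v s τ) (r s τ)|) := by
        gcongr
        refine (abs_sub _ _).trans_eq ?_
        simp only [abs_mul, abs_of_nonneg h0]
      _ ≤ (C₂ * φ τ + |m| * C₁ * (M * φ τ)) * B ^ 2 + C₁ * φ τ * (2 * (B * R)) := by
        gcongr
        exact hM τ
      _ = C * φ τ := by rw [hC]; ring
  have hprod := fun κ : ℝ => integrable_shear_of_le hPc hint hPb κ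
  clear_value P
  refine ⟨hPc, by simpa using hprod 0, ?_⟩
  have hE : ∀ s, ∫ τ, c s * φ τ * ‖v s τ‖ ^ 2 =
      ∫ ξ, c s * φ (ξ - m * s) * ‖v s (ξ - m * s)‖ ^ 2 := fun s =>
    (integral_sub_right_eq_self (fun τ => c s * φ τ * ‖v s τ‖ ^ 2) _).symm
  have hEint : ∀ s, Integrable fun τ => c s * φ τ * ‖v s τ‖ ^ 2 := fun s => by
    refine (hint.const_mul (|c s| * B ^ 2)).mono' (by fun_prop) (ae_of_all _ fun τ => ?_)
    rw [norm_mul, norm_mul, norm_pow, norm_norm, Real.norm_of_nonneg (hφ0 τ), Real.norm_eq_abs]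
    have h4 : ‖v s τ‖ ^ 2 ≤ B ^ 2 := pow_le_pow_left₀ (norm_nonneg _) (hvB s τ) 2
    have := mul_le_mul_of_nonneg_left h4 (mul_nonneg (abs_nonneg (c s)) (hφ0 τ))
    linarith
  rw [hE t, hE 0, ← integral_sub ((hEint t).comp_sub_right _) ((hEint 0).comp_sub_right _)]
  have hpt : ∀ ξ, c t * φ (ξ - m * t) * ‖v t (ξ - m * t)‖ ^ 2 -
      c 0 * φ (ξ - m * 0) * ‖v 0 (ξ - m * 0)‖ ^ 2 = ∫ s in Ioc 0 t, P s (ξ - m * s) := by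
    intro ξ
    have hline : ∀ s, HasDerivAt (fun σ => ξ - m * σ) (-m) s := fun s => by
      simpa using ((hasDerivAt_id s).const_mul m).const_sub ξ
    rw [← intervalIntegral.integral_of_le ht]
    symm
    refine intervalIntegral.integral_eq_sub_of_hasDerivAt_of_le
      (f := fun s => c s * φ (ξ - m * s) * ‖v s (ξ - m * s)‖ ^ 2) ht ?_ ?_ ?_
    · refine Continuous.continuousOn ?_
      have : Continuous fun s : ℝ => v s (ξ - m * s) :=
        hv2.comp (f := fun s : ℝ => (s, ξ - m * s)) (by fun_prop)
      fun_prop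
    · intro s hs
      have h1 := ((hc s).mul ((hφ (ξ - m * s)).comp s (hline s))).mul (hder s ξ hs.1).norm_sq
      refine h1.congr_deriv ?_
      simp only [hP, Function.comp_apply, Pi.mul_apply]
      ring
    · refine Continuous.intervalIntegrable ?_ _ _
      exact hPc2.comp (f := fun s : ℝ => (s, ξ - m * s)) (by fun_prop)
  have hm := hprod m
  simp_rw [hpt]
  rw [← integral_integral_swap (f := fun s ξ => P s (ξ - m * s)) hm]
  refine integral_congr_ae (ae_of_all _ fun s => ?_)
  exact (integral_sub_right_eq_self (μ := volume) (P s) (m * s)).trans (by simp only [hP])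

lemma sum_setIntegral_integral_le {P : ℕ → ℝ → ℝ → ℝ} {G : ℝ → ℝ} {t : ℝ} {L : ℕ} (ht : 0 ≤ t)
    (hP : ∀ i, Integrable (Function.uncurry (P i)) ((volume.restrict (Ioc 0 t)).prod volume))
    (hG : Integrable G) (hle : ∀ s ∈ Ioc 0 t, ∀ τ, ∑ i ∈ Finset.range L, P i s τ ≤ G τ) :
    ∑ i ∈ Finset.range L, (∫ s in Ioc 0 t, ∫ τ, P i s τ) ≤ t * ∫ τ, G τ := by
  have hsum : Integrable (Function.uncurry fun s τ => ∑ i ∈ Finset.range L, P i s τ)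
      ((volume.restrict (Ioc 0 t)).prod volume) :=
    (integrable_finsetSum (Finset.range L) fun i _ => hP i)
  calc _ = ∫ x, ∑ i ∈ Finset.range L, P i x.1 x.2 ∂((volume.restrict (Ioc 0 t)).prod volume) := by
        rw [integral_finsetSum (f := fun i (x : ℝ × ℝ) => P i x.1 x.2) _ fun i _ => hP i]
        exact Finset.sum_congr rfl fun i _ => (integral_prod _ (hP i)).symm
    _ = ∫ s in Ioc 0 t, ∫ τ, ∑ i ∈ Finset.range L, P i s τ := integral_prod _ hsum
    _ ≤ ∫ s in Ioc 0 t, ∫ τ, G τ := by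
        refine integral_mono_ae hsum.integral_prod_left (integrable_const _) ?_
        filter_upwards [hsum.prod_right_ae, ae_restrict_mem measurableSet_Ioc] with s h1 h2
        exact integral_mono h1 hG (hle s h2)
    _ = _ := by simp [ht]

/-- Summation by parts for the nearest-neighbour coupling with geometric weights. The coupling
coefficients grow like `i`, but their weighted increments only cost a multiple of
`1 + (1 - r) i`. -/
lemma sum_coupling_le {r B : ℝ} {x A : ℕ → ℝ} (hr : 1 / 2 ≤ r) (hr1 : r ≤ 1)
    (hA : ∀ i, |A i| ≤ (x i ^ 2 + x (i + 1) ^ 2) / 2) (hx0 : ∀ i, 0 ≤ x i) (hxB : ∀ i, x i ≤ B)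
    (L : ℕ) :
    ∑ i ∈ Finset.range L, ((i : ℝ) + 1) * r ^ (i + 1) * (A i - A (i + 1)) ≤
      x 0 ^ 2 / 2 + ∑ i ∈ Finset.range L,
        (1 + 3 / 2 * (1 - r) * ((i : ℝ) + 1)) * r ^ (i + 1) * x (i + 1) ^ 2 +
      L * r ^ L * B ^ 2 := by
  have hr0 : 0 ≤ r := by linarith
  have key : ∀ L : ℕ, ∑ i ∈ Finset.range L, ((i : ℝ) + 1) * r ^ (i + 1) * (A i - A (i + 1)) +
      L * r ^ L * A L ≤ x 0 ^ 2 / 2 + ∑ i ∈ Finset.range L,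
        (1 + 3 / 2 * (1 - r) * ((i : ℝ) + 1)) * r ^ (i + 1) * x (i + 1) ^ 2 -
        r ^ L * x L ^ 2 / 2 - (1 - r) * L * r ^ L * x L ^ 2 / 2 := by
    intro L
    induction L with
    | zero => simp
    | succ L ih =>
      rw [Finset.sum_range_succ, Finset.sum_range_succ]
      push_cast
      have hrL : 0 ≤ r ^ L := pow_nonneg hr0 L
      have hL : (0 : ℝ) ≤ L := Nat.cast_nonneg L
      have h1 : ((L + 1) * r ^ (L + 1) - L * r ^ L) * A L ≤
          (r ^ (L + 1) + L * (1 - r) * r ^ L) * ((x L ^ 2 + x (L + 1) ^ 2) / 2) := by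
        refine (le_abs_self _).trans ?_
        rw [abs_mul]
        refine mul_le_mul ?_ (hA L) (abs_nonneg _) ?_
        · rw [show ((L : ℝ) + 1) * r ^ (L + 1) - L * r ^ L =
            r ^ (L + 1) - L * (1 - r) * r ^ L by ring]
          refine (abs_sub _ _).trans_eq ?_
          rw [abs_of_nonneg (pow_nonneg hr0 _), abs_of_nonneg]
          exact mul_nonneg (mul_nonneg hL (by linarith)) hrL
        · exact add_nonneg (pow_nonneg hr0 _) (mul_nonneg (mul_nonneg hL (by linarith)) hrL)
      have h2 : r ^ (L + 1) * x L ^ 2 ≤ r ^ L * x L ^ 2 :=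
        mul_le_mul_of_nonneg_right (pow_le_pow_of_le_one hr0 hr1 (Nat.le_succ L)) (sq_nonneg _)
      have h3 : L * (1 - r) * r ^ L * x (L + 1) ^ 2 ≤
          2 * ((1 - r) * (L + 1) * r ^ (L + 1) * x (L + 1) ^ 2) := by
        have : L * r ^ L ≤ (L + 1) * r ^ L * (2 * r) := by
          have : (L + 1) * r ^ L * 1 ≤ (L + 1) * r ^ L * (2 * r) :=
            mul_le_mul_of_nonneg_left (by linarith) (by positivity)
          linarith
        have := mul_le_mul_of_nonneg_left this
          (mul_nonneg (by linarith : 0 ≤ 1 - r) (sq_nonneg (x (L + 1))))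
        rw [pow_succ r L]
        linarith
      linarith
  have h := key L
  have hAL : |A L| ≤ B ^ 2 := by
    refine (hA L).trans ?_
    have := pow_le_pow_left₀ (hx0 L) (hxB L) 2
    have := pow_le_pow_left₀ (hx0 (L + 1)) (hxB (L + 1)) 2
    linarith
  have hLr : 0 ≤ L * r ^ L := by positivity
  have h1 : -(L * r ^ L * A L) ≤ L * r ^ L * B ^ 2 := by
    rw [← mul_neg]
    exact mul_le_mul_of_nonneg_left ((neg_le_abs _).trans hAL) hLr
  have h2 : 0 ≤ r ^ L * x L ^ 2 := by positivity
  have h3 : 0 ≤ (1 - r) * L * r ^ L * x L ^ 2 := by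
    have : 0 ≤ 1 - r := by linarith
    positivity
  linarith

/-- Solutions `u_ℓ(s, τ)`, `ℓ ≥ 0`, of the hierarchy
`∂_s u_ℓ = ℓ ∂_τ u_ℓ + (K ℓ / 2) (conj z u_{ℓ-1} - z u_{ℓ+1})` satisfied by the Fourier
coefficients of a solution of the Kuramoto equation with order parameter `z`. The equation is
imposed along characteristics, so that no differentiability in `τ` is required. -/
structure IsModeHierarchy (K : ℝ) (z : ℝ → ℂ) (u : ℕ → ℝ → ℝ → ℂ) : Prop where
  continuous : ∀ ℓ, Continuous (Function.uncurry (u ℓ))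
  bounded : ∃ B, ∀ ℓ s τ, ‖u ℓ s τ‖ ≤ B
  zero_mode : ∀ s τ, u 0 s τ = u 0 0 τ
  transport : ∀ (ℓ : ℕ) (s ξ : ℝ), 0 < s →
    HasDerivAt (fun σ => u (ℓ + 1) σ (ξ - ((ℓ : ℝ) + 1) * σ))
      (((K * ((ℓ : ℝ) + 1) / 2 : ℝ) : ℂ) * (conj (z s) * u ℓ s (ξ - ((ℓ : ℝ) + 1) * s) -
        z s * u (ℓ + 2) s (ξ - ((ℓ : ℝ) + 1) * s))) s

namespace IsModeHierarchy

variable {K : ℝ} {z : ℝ → ℂ} {u : ℕ → ℝ → ℝ → ℂ}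

/-- The energy inequality with an integrable weight `φ` and geometric weights `e^{-ℓ q(s)}` in the
mode index, for finitely many modes. The growth of `q` in time pays for the coupling coefficients
growing with `ℓ` and for the decay of `φ`. -/
lemma sum_integral_le (h : IsModeHierarchy K z u) (hK : 0 ≤ K) (hz : Continuous z)
    (hz1 : ∀ s, ‖z s‖ ≤ 1) {B a η t : ℝ} (hB : ∀ ℓ s τ, ‖u ℓ s τ‖ ≤ B) (ha : 0 < a) (hη : 0 < η)
    (ht : 0 ≤ t) (hηt : η * Real.exp ((2 * K + 1) * t) ≤ 1 / 2) (L : ℕ) :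
    ∑ i ∈ Finset.range L, (∫ τ, Real.exp (-K * t - ((i : ℝ) + 1) *
        (η * Real.exp ((2 * K + 1) * t))) * cutoffWeight a η τ * ‖u (i + 1) t τ‖ ^ 2) ≤
      ∑ i ∈ Finset.range L, (∫ τ, cutoffWeight a η τ * ‖u (i + 1) 0 τ‖ ^ 2) +
      t * (K / 2 * (∫ τ, cutoffWeight a η τ * ‖u 0 0 τ‖ ^ 2) +
        K * B ^ 2 * (L * Real.exp (-η) ^ L) * ∫ τ, cutoffWeight a η τ) := by
  set φ := cutoffWeight a η with hφdef
  set q : ℝ → ℝ := fun s => η * Real.exp ((2 * K + 1) * s) with hq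
  have hq' : ∀ s, HasDerivAt q ((2 * K + 1) * q s) s := fun s => by
    have := (((hasDerivAt_id s).const_mul (2 * K + 1)).exp).const_mul η
    refine this.congr_deriv ?_
    simp only [hq, id]
    ring
  have hqc : Continuous q := by simp only [hq]; fun_prop
  set c : ℕ → ℝ → ℝ := fun i s => Real.exp (-K * s - ((i : ℝ) + 1) * q s) with hc
  have hc' : ∀ i s, HasDerivAt (c i) ((-K - ((i : ℝ) + 1) * ((2 * K + 1) * q s)) * c i s) s := by
    intro i s
    have := (((hasDerivAt_id s).const_mul (-K)).sub ((hq' s).const_mul ((i : ℝ) + 1))).exp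
    refine this.congr_deriv ?_
    simp only [hc, id, Pi.sub_apply]
    ring
  set R : ℕ → ℝ → ℝ → ℂ := fun i s τ => ((K * ((i : ℝ) + 1) / 2 : ℝ) : ℂ) *
    (conj (z s) * u i s τ - z s * u (i + 2) s τ) with hR
  have hu2 : ∀ ℓ, Continuous fun x : ℝ × ℝ => u ℓ x.1 x.2 := h.continuous
  have hB0 : 0 ≤ B := (norm_nonneg _).trans (hB 0 0 0)
  have hRB : ∀ i s τ, ‖R i s τ‖ ≤ K * ((i : ℝ) + 1) / 2 * (B + B) := by
    intro i s τ
    simp only [hR]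
    rw [norm_mul, Complex.norm_real, Real.norm_of_nonneg (by positivity)]
    refine mul_le_mul_of_nonneg_left ((norm_sub_le _ _).trans ?_) (by positivity)
    rw [norm_mul, norm_mul, RCLike.norm_conj]
    have h1 := hz1 s
    have := mul_le_mul h1 (hB i s τ) (norm_nonneg _) zero_le_one
    have := mul_le_mul h1 (hB (i + 2) s τ) (norm_nonneg _) zero_le_one
    linarith
  have hE := fun i : ℕ => integral_weight_norm_sq_sub_eq (v := u (i + 1)) (r := R i)
    (m := (i : ℝ) + 1) (c := c i) (φ := φ) (φ' := cutoffWeightDeriv a η) (t := t) ht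
    (h.continuous _) (by simp only [hR, Function.uncurry_def]; fun_prop) (hB (i + 1)) (hRB i)
    (fun s ξ hs => h.transport i s ξ hs) (hc' i) (by simp only [hc]; fun_prop)
    (hasDerivAt_cutoffWeight hη.le) (continuous_cutoffWeightDeriv hη.le)
    (fun τ => (cutoffWeight_pos hη.le τ).le) (abs_cutoffWeightDeriv_le ha.le hη.le)
    (integrable_cutoffWeight ha hη)
  set P : ℕ → ℝ → ℝ → ℝ := fun i s τ =>
    ((-K - ((i : ℝ) + 1) * ((2 * K + 1) * q s)) * c i s * φ τ -
      ((i : ℝ) + 1) * c i s * cutoffWeightDeriv a η τ) * ‖u (i + 1) s τ‖ ^ 2 +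
      c i s * φ τ * (2 * inner ℝ (u (i + 1) s τ) (R i s τ)) with hP
  have hφint : Integrable φ := integrable_cutoffWeight ha hη
  have hu0int : Integrable fun τ => φ τ * ‖u 0 0 τ‖ ^ 2 := by
    have hc0 : Continuous φ := continuous_cutoffWeight hη.le
    refine (hφint.const_mul (B ^ 2)).mono' (by fun_prop) (ae_of_all _ fun τ => ?_)
    rw [norm_mul, norm_pow, norm_norm, Real.norm_of_nonneg (cutoffWeight_pos hη.le τ).le, mul_comm]
    exact mul_le_mul_of_nonneg_right (pow_le_pow_left₀ (norm_nonneg _) (hB 0 0 τ) 2)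
      (cutoffWeight_pos hη.le τ).le
  -- the pointwise inequality: interactions telescope up to terms absorbed by the weights
  have hpt : ∀ s ∈ Ioc 0 t, ∀ τ, ∑ i ∈ Finset.range L, P i s τ ≤
      K / 2 * (φ τ * ‖u 0 0 τ‖ ^ 2) + K * B ^ 2 * (L * Real.exp (-η) ^ L) * φ τ := by
    intro s hs τ
    set r := Real.exp (-q s) with hr
    have hqle : q s ≤ 1 / 2 := by
      refine le_trans ?_ hηt
      simp only [hq]
      gcongr
      exact hs.2
    have hqη : η ≤ q s := by
      have : 1 ≤ Real.exp ((2 * K + 1) * s) :=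
        Real.one_le_exp (mul_nonneg (by linarith) hs.1.le)
      simp only [hq]
      nlinarith
    have h1r : 1 - r ≤ q s := by linarith [Real.add_one_le_exp (-q s)]
    have hr2 : 1 / 2 ≤ r := by linarith
    have hr1 : r ≤ 1 := Real.exp_le_one_iff.2 (by linarith)
    have hr0 : 0 < r := Real.exp_pos _
    set x : ℕ → ℝ := fun i => ‖u i s τ‖ with hx
    set A : ℕ → ℝ := fun i => inner ℝ (u i s τ) (z s * u (i + 1) s τ) with hA
    have hAb : ∀ i, |A i| ≤ (x i ^ 2 + x (i + 1) ^ 2) / 2 := by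
      intro i
      refine (abs_real_inner_le_norm _ _).trans ?_
      rw [norm_mul]
      have h1 : ‖u i s τ‖ * (‖z s‖ * ‖u (i + 1) s τ‖) ≤ x i * (1 * x (i + 1)) := by
        gcongr
        exact hz1 s
      nlinarith [sq_nonneg (x i - x (i + 1))]
    have hinner : ∀ i : ℕ, inner ℝ (u (i + 1) s τ) (R i s τ) =
        K * ((i : ℝ) + 1) / 2 * (A i - A (i + 1)) := by
      intro i
      have h1 : inner ℝ (u (i + 1) s τ) (conj (z s) * u i s τ) = A i := by
        simp only [hA, Complex.inner, Complex.mul_re, Complex.mul_im, Complex.conj_re,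
          Complex.conj_im]
        ring
      simp only [hR]
      rw [← Complex.real_smul, real_inner_smul_right, inner_sub_right, h1]
    have hci : ∀ i, c i s = Real.exp (-K * s) * r ^ (i + 1) := by
      intro i
      rw [hr, ← Real.exp_nat_mul, ← Real.exp_add]
      simp only [hc]
      congr 1
      push_cast
      ring
    have hφ0 := cutoffWeight_pos (a := a) hη.le τ
    have hφ' := neg_mul_cutoffWeight_le_deriv ha.le hη.le τ
    have hK1 : Real.exp (-K * s) ≤ 1 := Real.exp_le_one_iff.2 (by nlinarith [hs.1])
    have hsum := sum_coupling_le hr2 hr1 hAb (fun i => norm_nonneg _) (fun i => hB i s τ) L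
    have hterm : ∀ i : ℕ, P i s τ ≤ Real.exp (-K * s) * φ τ * K *
        (((i : ℝ) + 1) * r ^ (i + 1) * (A i - A (i + 1)) -
          (1 + 3 / 2 * (1 - r) * ((i : ℝ) + 1)) * r ^ (i + 1) * x (i + 1) ^ 2) := by
      intro i
      simp only [hP]
      rw [hinner, hci]
      have hi : (0 : ℝ) ≤ i := Nat.cast_nonneg i
      have hcoef : (-K - ((i : ℝ) + 1) * ((2 * K + 1) * q s)) * φ τ -
          ((i : ℝ) + 1) * cutoffWeightDeriv a η τ ≤
          -(φ τ * K * (1 + 3 / 2 * (1 - r) * ((i : ℝ) + 1))) := by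
        have h1 : -((i : ℝ) + 1) * cutoffWeightDeriv a η τ ≤ ((i : ℝ) + 1) * (η * φ τ) := by
          nlinarith
        have h2 : η + 3 / 2 * (K * (1 - r)) ≤ (2 * K + 1) * q s := by
          nlinarith [mul_le_mul_of_nonneg_left h1r hK, mul_nonneg hK (hη.le.trans hqη)]
        have h3 := mul_le_mul_of_nonneg_left h2 (mul_nonneg (by linarith : (0 : ℝ) ≤ i + 1) hφ0.le)
        linarith
      have hw : 0 ≤ Real.exp (-K * s) * r ^ (i + 1) * x (i + 1) ^ 2 := by positivity
      have := mul_le_mul_of_nonneg_right hcoef hw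
      linarith
    calc ∑ i ∈ Finset.range L, P i s τ ≤ ∑ i ∈ Finset.range L, Real.exp (-K * s) * φ τ * K *
          (((i : ℝ) + 1) * r ^ (i + 1) * (A i - A (i + 1)) -
            (1 + 3 / 2 * (1 - r) * ((i : ℝ) + 1)) * r ^ (i + 1) * x (i + 1) ^ 2) :=
          Finset.sum_le_sum fun i _ => hterm i
      _ = Real.exp (-K * s) * φ τ * K * (∑ i ∈ Finset.range L,
            ((i : ℝ) + 1) * r ^ (i + 1) * (A i - A (i + 1)) - ∑ i ∈ Finset.range L,
            (1 + 3 / 2 * (1 - r) * ((i : ℝ) + 1)) * r ^ (i + 1) * x (i + 1) ^ 2) := by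
          rw [← Finset.mul_sum, Finset.sum_sub_distrib]
      _ ≤ 1 * φ τ * K * (x 0 ^ 2 / 2 + L * Real.exp (-η) ^ L * B ^ 2) := by
          have hrη : r ≤ Real.exp (-η) := Real.exp_le_exp.2 (by linarith)
          refine (mul_le_mul_of_nonneg_left (b := _) (c := x 0 ^ 2 / 2 + L * r ^ L * B ^ 2)
            (by linarith) (by positivity)).trans ?_
          gcongr
      _ = _ := by
          simp only [hx]
          rw [h.zero_mode s τ]
          ring
  have hsub : ∑ i ∈ Finset.range L, (∫ τ, c i t * φ τ * ‖u (i + 1) t τ‖ ^ 2) -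
      ∑ i ∈ Finset.range L, (∫ τ, c i 0 * φ τ * ‖u (i + 1) 0 τ‖ ^ 2) ≤
      t * (K / 2 * (∫ τ, φ τ * ‖u 0 0 τ‖ ^ 2) +
        K * B ^ 2 * (L * Real.exp (-η) ^ L) * ∫ τ, φ τ) := by
    have hle := sum_setIntegral_integral_le (P := P) (L := L) ht (fun i => (hE i).2.1)
      ((hu0int.const_mul (K / 2)).add
        (hφint.const_mul (K * B ^ 2 * (L * Real.exp (-η) ^ L)))) hpt
    rw [← Finset.sum_sub_distrib, Finset.sum_congr rfl fun i _ => (hE i).2.2]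
    refine hle.trans_eq ?_
    simp only [Pi.add_apply]
    rw [integral_add (hu0int.const_mul _) (hφint.const_mul _), integral_const_mul,
      integral_const_mul]
  have h0 : ∑ i ∈ Finset.range L, (∫ τ, c i 0 * φ τ * ‖u (i + 1) 0 τ‖ ^ 2) ≤
      ∑ i ∈ Finset.range L, ∫ τ, φ τ * ‖u (i + 1) 0 τ‖ ^ 2 := by
    refine Finset.sum_le_sum fun i _ => ?_
    simp_rw [mul_assoc, integral_const_mul]
    refine mul_le_of_le_one_left (integral_nonneg fun τ =>
      mul_nonneg (cutoffWeight_pos hη.le τ).le (by positivity)) ?_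
    refine Real.exp_le_one_iff.2 ?_
    simp only [hq]
    have : 0 ≤ ((i : ℝ) + 1) * (η * Real.exp ((2 * K + 1) * 0)) := by positivity
    linarith
  linarith

end IsModeHierarchy

/-- The squared norm of `L²(ℝ; e^{2aτ} dτ)`. -/
noncomputable def weightedL2Sq (a : ℝ) (u : ℝ → ℂ) : ℝ≥0∞ :=
  ∫⁻ τ, ENNReal.ofReal (expWeight a τ ^ 2 * ‖u τ‖ ^ 2)

lemma expWeight_pos (a τ : ℝ) : 0 < expWeight a τ := Real.exp_pos _

lemma expWeight_sq (a τ : ℝ) : expWeight a τ ^ 2 = Real.exp (2 * a * τ) := by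
  rw [expWeight, ← Real.exp_nat_mul]
  push_cast
  ring_nf

lemma continuous_expWeight (a : ℝ) : Continuous (expWeight a) := by
  unfold expWeight
  fun_prop

namespace IsModeHierarchy

variable {K : ℝ} {z : ℝ → ℂ} {u : ℕ → ℝ → ℝ → ℂ}

/-- The limit of `sum_integral_le` as the number of modes tends to infinity. -/
lemma sum_lintegral_le (h : IsModeHierarchy K z u) (hK : 0 ≤ K) (hz : Continuous z)
    (hz1 : ∀ s, ‖z s‖ ≤ 1) {a η t : ℝ} (ha : 0 < a) (hη : 0 < η)
    (ht : 0 ≤ t) (hηt : η * Real.exp ((2 * K + 1) * t) ≤ 1 / 2) (N : ℕ) :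
    ∑ i ∈ Finset.range N, (∫⁻ τ, ENNReal.ofReal (Real.exp (-K * t - ((i : ℝ) + 1) *
        (η * Real.exp ((2 * K + 1) * t))) * cutoffWeight a η τ * ‖u (i + 1) t τ‖ ^ 2)) ≤
      ∑' i, weightedL2Sq a (u (i + 1) 0) + ENNReal.ofReal (K * t) * weightedL2Sq a (u 0 0) := by
  obtain ⟨B, hB⟩ := h.bounded
  set S := ∑' i, weightedL2Sq a (u (i + 1) 0) + ENNReal.ofReal (K * t) * weightedL2Sq a (u 0 0)
  have hφ0 := fun τ => (cutoffWeight_pos (a := a) hη.le τ).le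
  have hφi := integrable_cutoffWeight (a := a) ha hη
  have hφc := continuous_cutoffWeight (a := a) hη.le
  have huc : ∀ ℓ s, Continuous (u ℓ s) := fun ℓ s =>
    (h.continuous ℓ).comp (f := fun τ : ℝ => (s, τ)) (by fun_prop)
  have hint : ∀ ℓ s, Integrable fun τ => cutoffWeight a η τ * ‖u ℓ s τ‖ ^ 2 := by
    intro ℓ s
    have := huc ℓ s
    refine (hφi.const_mul (B ^ 2)).mono' (by fun_prop) (ae_of_all _ fun τ => ?_)
    rw [norm_mul, norm_pow, norm_norm, Real.norm_of_nonneg (hφ0 τ), mul_comm]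
    exact mul_le_mul_of_nonneg_right (pow_le_pow_left₀ (norm_nonneg _) (hB ℓ s τ) 2) (hφ0 τ)
  have hle : ∀ ℓ s, ENNReal.ofReal (∫ τ, cutoffWeight a η τ * ‖u ℓ s τ‖ ^ 2) ≤
      weightedL2Sq a (u ℓ s) := by
    intro ℓ s
    rw [ofReal_integral_eq_lintegral_ofReal (hint ℓ s)
      (ae_of_all _ fun τ => mul_nonneg (hφ0 τ) (by positivity))]
    refine lintegral_mono fun τ => ENNReal.ofReal_le_ofReal ?_
    rw [expWeight_sq]
    exact mul_le_mul_of_nonneg_right (cutoffWeight_le_exp hη.le τ) (by positivity)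
  have hbound : ∀ L ≥ N, ∑ i ∈ Finset.range N, (∫⁻ τ, ENNReal.ofReal (Real.exp (-K * t -
      ((i : ℝ) + 1) * (η * Real.exp ((2 * K + 1) * t))) * cutoffWeight a η τ *
        ‖u (i + 1) t τ‖ ^ 2)) ≤
      S + ENNReal.ofReal (t * (K * B ^ 2 * (L * Real.exp (-η) ^ L) *
        ∫ τ, cutoffWeight a η τ)) := by
    intro L hL
    have hI : ∀ ℓ s, 0 ≤ ∫ τ, cutoffWeight a η τ * ‖u ℓ s τ‖ ^ 2 := fun ℓ s =>
      integral_nonneg fun τ => mul_nonneg (hφ0 τ) (by positivity)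
    have hφI : 0 ≤ ∫ τ, cutoffWeight a η τ := integral_nonneg hφ0
    calc _ ≤ ∑ i ∈ Finset.range L, (∫⁻ τ, ENNReal.ofReal (Real.exp (-K * t -
            ((i : ℝ) + 1) * (η * Real.exp ((2 * K + 1) * t))) * cutoffWeight a η τ *
              ‖u (i + 1) t τ‖ ^ 2)) :=
          Finset.sum_le_sum_of_subset (Finset.range_mono hL)
      _ = ENNReal.ofReal (∑ i ∈ Finset.range L, ∫ τ, (Real.exp (-K * t -
            ((i : ℝ) + 1) * (η * Real.exp ((2 * K + 1) * t))) * cutoffWeight a η τ *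
              ‖u (i + 1) t τ‖ ^ 2)) := by
          have hnn : ∀ (i : ℕ) τ, 0 ≤ Real.exp (-K * t -
            ((i : ℝ) + 1) * (η * Real.exp ((2 * K + 1) * t))) * cutoffWeight a η τ *
              ‖u (i + 1) t τ‖ ^ 2 := fun i τ =>
            mul_nonneg (mul_nonneg (Real.exp_pos _).le (hφ0 τ)) (by positivity)
          rw [ENNReal.ofReal_sum_of_nonneg fun i _ => integral_nonneg (hnn i)]
          refine Finset.sum_congr rfl fun i _ => ?_
          rw [ofReal_integral_eq_lintegral_ofReal _ (ae_of_all _ (hnn i))]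
          simp_rw [mul_assoc]
          exact (hint (i + 1) t).const_mul _
      _ ≤ ENNReal.ofReal (∑ i ∈ Finset.range L,
            (∫ τ, cutoffWeight a η τ * ‖u (i + 1) 0 τ‖ ^ 2) +
            K * t * (∫ τ, cutoffWeight a η τ * ‖u 0 0 τ‖ ^ 2) +
            t * (K * B ^ 2 * (L * Real.exp (-η) ^ L) * ∫ τ, cutoffWeight a η τ)) := by
          refine ENNReal.ofReal_le_ofReal ?_
          have h1 := h.sum_integral_le hK hz hz1 hB ha hη ht hηt L
          have h2 : 0 ≤ K * t * (∫ τ, cutoffWeight a η τ * ‖u 0 0 τ‖ ^ 2) :=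
            mul_nonneg (mul_nonneg hK ht) (hI 0 0)
          linarith
      _ ≤ _ := by
          refine ENNReal.ofReal_add_le.trans ?_
          refine add_le_add_left (ENNReal.ofReal_add_le.trans (add_le_add ?_ ?_)) _
          · rw [ENNReal.ofReal_sum_of_nonneg fun i _ => hI _ _]
            exact (Finset.sum_le_sum fun i _ => hle (i + 1) 0).trans (ENNReal.sum_le_tsum _)
          · rw [ENNReal.ofReal_mul (mul_nonneg hK ht)]
            exact mul_le_mul_right (hle 0 0) _
  have hlim : Tendsto (fun L : ℕ => S + ENNReal.ofReal (t * (K * B ^ 2 *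
      (L * Real.exp (-η) ^ L) * ∫ τ, cutoffWeight a η τ))) atTop (𝓝 (S + 0)) := by
    refine tendsto_const_nhds.add ?_
    rw [← ENNReal.ofReal_zero]
    refine ENNReal.tendsto_ofReal ?_
    have h1 := tendsto_self_mul_const_pow_of_lt_one (r := Real.exp (-η)) (Real.exp_pos _).le
      (Real.exp_lt_one_iff.2 (by linarith))
    have h2 := ((h1.const_mul (K * B ^ 2)).mul_const (∫ τ, cutoffWeight a η τ)).const_mul t
    simpa using h2
  rw [add_zero] at hlim
  exact ge_of_tendsto hlim (eventually_atTop.2 ⟨N, hbound⟩)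

/-- Propagation of exponentially weighted `L²` bounds by the hierarchy. -/
theorem tsum_weightedL2Sq_le (h : IsModeHierarchy K z u) (hK : 0 ≤ K) (hz : Continuous z)
    (hz1 : ∀ s, ‖z s‖ ≤ 1) {a t : ℝ} (ha : 0 < a) (ht : 0 ≤ t) :
    ∑' i, weightedL2Sq a (u (i + 1) t) ≤ ENNReal.ofReal (Real.exp (K * t)) *
      (∑' i, weightedL2Sq a (u (i + 1) 0) + ENNReal.ofReal (K * t) * weightedL2Sq a (u 0 0)) := by
  set S := ∑' i, weightedL2Sq a (u (i + 1) 0) + ENNReal.ofReal (K * t) * weightedL2Sq a (u 0 0)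
    with hS
  have huc : ∀ ℓ s, Continuous (u ℓ s) := fun ℓ s =>
    (h.continuous ℓ).comp (f := fun τ : ℝ => (s, τ)) (by fun_prop)
  have hmain : ∑' i, ENNReal.ofReal (Real.exp (-K * t)) * weightedL2Sq a (u (i + 1) t) ≤ S := by
    refine ENNReal.tsum_le_of_sum_range_le fun N => ?_
    set η : ℕ → ℝ := fun k => 1 / ((k : ℝ) + 1) with hη
    have hη0 : ∀ k, 0 < η k := fun k => Nat.one_div_pos_of_nat
    have hηlim : Tendsto η atTop (𝓝 0) := tendsto_one_div_add_atTop_nhds_zero_nat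
    set F : ℕ → ℝ → ℝ≥0∞ := fun k τ => ∑ i ∈ Finset.range N,
      ENNReal.ofReal (Real.exp (-K * t - ((i : ℝ) + 1) * (η k * Real.exp ((2 * K + 1) * t))) *
        cutoffWeight a (η k) τ * ‖u (i + 1) t τ‖ ^ 2) with hF
    have hmeas : ∀ k (i : ℕ), Measurable fun τ => ENNReal.ofReal (Real.exp (-K * t -
        ((i : ℝ) + 1) * (η k * Real.exp ((2 * K + 1) * t))) *
        cutoffWeight a (η k) τ * ‖u (i + 1) t τ‖ ^ 2) := by
      intro k i
      have h1 := continuous_cutoffWeight (a := a) (hη0 k).le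
      have h2 := huc (i + 1) t
      exact (ENNReal.continuous_ofReal.comp (by fun_prop)).measurable
    have hFmeas : ∀ k, Measurable (F k) := fun k =>
      Finset.measurable_sum _ fun i _ => hmeas k i
    have hlimF : ∀ τ, Tendsto (fun k => F k τ) atTop (𝓝 (∑ i ∈ Finset.range N,
        ENNReal.ofReal (Real.exp (-K * t) * (expWeight a τ ^ 2 * ‖u (i + 1) t τ‖ ^ 2)))) := by
      intro τ
      refine tendsto_finsetSum _ fun i _ => ENNReal.tendsto_ofReal ?_
      rw [expWeight_sq, ← mul_assoc]
      refine Tendsto.mul_const _ (Tendsto.mul ?_ ((tendsto_cutoffWeight a τ).comp hηlim))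
      refine (Real.continuous_exp.tendsto _).comp ?_
      have := ((hηlim.mul_const (Real.exp ((2 * K + 1) * t))).const_mul ((i : ℝ) + 1)).const_sub
        (-K * t)
      simpa using this
    have hev : ∀ᶠ k in atTop, ∫⁻ τ, F k τ ≤ S := by
      have h1 : Tendsto (fun k => η k * Real.exp ((2 * K + 1) * t)) atTop (𝓝 0) := by
        simpa using hηlim.mul_const (Real.exp ((2 * K + 1) * t))
      filter_upwards [h1.eventually_le_const (show (0 : ℝ) < 1 / 2 by norm_num)] with k hk
      rw [lintegral_finsetSum _ fun i _ => hmeas k i]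
      exact h.sum_lintegral_le hK hz hz1 ha (hη0 k) ht hk N
    calc _ = ∫⁻ τ, ∑ i ∈ Finset.range N,
          ENNReal.ofReal (Real.exp (-K * t) * (expWeight a τ ^ 2 * ‖u (i + 1) t τ‖ ^ 2)) := by
          rw [lintegral_finsetSum]
          · refine Finset.sum_congr rfl fun i _ => ?_
            simp_rw [ENNReal.ofReal_mul (Real.exp_pos (-K * t)).le]
            rw [lintegral_const_mul' _ _ ENNReal.ofReal_ne_top, weightedL2Sq]
          · intro i _
            have h1 := continuous_expWeight a
            have h2 := huc (i + 1) t
            exact (ENNReal.continuous_ofReal.comp (by fun_prop)).measurable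
      _ = ∫⁻ τ, liminf (fun k => F k τ) atTop :=
          lintegral_congr fun τ => (hlimF τ).liminf_eq.symm
      _ ≤ liminf (fun k => ∫⁻ τ, F k τ) atTop := lintegral_liminf_le hFmeas
      _ ≤ S := liminf_le_of_frequently_le' hev.frequently
  rw [ENNReal.tsum_mul_left] at hmain
  calc _ = ENNReal.ofReal (Real.exp (K * t)) * (ENNReal.ofReal (Real.exp (-K * t)) *
        ∑' i, weightedL2Sq a (u (i + 1) t)) := by
        rw [← mul_assoc, ← ENNReal.ofReal_mul (Real.exp_pos _).le, ← Real.exp_add]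
        simp
    _ ≤ _ := mul_le_mul_right hmain _

/-- Difference quotients in `τ` of a hierarchy form a hierarchy with the same order parameter. -/
lemma diffQuotient (h : IsModeHierarchy K z u) (δ : ℝ) :
    IsModeHierarchy K z fun ℓ s τ => (u ℓ s (τ + δ) - u ℓ s τ) / (δ : ℂ) where
  continuous ℓ := by
    have hu : Continuous fun x : ℝ × ℝ => u ℓ x.1 x.2 := h.continuous ℓ
    have hu' : Continuous fun x : ℝ × ℝ => u ℓ x.1 (x.2 + δ) :=
      hu.comp (f := fun x : ℝ × ℝ => (x.1, x.2 + δ)) (by fun_prop)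
    exact (hu'.sub hu).div_const _
  bounded := by
    obtain ⟨B, hB⟩ := h.bounded
    refine ⟨(B + B) / ‖(δ : ℂ)‖, fun ℓ s τ => ?_⟩
    rw [norm_div]
    gcongr
    exact (norm_sub_le _ _).trans (add_le_add (hB _ _ _) (hB _ _ _))
  zero_mode s τ := by
    rw [h.zero_mode s, h.zero_mode s]
  transport ℓ s ξ hs := by
    have h1 := h.transport ℓ s (ξ + δ) hs
    have h2 := h.transport ℓ s ξ hs
    have h3 := (h1.sub h2).div_const (δ : ℂ)
    have hsw : ∀ σ : ℝ, ξ + δ - ((ℓ : ℝ) + 1) * σ = ξ - ((ℓ : ℝ) + 1) * σ + δ := fun σ => by ring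
    simp only [hsw] at h3
    refine h3.congr_deriv ?_
    ring

end IsModeHierarchy

/-! ### Weak derivatives and difference quotients -/

lemma lintegral_mul_sq_le {α : Type*} [MeasurableSpace α] {μ : Measure α} {f g : α → ℝ≥0∞}
    (hf : AEMeasurable f μ) (hg : AEMeasurable g μ) :
    (∫⁻ x, f x * g x ∂μ) ^ 2 ≤ (∫⁻ x, f x ^ 2 ∂μ) * ∫⁻ x, g x ^ 2 ∂μ := by
  have h := ENNReal.lintegral_mul_le_Lp_mul_Lq μ Real.HolderConjugate.two_two hf hg
  have h2 := pow_le_pow_left' h 2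
  refine h2.trans_eq ?_
  rw [mul_pow]
  congr 1 <;>
  · rw [← ENNReal.rpow_natCast, ← ENNReal.rpow_mul]
    simp

lemma ofReal_mul_norm_sq {E : Type*} [NormedAddCommGroup E] {c : ℝ} (hc : 0 ≤ c) (x : E) :
    ENNReal.ofReal (c ^ 2 * ‖x‖ ^ 2) = ENNReal.ofReal c ^ 2 * ‖x‖ₑ ^ 2 := by
  rw [ENNReal.ofReal_mul (by positivity), ENNReal.ofReal_pow hc, ENNReal.ofReal_pow (norm_nonneg _),
    ofReal_norm]

lemma weightedL2Sq_eq (a : ℝ) (u : ℝ → ℂ) :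
    weightedL2Sq a u = ∫⁻ τ, ENNReal.ofReal (expWeight a τ) ^ 2 * ‖u τ‖ₑ ^ 2 := by
  simp only [weightedL2Sq, ofReal_mul_norm_sq (expWeight_pos a _).le]

lemma measurable_ofReal_expWeight (a : ℝ) :
    Measurable fun τ => ENNReal.ofReal (expWeight a τ) :=
  (ENNReal.continuous_ofReal.comp (continuous_expWeight a)).measurable

lemma weightedL2Sq_add_le {a : ℝ} {u v : ℝ → ℂ} (hu : AEStronglyMeasurable u) :
    weightedL2Sq a (u + v) ≤ 2 * (weightedL2Sq a u + weightedL2Sq a v) := by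
  have hw := (continuous_expWeight a).measurable
  simp only [weightedL2Sq]
  rw [← lintegral_add_left']
  · rw [← lintegral_const_mul' _ _ ENNReal.ofNat_ne_top]
    refine lintegral_mono fun τ => ?_
    rw [← ENNReal.ofReal_add (by positivity) (by positivity), show (2 : ℝ≥0∞) =
      ENNReal.ofReal 2 by simp, ← ENNReal.ofReal_mul (by norm_num)]
    refine ENNReal.ofReal_le_ofReal ?_
    have h1 : ‖u τ + v τ‖ ^ 2 ≤ 2 * (‖u τ‖ ^ 2 + ‖v τ‖ ^ 2) := by
      have := pow_le_pow_left₀ (norm_nonneg _) (norm_add_le (u τ) (v τ)) 2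
      nlinarith [sq_nonneg (‖u τ‖ - ‖v τ‖)]
    have := mul_le_mul_of_nonneg_left h1 (sq_nonneg (expWeight a τ))
    simp only [Pi.add_apply]
    linarith
  · have := hu.norm.aemeasurable
    exact ((hw.pow_const 2).aemeasurable.mul (this.pow_const 2)).ennreal_ofReal

/-- A weight-multiplied function with finite weighted norm is square integrable. -/
lemma memLp_expWeight_mul {a : ℝ} {u : ℝ → ℂ} (hu : AEStronglyMeasurable u)
    (h : weightedL2Sq a u < ⊤) : MemLp (fun τ => (expWeight a τ : ℂ) * u τ) 2 := by
  have hw := continuous_expWeight a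
  refine ⟨(Continuous.aestronglyMeasurable (by fun_prop)).mul hu, ?_⟩
  rw [eLpNorm_lt_top_iff_lintegral_rpow_enorm_lt_top two_ne_zero ENNReal.ofNat_ne_top]
  refine lt_of_le_of_lt (le_of_eq ?_) h
  rw [weightedL2Sq_eq]
  refine lintegral_congr fun τ => ?_
  simp only [ENNReal.toReal_ofNat, ENNReal.rpow_ofNat]
  rw [enorm_mul, mul_pow, ← ofReal_norm, Complex.norm_real,
    Real.norm_of_nonneg (expWeight_pos a τ).le]

lemma locallyIntegrable_of_weightedL2Sq_lt_top {a : ℝ} {u : ℝ → ℂ} (hu : AEStronglyMeasurable u)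
    (h : weightedL2Sq a u < ⊤) : LocallyIntegrable u := by
  have h1 := (memLp_expWeight_mul hu h).locallyIntegrable (by norm_num)
  have h2 : Continuous fun τ => ((expWeight (-a) τ : ℝ) : ℂ) :=
    Complex.continuous_ofReal.comp (continuous_expWeight (-a))
  have h3 := h1.continuous_mul h2
  refine h3.congr (ae_of_all _ fun τ => ?_)
  simp only
  rw [← mul_assoc, ← Complex.ofReal_mul, expWeight, expWeight, ← Real.exp_add]
  simp

/-- The fundamental theorem of calculus for a continuous function with a weak derivative. The test
functions are smooth trapezoids converging to the indicator of `(x, y)`. -/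
lemma HasWeakDerivOn.sub_eq_integral {Ω : Set ℝ} {u v : ℝ → ℂ} (h : HasWeakDerivOn Ω u v)
    (hu : Continuous u) {x y : ℝ} (hxy : x < y) (hΩ : Icc x y ⊆ Ω) :
    u y - u x = ∫ τ in x..y, v τ := by
  set S := Real.smoothTransition with hS
  have hSd : ContDiff ℝ ((⊤ : ℕ∞) : WithTop ℕ∞) S := Real.smoothTransition.contDiff
  have hSdiff : Differentiable ℝ S := hSd.differentiable (by simp)
  have hS'c : Continuous (deriv S) := hSd.continuous_deriv (by simp)
  have hS'0 : ∀ σ, σ ∉ Icc (0 : ℝ) 1 → deriv S σ = 0 := by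
    intro σ hσ
    rw [mem_Icc, not_and_or, not_le, not_le] at hσ
    rcases hσ with hσ | hσ
    · have : S =ᶠ[𝓝 σ] fun _ => 0 := by
        filter_upwards [Iio_mem_nhds hσ] with r hr
        exact Real.smoothTransition.zero_of_nonpos (le_of_lt hr)
      rw [this.deriv_eq, deriv_const]
    · have : S =ᶠ[𝓝 σ] fun _ => 1 := by
        filter_upwards [Ioi_mem_nhds hσ] with r hr
        exact Real.smoothTransition.one_of_one_le (le_of_lt hr)
      rw [this.deriv_eq, deriv_const]
  have hS'1 : ∫ σ in (0 : ℝ)..1, deriv S σ = 1 := by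
    rw [intervalIntegral.integral_deriv_eq_sub (fun σ _ => hSdiff σ) (hS'c.intervalIntegrable _ _)]
    simp [hS]
  have hS'cs : HasCompactSupport (deriv S) := HasCompactSupport.intro isCompact_Icc hS'0
  have hS'1c : ∫ σ, ((deriv S σ : ℝ) : ℂ) = 1 := by
    rw [integral_complex_ofReal, ← setIntegral_eq_integral_of_forall_compl_eq_zero
      (s := Icc 0 1) hS'0, integral_Icc_eq_integral_Ioc,
      ← intervalIntegral.integral_of_le zero_le_one, hS'1]
    simp
  set n : ℕ → ℝ := fun k => (k : ℝ) + 1 with hn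
  have hn0 : ∀ k, 0 < n k := fun k => by positivity
  have hninv : Tendsto (fun k => (n k)⁻¹) atTop (𝓝 0) := by
    simpa [hn, one_div] using tendsto_one_div_add_atTop_nhds_zero_nat (𝕜 := ℝ)
  have hntop : Tendsto n atTop atTop :=
    tendsto_atTop_add_const_right _ _ tendsto_natCast_atTop_atTop
  set χ : ℕ → ℝ → ℝ := fun k τ => S (n k * (τ - x)) - S (n k * (τ - y) + 1) with hχ
  -- the limit of the mollified point values
  have hpoint : ∀ (b c : ℝ), Tendsto (fun k => ∫ τ, ((n k * deriv S (n k * (τ - b) + c) : ℝ) : ℂ) *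
      u τ) atTop (𝓝 (u b)) := by
    intro b c
    have hcv : ∀ k, ∫ τ, ((n k * deriv S (n k * (τ - b) + c) : ℝ) : ℂ) * u τ =
        ∫ σ, ((deriv S σ : ℝ) : ℂ) * u (b + (σ - c) * (n k)⁻¹) := by
      intro k
      have hk := (hn0 k).ne'
      set F : ℝ → ℂ := fun σ => ((deriv S σ : ℝ) : ℂ) * u (b + (σ - c) * (n k)⁻¹) with hF
      have h1 : (fun τ => ((n k * deriv S (n k * (τ - b) + c) : ℝ) : ℂ) * u τ) =
          fun τ => (n k) • (fun ρ => F (n k * ρ)) (τ - (b - c * (n k)⁻¹)) := by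
        funext τ
        have e1 : n k * (τ - (b - c * (n k)⁻¹)) = n k * (τ - b) + c := by field_simp; ring
        have e2 : b + (n k * (τ - b) + c - c) * (n k)⁻¹ = τ := by field_simp; ring
        simp only [hF]
        rw [e1, e2, Complex.real_smul]
        push_cast
        ring
      rw [h1, integral_smul, integral_sub_right_eq_self (fun ρ => F (n k * ρ)),
        Measure.integral_comp_mul_left, abs_of_pos (inv_pos.2 (hn0 k)), smul_smul,
        mul_inv_cancel₀ hk, one_smul]
    simp_rw [hcv]
    have hlim : u b = ∫ σ, ((deriv S σ : ℝ) : ℂ) * u b := by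
      rw [integral_mul_const, hS'1c, one_mul]
    rw [hlim]
    obtain ⟨C, hC⟩ := (isCompact_Icc (a := b - (1 + |c|)) (b := b + (1 + |c|))).exists_bound_of_continuousOn
      hu.continuousOn
    refine tendsto_integral_of_dominated_convergence (fun σ => |deriv S σ| * C) ?_ ?_ ?_ ?_
    · intro k
      exact Continuous.aestronglyMeasurable (by fun_prop)
    · exact ((hS'c.integrable_of_hasCompactSupport hS'cs).abs).mul_const C
    · intro k
      refine ae_of_all _ fun σ => ?_
      rw [norm_mul, Complex.norm_real, Real.norm_eq_abs]
      by_cases hσ : σ ∈ Icc (0 : ℝ) 1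
      · refine mul_le_mul_of_nonneg_left (hC _ ?_) (abs_nonneg _)
        have h1 : |(σ - c) * (n k)⁻¹| ≤ 1 + |c| := by
          rw [abs_mul, abs_of_pos (inv_pos.2 (hn0 k))]
          have h2 : |σ - c| ≤ 1 + |c| := (abs_sub _ _).trans (by
            rw [abs_of_nonneg hσ.1]; linarith [hσ.2])
          have h3 : (n k)⁻¹ ≤ 1 := inv_le_one_of_one_le₀ (by simp [hn])
          exact (mul_le_mul h2 h3 (inv_pos.2 (hn0 k)).le (by positivity)).trans_eq (mul_one _)
        rw [abs_le] at h1
        exact ⟨by linarith [h1.1], by linarith [h1.2]⟩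
      · simp [hS'0 σ hσ]
    · refine ae_of_all _ fun σ => Tendsto.const_mul _ ?_
      refine (hu.tendsto b).comp ?_
      simpa using (hninv.const_mul (σ - c)).const_add b
  have hχsmooth : ∀ k, ContDiff ℝ ((⊤ : ℕ∞) : WithTop ℕ∞) (χ k) := fun k =>
    (hSd.comp (by fun_prop)).sub (hSd.comp (by fun_prop))
  have hev : ∀ᶠ k in atTop, 1 ≤ n k * (y - x) :=
    (hntop.atTop_mul_const (sub_pos.2 hxy)).eventually_ge_atTop 1
  have hχ0 : ∀ k, 1 ≤ n k * (y - x) → ∀ τ, τ ∉ Icc x y → χ k τ = 0 := by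
    intro k hk τ hτ
    have hk0 := hn0 k
    rw [mem_Icc, not_and_or, not_le, not_le] at hτ
    simp only [hχ, hS]
    rcases hτ with hτ | hτ
    · rw [Real.smoothTransition.zero_of_nonpos (by nlinarith),
        Real.smoothTransition.zero_of_nonpos (by nlinarith), sub_zero]
    · rw [Real.smoothTransition.one_of_one_le (by nlinarith),
        Real.smoothTransition.one_of_one_le (by nlinarith), sub_self]
  have hχ' : ∀ k τ, deriv (χ k) τ =
      n k * deriv S (n k * (τ - x) + 0) - n k * deriv S (n k * (τ - y) + 1) := by
    intro k τ
    have h1 : HasDerivAt (fun τ => n k * (τ - x)) (n k) τ := by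
      simpa using ((hasDerivAt_id τ).sub_const x).const_mul (n k)
    have h2 : HasDerivAt (fun τ => n k * (τ - y) + 1) (n k) τ := by
      simpa using (((hasDerivAt_id τ).sub_const y).const_mul (n k)).add_const 1
    have h3 := ((hSdiff _).hasDerivAt.comp τ h1).sub ((hSdiff _).hasDerivAt.comp τ h2)
    rw [add_zero]
    refine (HasDerivAt.deriv h3).trans ?_
    ring
  have hint : ∀ (k : ℕ) (b c : ℝ), Integrable fun τ =>
      ((n k * deriv S (n k * (τ - b) + c) : ℝ) : ℂ) * u τ := by
    intro k b c
    refine Continuous.integrable_of_hasCompactSupport (by fun_prop) ?_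
    refine HasCompactSupport.mul_right ?_
    refine HasCompactSupport.intro (K := Icc (b + (0 - c) * (n k)⁻¹) (b + (1 - c) * (n k)⁻¹))
      isCompact_Icc fun τ hτ => ?_
    have hk := hn0 k
    have : n k * (τ - b) + c ∉ Icc (0 : ℝ) 1 := by
      intro hmem
      apply hτ
      rw [mem_Icc, ← div_eq_mul_inv, ← div_eq_mul_inv, ← sub_le_iff_le_add', ← le_sub_iff_add_le',
        div_le_iff₀ hk, le_div_iff₀ hk]
      exact ⟨by linarith [hmem.1], by linarith [hmem.2]⟩
    simp [hS'0 _ this]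
  have hleft : Tendsto (fun k => ∫ τ in Ω, ((deriv (χ k) τ : ℝ) : ℂ) * u τ) atTop
      (𝓝 (u x - u y)) := by
    refine ((hpoint x 0).sub (hpoint y 1)).congr' ?_
    filter_upwards [hev] with k hk
    rw [← integral_sub (hint k x 0) (hint k y 1), setIntegral_eq_integral_of_forall_compl_eq_zero]
    · refine integral_congr_ae (ae_of_all _ fun τ => ?_)
      simp only
      rw [hχ']
      push_cast
      ring
    · intro τ hτ
      have : χ k =ᶠ[𝓝 τ] fun _ => 0 := by
        filter_upwards [isClosed_Icc.isOpen_compl.mem_nhds fun h' => hτ (hΩ h')] with r hr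
        exact hχ0 k hk r hr
      rw [this.deriv_eq, deriv_const]
      simp
  have hvint : IntegrableOn v (Icc x y) := h.locInt_deriv.integrableOn_compact_subset hΩ isCompact_Icc
  have hright : Tendsto (fun k => -∫ τ in Ω, (χ k τ : ℂ) * v τ) atTop
      (𝓝 (-∫ τ in Icc x y, v τ)) := by
    refine Tendsto.neg ?_
    have h1 : Tendsto (fun k => ∫ τ in Icc x y, (χ k τ : ℂ) * v τ) atTop
        (𝓝 (∫ τ in Icc x y, v τ)) := by
      refine tendsto_integral_of_dominated_convergence (fun τ => 2 * ‖v τ‖) ?_ ?_ ?_ ?_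
      · intro k
        have := (hχsmooth k).continuous
        exact (Continuous.aestronglyMeasurable (by fun_prop)).mul hvint.aestronglyMeasurable
      · exact hvint.norm.const_mul 2
      · intro k
        refine ae_of_all _ fun τ => ?_
        rw [norm_mul, Complex.norm_real]
        refine mul_le_mul_of_nonneg_right ?_ (norm_nonneg _)
        refine (norm_sub_le _ _).trans ?_
        rw [Real.norm_of_nonneg (Real.smoothTransition.nonneg _),
          Real.norm_of_nonneg (Real.smoothTransition.nonneg _)]
        linarith [Real.smoothTransition.le_one (n k * (τ - x)),
          Real.smoothTransition.le_one (n k * (τ - y) + 1)]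
      · have hne : ∀ᵐ τ ∂(volume.restrict (Icc x y)), τ ∈ Ioo x y := by
          rw [← restrict_Ioo_eq_restrict_Icc]
          exact ae_restrict_mem measurableSet_Ioo
        filter_upwards [hne] with τ hτ
        refine tendsto_const_nhds.congr' ?_
        filter_upwards [(hntop.atTop_mul_const (sub_pos.2 hτ.1)).eventually_ge_atTop 1,
          (hntop.atTop_mul_const (sub_pos.2 hτ.2)).eventually_ge_atTop 1] with k h1 h2
        simp only [hχ, hS]
        rw [Real.smoothTransition.one_of_one_le h1,
          Real.smoothTransition.zero_of_nonpos (by linarith)]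
        simp
    refine h1.congr' ?_
    filter_upwards [hev] with k hk
    rw [setIntegral_eq_integral_of_forall_compl_eq_zero,
      setIntegral_eq_integral_of_forall_compl_eq_zero]
    · intro τ hτ
      simp [hχ0 k hk τ fun h' => hτ (hΩ h')]
    · intro τ hτ
      simp [hχ0 k hk τ hτ]
  have heq : u x - u y = -∫ τ in Icc x y, v τ := by
    refine tendsto_nhds_unique_of_eventuallyEq hleft hright ?_
    filter_upwards [hev] with k hk
    refine h.integral_eq (χ k) (hχsmooth k) (HasCompactSupport.intro isCompact_Icc (hχ0 k hk)) ?_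
    refine (closure_minimal ?_ isClosed_Icc).trans hΩ
    intro τ hτ
    by_contra hcon
    exact hτ (hχ0 k hk τ hcon)
  rw [intervalIntegral.integral_of_le hxy.le, ← integral_Icc_eq_integral_Ioc]
  linear_combination -heq

/-- Forward difference quotients are controlled by the derivative in `L²(e^{2aτ} dτ)`, `a ≥ 0`,
because the weight increases. -/
lemma weightedL2Sq_diffQuotient_le {a δ : ℝ} (ha : 0 ≤ a) (hδ : 0 < δ) {u v : ℝ → ℂ}
    (hv : AEStronglyMeasurable v) (h : ∀ x, u (x + δ) - u x = ∫ τ in x..x + δ, v τ) :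
    weightedL2Sq a (fun τ => (u (τ + δ) - u τ) / (δ : ℂ)) ≤ weightedL2Sq a v := by
  obtain ⟨v', hv'm, hv'⟩ := hv
  have h' : ∀ x, u (x + δ) - u x = ∫ τ in x..x + δ, v' τ := fun x => by
    rw [h x]
    exact intervalIntegral.integral_congr_ae (hv'.mono fun τ hτ _ => hτ)
  have hvv : weightedL2Sq a v = weightedL2Sq a v' := by
    refine lintegral_congr_ae ?_
    filter_upwards [hv'] with τ hτ
    rw [hτ]
  rw [hvv, weightedL2Sq_eq, weightedL2Sq_eq]
  have hvm : Measurable fun τ => ‖v' τ‖ₑ := hv'm.measurable.enorm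
  have hδ' : ENNReal.ofReal δ ≠ 0 := by simpa using hδ
  have hwm := measurable_ofReal_expWeight a
  have hpt : ∀ τ, ENNReal.ofReal (expWeight a τ) ^ 2 * ‖(u (τ + δ) - u τ) / (δ : ℂ)‖ₑ ^ 2 ≤
      (ENNReal.ofReal δ)⁻¹ * ∫⁻ σ in Ioc 0 δ,
        ENNReal.ofReal (expWeight a (τ + σ)) ^ 2 * ‖v' (τ + σ)‖ₑ ^ 2 := by
    intro τ
    have h1 : ‖u (τ + δ) - u τ‖ₑ ^ 2 ≤
        ENNReal.ofReal δ * ∫⁻ σ in Ioc 0 δ, ‖v' (τ + σ)‖ₑ ^ 2 := by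
      rw [h' τ, intervalIntegral.integral_of_le (by linarith)]
      have e1 : ∫ σ in Ioc τ (τ + δ), v' σ = ∫ σ in Ioc 0 δ, v' (τ + σ) := by
        rw [← intervalIntegral.integral_of_le (by linarith), ← intervalIntegral.integral_of_le hδ.le,
          intervalIntegral.integral_comp_add_left, add_zero]
      rw [e1]
      refine (pow_le_pow_left' (enorm_integral_le_lintegral_enorm _) 2).trans ?_
      have h2 := lintegral_mul_sq_le (μ := volume.restrict (Ioc 0 δ)) (f := fun _ => 1)
        (g := fun σ => ‖v' (τ + σ)‖ₑ) aemeasurable_const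
        (hvm.comp (measurable_const_add τ)).aemeasurable
      simpa using h2
    have h3 : ‖(u (τ + δ) - u τ) / (δ : ℂ)‖ₑ ^ 2 ≤
        (ENNReal.ofReal δ)⁻¹ * ∫⁻ σ in Ioc 0 δ, ‖v' (τ + σ)‖ₑ ^ 2 := by
      have e : ‖(u (τ + δ) - u τ) / (δ : ℂ)‖ₑ = (ENNReal.ofReal δ)⁻¹ * ‖u (τ + δ) - u τ‖ₑ := by
        rw [div_eq_mul_inv, enorm_mul, mul_comm, enorm_inv (by exact_mod_cast hδ.ne'),
          ← ofReal_norm (δ : ℂ), Complex.norm_real, Real.norm_of_nonneg hδ.le]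
      rw [e, mul_pow]
      refine (mul_le_mul_right h1 _).trans_eq ?_
      rw [sq, mul_assoc, ← mul_assoc (ENNReal.ofReal δ)⁻¹ (ENNReal.ofReal δ),
        ENNReal.inv_mul_cancel hδ' ENNReal.ofReal_ne_top, one_mul]
    calc _ ≤ ENNReal.ofReal (expWeight a τ) ^ 2 *
          ((ENNReal.ofReal δ)⁻¹ * ∫⁻ σ in Ioc 0 δ, ‖v' (τ + σ)‖ₑ ^ 2) := mul_le_mul_right h3 _
      _ = (ENNReal.ofReal δ)⁻¹ * ∫⁻ σ in Ioc 0 δ,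
          ENNReal.ofReal (expWeight a τ) ^ 2 * ‖v' (τ + σ)‖ₑ ^ 2 := by
        rw [lintegral_const_mul' _ _ (ENNReal.pow_ne_top ENNReal.ofReal_ne_top)]
        ring
      _ ≤ _ := by
        refine mul_le_mul_right ?_ _
        refine setLIntegral_mono_ae' measurableSet_Ioc (ae_of_all _ fun σ hσ => ?_)
        gcongr
        exact Real.exp_le_exp.2 (mul_le_mul_of_nonneg_left (by linarith [hσ.1]) ha)
  have hm2 : Measurable fun τ => ENNReal.ofReal (expWeight a τ) ^ 2 * ‖v' τ‖ₑ ^ 2 :=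
    (hwm.pow_const 2).mul (hvm.pow_const 2)
  calc _ ≤ ∫⁻ τ, (ENNReal.ofReal δ)⁻¹ * ∫⁻ σ in Ioc 0 δ,
        ENNReal.ofReal (expWeight a (τ + σ)) ^ 2 * ‖v' (τ + σ)‖ₑ ^ 2 := lintegral_mono hpt
    _ = (ENNReal.ofReal δ)⁻¹ * ∫⁻ σ in Ioc 0 δ, ∫⁻ τ,
        ENNReal.ofReal (expWeight a (τ + σ)) ^ 2 * ‖v' (τ + σ)‖ₑ ^ 2 := by
      rw [lintegral_const_mul' _ _ (ENNReal.inv_ne_top.2 hδ'), lintegral_lintegral_swap]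
      exact (hm2.comp measurable_add).aemeasurable
    _ = (ENNReal.ofReal δ)⁻¹ * ∫⁻ σ in Ioc 0 δ, ∫⁻ τ,
        ENNReal.ofReal (expWeight a τ) ^ 2 * ‖v' τ‖ₑ ^ 2 := by
      congr 1
      refine lintegral_congr fun σ => ?_
      exact lintegral_add_right_eq_self
        (fun τ => ENNReal.ofReal (expWeight a τ) ^ 2 * ‖v' τ‖ₑ ^ 2) σ
    _ = _ := by
      rw [lintegral_const, Measure.restrict_apply_univ, Real.volume_Ioc, sub_zero, mul_comm,
        mul_assoc, ENNReal.mul_inv_cancel hδ' ENNReal.ofReal_ne_top, mul_one]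

lemma weightedL2Sq_le_weightedH1Sq (a : ℝ) (u : ℝ → ℂ) :
    weightedL2Sq a u ≤ weightedH1Sq univ (expWeight a) u := by
  refine le_iInf₂ fun v _ => ?_
  rw [setLIntegral_univ]
  refine lintegral_mono fun τ => ENNReal.ofReal_le_ofReal ?_
  exact mul_le_mul_of_nonneg_left (le_add_of_nonneg_right (by positivity)) (by positivity)

lemma weightedL2Sq_diffQuotient_le_weightedH1Sq {a δ : ℝ} (ha : 0 ≤ a) (hδ : 0 < δ) {u : ℝ → ℂ}
    (hu : Continuous u) :
    weightedL2Sq a (fun τ => (u (τ + δ) - u τ) / (δ : ℂ)) ≤ weightedH1Sq univ (expWeight a) u := by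
  refine le_iInf₂ fun v hv => ?_
  have hvm : LocallyIntegrable v := locallyIntegrableOn_univ.1 hv.locInt_deriv
  refine (weightedL2Sq_diffQuotient_le ha hδ hvm.aestronglyMeasurable fun x =>
    hv.sub_eq_integral hu (by linarith) (subset_univ _)).trans ?_
  rw [setLIntegral_univ]
  refine lintegral_mono fun τ => ENNReal.ofReal_le_ofReal ?_
  exact mul_le_mul_of_nonneg_left (le_add_of_nonneg_left (by positivity)) (by positivity)

lemma aestronglyMeasurable_expWeight_mul {a : ℝ} {u : ℝ → ℂ} (hu : AEStronglyMeasurable u) :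
    AEStronglyMeasurable fun τ => (expWeight a τ : ℂ) * u τ := by
  have hw := continuous_expWeight a
  exact (Continuous.aestronglyMeasurable (by fun_prop)).mul hu

lemma eLpNorm_expWeight_mul_sq (a : ℝ) (u : ℝ → ℂ) :
    eLpNorm (fun τ => (expWeight a τ : ℂ) * u τ) 2 ^ 2 = weightedL2Sq a u := by
  rw [eLpNorm_eq_lintegral_rpow_enorm_toReal two_ne_zero ENNReal.ofNat_ne_top,
    ← ENNReal.rpow_natCast, ← ENNReal.rpow_mul, weightedL2Sq_eq]
  simp only [ENNReal.toReal_ofNat, Nat.cast_ofNat, one_div, ne_eq, OfNat.ofNat_ne_zero,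
    not_false_eq_true, inv_mul_cancel₀, ENNReal.rpow_one, ENNReal.rpow_ofNat]
  refine lintegral_congr fun τ => ?_
  rw [enorm_mul, mul_pow, ← ofReal_norm, Complex.norm_real,
    Real.norm_of_nonneg (expWeight_pos a τ).le]

/-- Difference quotients tested against a smooth function converge to the distributional
derivative. -/
lemma tendsto_integral_mul_diffQuotient {u : ℝ → ℂ} (hu : Continuous u) {χ : ℝ → ℝ}
    (hχ : ContDiff ℝ ((⊤ : ℕ∞) : WithTop ℕ∞) χ) (hc : HasCompactSupport χ) {δ : ℕ → ℝ}
    (hδ : Tendsto δ atTop (𝓝[>] 0)) :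
    Tendsto (fun k => ∫ τ, (χ τ : ℂ) * ((u (τ + δ k) - u τ) / (δ k : ℂ))) atTop
      (𝓝 (-∫ τ, ((deriv χ τ : ℝ) : ℂ) * u τ)) := by
  have hχc : Continuous χ := hχ.continuous
  have hχd : Differentiable ℝ χ := hχ.differentiable (by simp)
  -- the reflected test function, so that shifts of the pairing become a convolution
  set ψ : ℝ → ℂ := fun s => ((χ (-s) : ℝ) : ℂ) with hψ
  have hψc : HasCompactSupport ψ := by
    have h1 : HasCompactSupport fun s : ℝ => χ (-s) := hc.comp_homeomorph (Homeomorph.neg ℝ)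
    exact h1.comp_left (g := fun r : ℝ => (r : ℂ)) (by simp)
  have hψd : ContDiff ℝ 1 ψ := by
    have h1 : ContDiff ℝ 1 χ := hχ.of_le (by exact_mod_cast le_top)
    exact Complex.ofRealCLM.contDiff.comp (h1.comp contDiff_neg)
  have hder : ∀ s, deriv ψ s = -((deriv χ (-s) : ℝ) : ℂ) := by
    intro s
    have h1 : HasDerivAt (fun s : ℝ => χ (-s)) (deriv χ (-s) * (-1)) s :=
      (hχd (-s)).hasDerivAt.comp s (hasDerivAt_neg s)
    refine h1.ofReal_comp.deriv.trans ?_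
    push_cast
    ring
  have hG := HasCompactSupport.hasDerivAt_convolution_right (ContinuousLinearMap.mul ℝ ℂ)
    (μ := volume) hu.locallyIntegrable hψc hψd 0
  have hslope := hG.tendsto_slope_zero_right.comp hδ
  have e1 : (convolution u (deriv ψ) (ContinuousLinearMap.mul ℝ ℂ) volume) 0 =
      -∫ τ, ((deriv χ τ : ℝ) : ℂ) * u τ := by
    rw [convolution_def, ← integral_neg]
    refine integral_congr_ae (ae_of_all _ fun τ => ?_)
    simp only [ContinuousLinearMap.mul_apply', hder]
    rw [zero_sub, neg_neg]
    ring
  rw [e1] at hslope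
  refine hslope.congr' ?_
  have hpos : ∀ᶠ k in atTop, 0 < δ k :=
    hδ.eventually (eventually_mem_nhdsWithin)
  filter_upwards [hpos] with k hk
  have hk0 : (δ k : ℂ) ≠ 0 := by exact_mod_cast hk.ne'
  have hint : ∀ x : ℝ, Integrable fun τ => u τ * ψ (x - τ) := by
    intro x
    refine Continuous.integrable_of_hasCompactSupport (by fun_prop) ?_
    exact HasCompactSupport.mul_left
      (hψc.comp_homeomorph ((Homeomorph.neg ℝ).trans (Homeomorph.addLeft x)) :
        HasCompactSupport (ψ ∘ ((Homeomorph.neg ℝ).trans (Homeomorph.addLeft x))))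
  have hconv : ∀ x : ℝ, (convolution u ψ (ContinuousLinearMap.mul ℝ ℂ) volume) x =
      ∫ τ, (χ τ : ℂ) * u (τ + x) := by
    intro x
    rw [convolution_def, ← integral_add_right_eq_self _ x]
    refine integral_congr_ae (ae_of_all _ fun τ => ?_)
    simp only [ContinuousLinearMap.mul_apply', hψ]
    rw [show -(x - (τ + x)) = τ by ring, mul_comm]
  have hintχ : ∀ x : ℝ, Integrable fun τ => (χ τ : ℂ) * u (τ + x) := by
    intro x
    refine Continuous.integrable_of_hasCompactSupport (by fun_prop) ?_
    exact (hc.comp_left (g := fun r : ℝ => (r : ℂ)) (by simp) :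
      HasCompactSupport fun τ => (χ τ : ℂ)).mul_right
  simp only [Function.comp_apply, zero_add]
  rw [hconv, hconv, ← integral_sub (hintχ _) (hintχ _), ← integral_smul]
  refine integral_congr_ae (ae_of_all _ fun τ => ?_)
  simp only [add_zero, Complex.real_smul]
  push_cast
  field_simp

lemma exists_hasWeakDerivOn_of_weightedH1Sq_lt {Ω : Set ℝ} {φ : ℝ → ℝ} {u : ℝ → ℂ} {R : ℝ≥0∞}
    (h : weightedH1Sq Ω φ u < R) : ∃ v, HasWeakDerivOn Ω u v ∧
      ∫⁻ τ in Ω, ENNReal.ofReal (φ τ ^ 2 * (‖u τ‖ ^ 2 + ‖v τ‖ ^ 2)) < R := by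
  simpa only [weightedH1Sq, iInf_lt_iff, exists_prop] using h

/-- Weak compactness: if difference quotients of `u` along some sequence of steps are infinitely
often bounded in `L²(e^{2aτ} dτ)`, then `u` has a weak derivative with the same bound. -/
lemma exists_hasWeakDerivOn_of_frequently {a : ℝ} {u : ℝ → ℂ} (hu : Continuous u) {δ : ℕ → ℝ}
    (hδ : Tendsto δ atTop (𝓝[>] 0)) {R : ℝ≥0∞} (hR : R ≠ ⊤)
    (hfreq : ∃ᶠ k in atTop, weightedL2Sq a (fun τ => (u (τ + δ k) - u τ) / (δ k : ℂ)) ≤ R) :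
    ∃ v, HasWeakDerivOn univ u v ∧ weightedL2Sq a v ≤ R := by
  set D : ℕ → ℝ → ℂ := fun k τ => (u (τ + δ k) - u τ) / (δ k : ℂ) with hD
  have hDc : ∀ k, Continuous (D k) := fun k => by simp only [hD]; fun_prop
  set G : Set ℕ := {k | weightedL2Sq a (D k) ≤ R} with hG
  have hmem : ∀ k ∈ G, MemLp (fun τ => (expWeight a τ : ℂ) * D k τ) 2 := fun k hk =>
    memLp_expWeight_mul (hDc k).aestronglyMeasurable (lt_of_le_of_lt hk hR.lt_top)
  classical
  set y : ℕ → Lp ℂ 2 (volume : Measure ℝ) := fun k =>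
    if hk : k ∈ G then (hmem k hk).toLp else 0 with hy
  have hynorm : ∀ k ∈ G, ‖y k‖ ≤ (R ^ (1 / 2 : ℝ)).toReal := by
    intro k hk
    simp only [hy, hk, dite_true]
    rw [Lp.norm_toLp]
    refine ENNReal.toReal_mono (ENNReal.rpow_ne_top_of_nonneg (by norm_num) hR) ?_
    rw [one_div, ENNReal.le_rpow_inv_iff (by norm_num)]
    rw [ENNReal.rpow_ofNat, eLpNorm_expWeight_mul_sq]
    exact hk
  have hne : (atTop ⊓ 𝓟 G).NeBot := frequently_mem_iff_neBot.1 hfreq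
  set U : Ultrafilter ℕ := Ultrafilter.of (atTop ⊓ 𝓟 G) with hU
  have hUle : (U : Filter ℕ) ≤ atTop ⊓ 𝓟 G := Ultrafilter.of_le _
  have hUG : ∀ᶠ k in (U : Filter ℕ), k ∈ G := hUle.trans inf_le_right (mem_principal_self G)
  -- Banach-Alaoglu along an ultrafilter that contains the good indices
  set Λ : ℕ → WeakDual ℂ (Lp ℂ 2 (volume : Measure ℝ)) := fun k =>
    StrongDual.toWeakDual (InnerProductSpace.toDual ℂ _ (y k)) with hΛ
  have hcpt := WeakDual.isCompact_closedBall (𝕜 := ℂ)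
    (0 : StrongDual ℂ (Lp ℂ 2 (volume : Measure ℝ))) (R ^ (1 / 2 : ℝ)).toReal
  obtain ⟨Λ₀, hΛ₀, hlim⟩ := hcpt.ultrafilter_le_nhds (U.map Λ) (by
    rw [le_principal_iff, Ultrafilter.coe_map, mem_map]
    filter_upwards [hUG] with k hk
    have h1 : ‖InnerProductSpace.toDual ℂ _ (y k)‖ ≤ (R ^ (1 / 2 : ℝ)).toReal := by
      rw [LinearIsometryEquiv.norm_map]
      exact hynorm k hk
    simpa [hΛ] using h1)
  obtain ⟨w, hw⟩ := (InnerProductSpace.toDual ℂ (Lp ℂ 2 (volume : Measure ℝ))).surjective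
    (WeakDual.toStrongDual Λ₀)
  have hwnorm : ‖w‖ ≤ (R ^ (1 / 2 : ℝ)).toReal := by
    rw [← LinearIsometryEquiv.norm_map (InnerProductSpace.toDual ℂ _) w, hw]
    simpa using hΛ₀
  have hweak : ∀ x : Lp ℂ 2 (volume : Measure ℝ),
      Tendsto (fun k => inner ℂ (y k) x) (U : Filter ℕ) (𝓝 (inner ℂ w x)) := by
    intro x
    have h1 : Tendsto Λ (U : Filter ℕ) (𝓝 Λ₀) := hlim
    have h2 := ((WeakDual.eval_continuous x).tendsto Λ₀).comp h1
    have h3 : Λ₀ x = inner ℂ w x := by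
      rw [← InnerProductSpace.toDual_apply_apply, hw]
      rfl
    rw [h3] at h2
    exact h2
  set v : ℝ → ℂ := fun τ => (expWeight (-a) τ : ℂ) * w τ with hv
  have hinv : ∀ τ, (expWeight a τ : ℂ) * (expWeight (-a) τ : ℂ) = 1 := fun τ => by
    rw [← Complex.ofReal_mul, expWeight, expWeight, ← Real.exp_add]
    simp
  have hwm : AEStronglyMeasurable w := Lp.aestronglyMeasurable w
  have hvm : AEStronglyMeasurable v := aestronglyMeasurable_expWeight_mul hwm
  have hvR : weightedL2Sq a v ≤ R := by
    rw [← eLpNorm_expWeight_mul_sq]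
    have e : (fun τ => (expWeight a τ : ℂ) * v τ) = w := by
      funext τ
      simp only [hv]
      rw [← mul_assoc, hinv, one_mul]
    rw [e]
    have h1 : eLpNorm w 2 ≤ R ^ (1 / 2 : ℝ) := by
      rw [Lp.norm_def] at hwnorm
      exact (ENNReal.toReal_le_toReal (Lp.eLpNorm_ne_top w)
        (ENNReal.rpow_ne_top_of_nonneg (by norm_num) hR)).1 hwnorm
    refine (pow_le_pow_left' h1 2).trans_eq ?_
    rw [← ENNReal.rpow_natCast, ← ENNReal.rpow_mul]
    simp
  refine ⟨v, ⟨locallyIntegrableOn_univ.2 hu.locallyIntegrable, locallyIntegrableOn_univ.2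
    (locallyIntegrable_of_weightedL2Sq_lt_top hvm (lt_of_le_of_lt hvR hR.lt_top)), ?_⟩, hvR⟩
  intro χ hχ hc _
  rw [setIntegral_univ, setIntegral_univ]
  have hχc : Continuous χ := hχ.continuous
  have hwc := continuous_expWeight (-a)
  have hxmem : MemLp (fun τ => (expWeight (-a) τ : ℂ) * (χ τ : ℂ)) 2 := by
    refine Continuous.memLp_of_hasCompactSupport (by fun_prop) ?_
    exact (hc.comp_left (g := fun r : ℝ => (r : ℂ)) (by simp) :
      HasCompactSupport fun τ => (χ τ : ℂ)).mul_left
  have hin : ∀ p : Lp ℂ 2 (volume : Measure ℝ), inner ℂ p (hxmem.toLp) =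
      conj (∫ τ, (χ τ : ℂ) * ((expWeight (-a) τ : ℂ) * p τ)) := by
    intro p
    rw [L2.inner_def, ← integral_conj]
    refine integral_congr_ae ?_
    filter_upwards [hxmem.coeFn_toLp] with τ hτ
    rw [hτ, RCLike.inner_apply']
    simp only [map_mul, Complex.conj_ofReal]
    ring
  have hlim1 := hweak hxmem.toLp
  have hlim2 : Tendsto (fun k => inner ℂ (y k) hxmem.toLp) (U : Filter ℕ)
      (𝓝 (conj (-∫ τ, ((deriv χ τ : ℝ) : ℂ) * u τ))) := by
    have h1 := ((tendsto_integral_mul_diffQuotient hu hχ hc hδ).mono_left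
      (hUle.trans inf_le_left))
    refine ((Complex.continuous_conj.tendsto _).comp h1).congr' ?_
    filter_upwards [hUG] with k hk
    rw [hin]
    simp only [Function.comp_apply]
    congr 1
    refine integral_congr_ae ?_
    have hyk : y k = (hmem k hk).toLp := by simp only [hy, hk, dite_true]
    rw [hyk]
    filter_upwards [(hmem k hk).coeFn_toLp] with τ hτ
    rw [hτ, ← mul_assoc (expWeight (-a) τ : ℂ), mul_comm (expWeight (-a) τ : ℂ), hinv, one_mul]
  have heq := tendsto_nhds_unique hlim1 hlim2
  rw [hin] at heq
  have := (starRingEnd ℂ).injective heq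
  rw [this, neg_neg]

lemma lintegral_weight_eq_add {a : ℝ} {u v : ℝ → ℂ} (hu : AEStronglyMeasurable u) :
    ∫⁻ τ in univ, ENNReal.ofReal (expWeight a τ ^ 2 * (‖u τ‖ ^ 2 + ‖v τ‖ ^ 2)) =
      weightedL2Sq a u + weightedL2Sq a v := by
  rw [setLIntegral_univ, weightedL2Sq, weightedL2Sq, ← lintegral_add_left']
  · refine lintegral_congr fun τ => ?_
    rw [← ENNReal.ofReal_add (by positivity) (by positivity), mul_add]
  · have h1 := (continuous_expWeight a).measurable
    have h2 := hu.norm.aemeasurable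
    exact ((h1.pow_const 2).aemeasurable.mul (h2.pow_const 2)).ennreal_ofReal

/-- The weighted `H¹` norm is bounded by the `L²` norm and the lower limit of the norms of the
difference quotients. -/
lemma weightedH1Sq_le_add_liminf {a : ℝ} {u : ℝ → ℂ} (hu : Continuous u) {δ : ℕ → ℝ}
    (hδ : Tendsto δ atTop (𝓝[>] 0)) :
    weightedH1Sq univ (expWeight a) u ≤ weightedL2Sq a u +
      liminf (fun k => weightedL2Sq a (fun τ => (u (τ + δ k) - u τ) / (δ k : ℂ))) atTop := by
  set M := liminf (fun k => weightedL2Sq a (fun τ => (u (τ + δ k) - u τ) / (δ k : ℂ))) atTop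
  have key : ∀ R : ℝ≥0∞, M < R → weightedH1Sq univ (expWeight a) u ≤ weightedL2Sq a u + R := by
    intro R hR
    rcases eq_or_ne R ⊤ with rfl | hRt
    · simp
    obtain ⟨v, hv, hvR⟩ := exists_hasWeakDerivOn_of_frequently hu hδ hRt
      ((frequently_lt_of_liminf_lt (by isBoundedDefault) hR).mono fun k hk => hk.le)
    exact (iInf₂_le v hv).trans ((lintegral_weight_eq_add hu.aestronglyMeasurable).trans_le
      (add_le_add_right hvR _))
  refine ENNReal.le_of_forall_pos_le_add fun ε hε hfin => ?_
  have hM : M ≠ ⊤ := ((le_add_self).trans_lt hfin).ne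
  rw [add_assoc]
  exact key _ (ENNReal.lt_add_right hM (by exact_mod_cast hε.ne'))

/-- A continuous function with the symmetry of the Fourier transform of a real function and finite
weighted `H¹` norm on the half line is the primitive of a function in `L²(ℝ; e^{2aτ} dτ)`: its
derivative on the negative half line is obtained by reflection, where the weight is smaller. -/
lemma exists_derivative_of_conj_symm {a : ℝ} (ha : 0 ≤ a) {u : ℝ → ℂ} (hu : Continuous u)
    (hsymm : ∀ τ, u (-τ) = conj (u τ)) (h : weightedH1Sq (Ioi 0) (expWeight a) u < ⊤) :
    ∃ v, AEStronglyMeasurable v ∧ weightedL2Sq a v < ⊤ ∧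
      ∀ x y, u y - u x = ∫ τ in x..y, v τ := by
  obtain ⟨v₀, hw, hfin⟩ := exists_hasWeakDerivOn_of_weightedH1Sq_lt h
  set p : ℝ → ℂ := (Ioi (0 : ℝ)).indicator v₀ with hp
  have hpm : AEStronglyMeasurable p := by
    rw [hp, aestronglyMeasurable_indicator_iff measurableSet_Ioi]
    exact hw.locInt_deriv.aestronglyMeasurable
  have hpn : AEStronglyMeasurable fun τ => conj (p (-τ)) :=
    Complex.continuous_conj.comp_aestronglyMeasurable
      (hpm.comp_quasiMeasurePreserving (Measure.measurePreserving_neg volume).quasiMeasurePreserving)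
  have hpfin : weightedL2Sq a p < ⊤ := by
    refine lt_of_le_of_lt ?_ hfin
    rw [weightedL2Sq, ← lintegral_indicator measurableSet_Ioi]
    refine lintegral_mono fun τ => ?_
    by_cases hτ : τ ∈ Ioi (0 : ℝ)
    · rw [indicator_of_mem hτ, hp, indicator_of_mem hτ]
      refine ENNReal.ofReal_le_ofReal ?_
      exact mul_le_mul_of_nonneg_left (le_add_of_nonneg_left (by positivity)) (by positivity)
    · rw [hp, indicator_of_notMem hτ]
      simp
  have hnfin : weightedL2Sq a (fun τ => -conj (p (-τ))) < ⊤ := by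
    refine lt_of_le_of_lt ?_ hpfin
    rw [weightedL2Sq, ← lintegral_neg_eq_self, weightedL2Sq]
    refine lintegral_mono fun τ => ?_
    refine ENNReal.ofReal_le_ofReal ?_
    rw [neg_neg, norm_neg, RCLike.norm_conj]
    by_cases hτ : τ ∈ Ioi (0 : ℝ)
    · gcongr
      · exact (expWeight_pos _ _).le
      · refine Real.exp_le_exp.2 (mul_le_mul_of_nonneg_left ?_ ha)
        rw [mem_Ioi] at hτ
        linarith
    · rw [hp, indicator_of_notMem hτ]
      simp
  set v : ℝ → ℂ := p + fun τ => -conj (p (-τ)) with hv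
  have hvm : AEStronglyMeasurable v := hpm.add hpn.neg
  have hvfin : weightedL2Sq a v < ⊤ :=
    (weightedL2Sq_add_le hpm).trans_lt
      (ENNReal.mul_lt_top ENNReal.ofNat_lt_top (ENNReal.add_lt_top.2 ⟨hpfin, hnfin⟩))
  have hvloc := locallyIntegrable_of_weightedL2Sq_lt_top hvm hvfin
  have hvint : ∀ x y, IntervalIntegrable v volume x y := fun x y =>
    (hvloc.integrableOn_isCompact isCompact_uIcc).intervalIntegrable
  refine ⟨v, hvm, hvfin, ?_⟩
  have hvodd : ∀ τ, v (-τ) = -conj (v τ) := by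
    intro τ
    simp only [hv, Pi.add_apply]
    rw [neg_neg, map_add, map_neg, Complex.conj_conj]
    ring
  set I : ℝ → ℂ := fun x => ∫ τ in (0 : ℝ)..x, v τ with hI
  have hIc : Continuous I := intervalIntegral.continuous_primitive hvint 0
  have hIsub : ∀ x y, I y - I x = ∫ τ in x..y, v τ := fun x y =>
    intervalIntegral.integral_interval_sub_left (hvint _ _) (hvint _ _)
  have hpos : ∀ x y, 0 < x → x < y → u y - u x = I y - I x := by
    intro x y hx hxy
    rw [hIsub, hw.sub_eq_integral hu hxy fun τ hτ => lt_of_lt_of_le hx hτ.1]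
    refine intervalIntegral.integral_congr_ae (ae_of_all _ fun τ hτ => ?_)
    rw [uIoc_of_le hxy.le] at hτ
    have h0 : 0 < τ := hx.trans hτ.1
    simp [hv, hp, h0, h0.le]
  have hpos0 : ∀ y, 0 ≤ y → u y - u 0 = I y := by
    intro y hy
    rcases hy.eq_or_lt with rfl | hy
    · simp [hI]
    · have h1 : Tendsto (fun x => u y - u x) (𝓝[>] 0) (𝓝 (u y - u 0)) :=
        ((hu.tendsto 0).const_sub _).mono_left nhdsWithin_le_nhds
      have h2 : Tendsto (fun x => I y - I x) (𝓝[>] 0) (𝓝 (I y - I 0)) :=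
        ((hIc.tendsto 0).const_sub _).mono_left nhdsWithin_le_nhds
      have h3 : (fun x => u y - u x) =ᶠ[𝓝[>] 0] fun x => I y - I x := by
        filter_upwards [Ioo_mem_nhdsGT hy] with x hx
        exact hpos x y hx.1 hx.2
      have := tendsto_nhds_unique_of_eventuallyEq h1 h2 h3
      rw [this]
      simp [hI]
  have hIneg : ∀ y, I (-y) = conj (I y) := by
    intro y
    have h1 : ∫ τ in (0 : ℝ)..y, v (-τ) = ∫ τ in (-y)..(-0), v τ :=
      intervalIntegral.integral_comp_neg v
    have h2 : conj (I y) = ∫ τ in (0 : ℝ)..y, conj (v τ) := by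
      simp only [hI, intervalIntegral, map_sub, integral_conj]
    rw [h2]
    simp only [hI]
    rw [neg_zero] at h1
    rw [intervalIntegral.integral_symm, ← h1, ← intervalIntegral.integral_neg]
    refine intervalIntegral.integral_congr fun τ _ => ?_
    rw [hvodd, neg_neg]
  have hall : ∀ y, u y - u 0 = I y := by
    intro y
    rcases le_total 0 y with hy | hy
    · exact hpos0 y hy
    · have h1 := hpos0 (-y) (by linarith)
      have h0 : conj (u 0) = u 0 := by rw [← hsymm, neg_zero]
      rw [hIneg, hsymm] at h1
      have h2 := congrArg conj h1
      rwa [map_sub, Complex.conj_conj, Complex.conj_conj, h0] at h2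
  intro x y
  rw [← hIsub, ← hall, ← hall]
  ring

/-- The symmetry makes `|u|` even, so that its norm on the negative half line, where the weight is
smaller, is bounded by its norm on the positive half line. -/
lemma weightedL2Sq_lt_top_of_conj_symm {a : ℝ} (ha : 0 ≤ a) {u : ℝ → ℂ}
    (hsymm : ∀ τ, u (-τ) = conj (u τ)) (h : weightedH1Sq (Ioi 0) (expWeight a) u < ⊤) :
    weightedL2Sq a u < ⊤ := by
  obtain ⟨v₀, -, hfin⟩ := exists_hasWeakDerivOn_of_weightedH1Sq_lt h
  have hpos : ∫⁻ τ in Ioi 0, ENNReal.ofReal (expWeight a τ ^ 2 * ‖u τ‖ ^ 2) < ⊤ := by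
    refine lt_of_le_of_lt (lintegral_mono fun τ => ENNReal.ofReal_le_ofReal ?_) hfin
    exact mul_le_mul_of_nonneg_left (le_add_of_nonneg_right (by positivity)) (by positivity)
  have hneg : ∫⁻ τ in Iio 0, ENNReal.ofReal (expWeight a τ ^ 2 * ‖u τ‖ ^ 2) < ⊤ := by
    refine lt_of_le_of_lt ?_ hpos
    rw [← lintegral_indicator measurableSet_Iio, ← lintegral_neg_eq_self,
      ← lintegral_indicator measurableSet_Ioi]
    refine lintegral_mono fun τ => ?_
    by_cases hτ : 0 < τ
    · rw [indicator_of_mem (by simpa using hτ), indicator_of_mem (by simpa using hτ)]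
      refine ENNReal.ofReal_le_ofReal ?_
      rw [hsymm, RCLike.norm_conj]
      gcongr
      · exact (expWeight_pos _ _).le
      · exact Real.exp_le_exp.2 (mul_le_mul_of_nonneg_left (by linarith) ha)
    · rw [indicator_of_notMem (by simpa using hτ)]
      exact zero_le
  rw [weightedL2Sq, ← lintegral_add_compl _ (measurableSet_Ioi (a := (0 : ℝ))), compl_Ioi,
    setLIntegral_congr Iio_ae_eq_Iic.symm]
  exact ENNReal.add_lt_top.2 ⟨hpos, hneg⟩

/-- Propagation of exponentially weighted `H¹` bounds by the hierarchy: the `L²` estimate applied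
to the hierarchy and to its difference quotients in `τ`. -/
theorem IsModeHierarchy.tsum_weightedH1Sq_lt_top {K : ℝ} {z : ℝ → ℂ} {u : ℕ → ℝ → ℝ → ℂ}
    (h : IsModeHierarchy K z u) (hK : 0 ≤ K) (hz : Continuous z) (hz1 : ∀ s, ‖z s‖ ≤ 1) {a t : ℝ}
    (ha : 0 < a) (ht : 0 ≤ t) (hsymm : ∀ τ, u 0 0 (-τ) = conj (u 0 0 τ))
    (h0 : weightedH1Sq (Ioi 0) (expWeight a) (u 0 0) < ⊤)
    (hinit : ∑' i, weightedH1Sq univ (expWeight a) (u (i + 1) 0) < ⊤) :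
    ∑' i, weightedH1Sq univ (expWeight a) (u (i + 1) t) < ⊤ := by
  have huc : ∀ ℓ s, Continuous (u ℓ s) := fun ℓ s =>
    (h.continuous ℓ).comp (f := fun τ : ℝ => (s, τ)) (by fun_prop)
  obtain ⟨v, hvm, hvfin, hv⟩ := exists_derivative_of_conj_symm ha.le (huc 0 0) hsymm h0
  have hL2 := weightedL2Sq_lt_top_of_conj_symm ha.le hsymm h0
  set δ : ℕ → ℝ := fun k => 1 / ((k : ℝ) + 1) with hδdef
  have hδ0 : ∀ k, 0 < δ k := fun k => Nat.one_div_pos_of_nat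
  have hδ : Tendsto δ atTop (𝓝[>] 0) := tendsto_nhdsWithin_iff.2
    ⟨tendsto_one_div_add_atTop_nhds_zero_nat, Eventually.of_forall hδ0⟩
  set C : ℝ≥0∞ := ENNReal.ofReal (Real.exp (K * t)) *
    (∑' i, weightedH1Sq univ (expWeight a) (u (i + 1) 0) +
      ENNReal.ofReal (K * t) * (weightedL2Sq a (u 0 0) + weightedL2Sq a v)) with hC
  have hCfin : C < ⊤ := by
    refine ENNReal.mul_lt_top ENNReal.ofReal_lt_top (ENNReal.add_lt_top.2 ⟨hinit, ?_⟩)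
    exact ENNReal.mul_lt_top ENNReal.ofReal_lt_top (ENNReal.add_lt_top.2 ⟨hL2, hvfin⟩)
  have h1 : ∑' i, weightedL2Sq a (u (i + 1) t) ≤ C := by
    refine (h.tsum_weightedL2Sq_le hK hz hz1 ha ht).trans ?_
    rw [hC]
    gcongr
    · exact weightedL2Sq_le_weightedH1Sq _ _
    · exact le_self_add
  have h2 : ∀ k, ∑' i, weightedL2Sq a (fun τ => (u (i + 1) t (τ + δ k) - u (i + 1) t τ) /
      (δ k : ℂ)) ≤ C := by
    intro k
    refine ((h.diffQuotient (δ k)).tsum_weightedL2Sq_le hK hz hz1 ha ht).trans ?_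
    rw [hC]
    gcongr
    · exact weightedL2Sq_diffQuotient_le_weightedH1Sq ha.le (hδ0 k) (huc _ _)
    · exact (weightedL2Sq_diffQuotient_le ha.le (hδ0 k) hvm fun x => hv x _).trans le_add_self
  calc _ ≤ ∑' i, (weightedL2Sq a (u (i + 1) t) + liminf (fun k => weightedL2Sq a
        (fun τ => (u (i + 1) t (τ + δ k) - u (i + 1) t τ) / (δ k : ℂ))) atTop) :=
        ENNReal.tsum_le_tsum fun i => weightedH1Sq_le_add_liminf (huc _ _) hδ
    _ = ∑' i, weightedL2Sq a (u (i + 1) t) + ∑' i, liminf (fun k => weightedL2Sq a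
        (fun τ => (u (i + 1) t (τ + δ k) - u (i + 1) t τ) / (δ k : ℂ))) atTop :=
        ENNReal.tsum_add
    _ ≤ C + C := by
        refine add_le_add h1 ?_
        -- Fatou's lemma for the counting measure
        rw [← lintegral_count]
        refine (lintegral_liminf_le fun k => measurable_from_top).trans ?_
        simp_rw [lintegral_count]
        exact liminf_le_of_frequently_le' (Frequently.of_forall h2)
    _ < ⊤ := ENNReal.add_lt_top.2 ⟨hCfin, hCfin⟩

/-! ### Convolutions in exponentially weighted spaces -/

/-- The norm of `L¹(ℝ; e^{aτ} dτ)`. -/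
noncomputable def weightedL1 (a : ℝ) (u : ℝ → ℂ) : ℝ≥0∞ :=
  ∫⁻ τ, ENNReal.ofReal (expWeight a τ) * ‖u τ‖ₑ

lemma ofReal_expWeight_split (a t τ : ℝ) : ENNReal.ofReal (expWeight a τ) =
    ENNReal.ofReal (expWeight a t) * ENNReal.ofReal (expWeight a (τ - t)) := by
  rw [← ENNReal.ofReal_mul (expWeight_pos a t).le, expWeight, expWeight, expWeight, ← Real.exp_add]
  ring_nf

/-- Convolutions of functions in `L²(ℝ; e^{2aτ} dτ)` converge absolutely at every point. -/
lemma convolutionExists_of_weightedL2Sq_lt_top {a : ℝ} {F H : ℝ → ℂ} (hF : AEStronglyMeasurable F)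
    (hH : AEStronglyMeasurable H) (hF2 : weightedL2Sq a F < ⊤) (hH2 : weightedL2Sq a H < ⊤) :
    ConvolutionExists F H (ContinuousLinearMap.mul ℂ ℂ) volume := by
  intro x
  have h1 := memLp_expWeight_mul hF hF2
  have h2 := (memLp_expWeight_mul hH hH2).comp_measurePreserving
    (Measure.measurePreserving_sub_left volume x)
  have h3 := (h1.integrable_mul h2).const_mul (expWeight (-a) x : ℂ)
  refine h3.congr (ae_of_all _ fun t => ?_)
  simp only [Pi.mul_apply, Function.comp_apply, ContinuousLinearMap.mul_apply']
  have : (expWeight (-a) x : ℂ) * ((expWeight a t : ℂ) * (expWeight a (x - t) : ℂ)) = 1 := by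
    rw [← Complex.ofReal_mul, ← Complex.ofReal_mul, expWeight, expWeight, expWeight,
      ← Real.exp_add, ← Real.exp_add, show -a * x + (a * t + a * (x - t)) = 0 by ring]
    simp
  linear_combination (F t * H (x - t)) * this

lemma aestronglyMeasurable_convolution_integrand {F H : ℝ → ℂ} (hF : AEStronglyMeasurable F)
    (hH : AEStronglyMeasurable H) :
    AEStronglyMeasurable (fun x : ℝ × ℝ => F x.2 * H (x.1 - x.2)) (volume.prod volume) :=
  hF.convolution_integrand (ContinuousLinearMap.mul ℂ ℂ) hH

lemma aestronglyMeasurable_convolution {F H : ℝ → ℂ} (hF : AEStronglyMeasurable F)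
    (hH : AEStronglyMeasurable H) :
    AEStronglyMeasurable (convolution F H (ContinuousLinearMap.mul ℂ ℂ) volume) :=
  (aestronglyMeasurable_convolution_integrand hF hH).integral_prod_right'

/-- Young's inequality `L¹ ∗ L² ⊆ L²` with exponential weights, for the convolution of absolute
values. -/
lemma lintegral_convolution_enorm_sq_le (a : ℝ) {F H : ℝ → ℂ} (hF : AEStronglyMeasurable F)
    (hH : AEStronglyMeasurable H) :
    ∫⁻ τ, ENNReal.ofReal (expWeight a τ) ^ 2 * (∫⁻ t, ‖F t * H (τ - t)‖ₑ) ^ 2 ≤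
      weightedL1 a F ^ 2 * weightedL2Sq a H := by
  have hw := measurable_ofReal_expWeight a
  set p : ℝ → ℝ≥0∞ := fun t => ENNReal.ofReal (expWeight a t) * ‖F t‖ₑ with hp
  set q : ℝ → ℝ≥0∞ := fun t => ENNReal.ofReal (expWeight a t) * ‖H t‖ₑ with hq
  have hpm : AEMeasurable p := hw.aemeasurable.mul hF.enorm
  have hqm : AEMeasurable q := hw.aemeasurable.mul hH.enorm
  have hqs : ∀ τ, AEMeasurable fun t => q (τ - t) := fun τ =>
    hqm.comp_quasiMeasurePreserving (Measure.measurePreserving_sub_left volume τ).quasiMeasurePreserving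
  have hpt : ∀ τ, ENNReal.ofReal (expWeight a τ) ^ 2 * (∫⁻ t, ‖F t * H (τ - t)‖ₑ) ^ 2 ≤
      weightedL1 a F * ∫⁻ t, p t * q (τ - t) ^ 2 := by
    intro τ
    have h1 : ENNReal.ofReal (expWeight a τ) * ∫⁻ t, ‖F t * H (τ - t)‖ₑ =
        ∫⁻ t, p t * q (τ - t) := by
      rw [← lintegral_const_mul' _ _ ENNReal.ofReal_ne_top]
      refine lintegral_congr fun t => ?_
      rw [ofReal_expWeight_split a t τ, enorm_mul]
      simp only [hp, hq]
      ring
    rw [← mul_pow, h1]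
    -- Cauchy-Schwarz with respect to the measure `p(t) dt`
    have h2 := lintegral_mul_sq_le (μ := volume.withDensity p) (f := fun _ => 1)
      (g := fun t => q (τ - t)) aemeasurable_const
      ((hqs τ).mono_ac (withDensity_absolutelyContinuous _ _))
    rw [lintegral_withDensity_eq_lintegral_mul₀ hpm (by simpa using hqs τ),
      lintegral_withDensity_eq_lintegral_mul₀ hpm (by simp),
      lintegral_withDensity_eq_lintegral_mul₀ hpm ((hqs τ).pow_const 2)] at h2
    simpa [weightedL1, hp] using h2
  have hprod : AEMeasurable (fun x : ℝ × ℝ => p x.2 * q (x.1 - x.2) ^ 2) (volume.prod volume) := by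
    refine AEMeasurable.mul (hpm.comp_quasiMeasurePreserving
      Measure.quasiMeasurePreserving_snd) (AEMeasurable.pow_const ?_ 2)
    exact hqm.comp_quasiMeasurePreserving (quasiMeasurePreserving_sub_of_right_invariant volume volume)
  calc _ ≤ ∫⁻ τ, weightedL1 a F * ∫⁻ t, p t * q (τ - t) ^ 2 := lintegral_mono hpt
    _ = weightedL1 a F * ∫⁻ τ, ∫⁻ t, p t * q (τ - t) ^ 2 :=
      lintegral_const_mul'' _ hprod.lintegral_prod_right'
    _ = weightedL1 a F * ∫⁻ t, ∫⁻ τ, p t * q (τ - t) ^ 2 := by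
      rw [lintegral_lintegral_swap hprod]
    _ = weightedL1 a F * ∫⁻ t, p t * weightedL2Sq a H := by
      congr 1
      refine lintegral_congr fun t => ?_
      rw [lintegral_const_mul'']
      · rw [lintegral_sub_right_eq_self (fun τ => q τ ^ 2) t, weightedL2Sq_eq]
        simp only [hq, mul_pow]
      · exact (hqm.comp_quasiMeasurePreserving
          (measurePreserving_sub_right volume t).quasiMeasurePreserving).pow_const 2
    _ = _ := by
      rw [lintegral_mul_const'' _ hpm, ← mul_assoc, sq]
      rfl

lemma weightedL2Sq_convolution_le (a : ℝ) {F H : ℝ → ℂ} (hF : AEStronglyMeasurable F)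
    (hH : AEStronglyMeasurable H) :
    weightedL2Sq a (convolution F H (ContinuousLinearMap.mul ℂ ℂ) volume) ≤
      weightedL1 a F ^ 2 * weightedL2Sq a H := by
  refine le_trans ?_ (lintegral_convolution_enorm_sq_le a hF hH)
  rw [weightedL2Sq_eq]
  refine lintegral_mono fun τ => ?_
  gcongr
  exact enorm_integral_le_lintegral_enorm _

/-- The double integral obtained by testing a convolution converges absolutely. -/
lemma integrable_test_mul_convolution {a : ℝ} {F H : ℝ → ℂ} (hF : AEStronglyMeasurable F)
    (hH : AEStronglyMeasurable H) (hF1 : weightedL1 a F < ⊤) (hH2 : weightedL2Sq a H < ⊤)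
    {k : ℝ → ℂ} (hk : Continuous k) (hkc : HasCompactSupport k) :
    Integrable (fun x : ℝ × ℝ => k x.1 * (F x.2 * H (x.1 - x.2))) (volume.prod volume) := by
  have hm := aestronglyMeasurable_convolution_integrand hF hH
  refine ⟨(hk.comp continuous_fst).aestronglyMeasurable.mul hm, ?_⟩
  rw [hasFiniteIntegral_iff_enorm]
  have hem : AEMeasurable (fun x : ℝ × ℝ => ‖F x.2 * H (x.1 - x.2)‖ₑ) (volume.prod volume) :=
    hm.enorm
  have hPm : AEMeasurable fun τ => ∫⁻ t, ‖F t * H (τ - t)‖ₑ := hem.lintegral_prod_right'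
  have hwa := measurable_ofReal_expWeight a
  have hwn := measurable_ofReal_expWeight (-a)
  have hk2 : ∫⁻ τ, (ENNReal.ofReal (expWeight (-a) τ) * ‖k τ‖ₑ) ^ 2 < ⊤ := by
    have hwc := continuous_expWeight (-a)
    have h1 : MemLp (fun τ => (expWeight (-a) τ : ℂ) * k τ) 2 :=
      Continuous.memLp_of_hasCompactSupport (by fun_prop) hkc.mul_left
    have h2 := eLpNorm_expWeight_mul_sq (-a) k
    rw [weightedL2Sq_eq] at h2
    simp only [mul_pow]
    rw [← h2]
    exact ENNReal.pow_lt_top h1.2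
  have hinv : ∀ τ, ENNReal.ofReal (expWeight (-a) τ) * ENNReal.ofReal (expWeight a τ) = 1 := by
    intro τ
    rw [← ENNReal.ofReal_mul (expWeight_pos _ τ).le, expWeight, expWeight, ← Real.exp_add]
    simp
  calc ∫⁻ x : ℝ × ℝ, ‖k x.1 * (F x.2 * H (x.1 - x.2))‖ₑ ∂(volume.prod volume)
      = ∫⁻ τ, ∫⁻ t, ‖k τ * (F t * H (τ - t))‖ₑ :=
        lintegral_prod _ ((hk.comp continuous_fst).aestronglyMeasurable.mul hm).enorm
    _ = ∫⁻ τ, (ENNReal.ofReal (expWeight (-a) τ) * ‖k τ‖ₑ) *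
          (ENNReal.ofReal (expWeight a τ) * ∫⁻ t, ‖F t * H (τ - t)‖ₑ) := by
        refine lintegral_congr fun τ => ?_
        simp_rw [enorm_mul (k τ)]
        rw [lintegral_const_mul' _ _ enorm_ne_top]
        calc _ = 1 * (‖k τ‖ₑ * ∫⁻ t, ‖F t * H (τ - t)‖ₑ) := (one_mul _).symm
          _ = _ := by rw [← hinv τ]; ring
    _ < ⊤ := by
        have h1 := lintegral_mul_sq_le (μ := volume)
          (hwn.mul hk.measurable.enorm).aemeasurable (hwa.aemeasurable.mul hPm)
        have h2 : ∫⁻ τ, (ENNReal.ofReal (expWeight a τ) * ∫⁻ t, ‖F t * H (τ - t)‖ₑ) ^ 2 < ⊤ := by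
          simp only [mul_pow]
          exact (lintegral_convolution_enorm_sq_le a hF hH).trans_lt
            (ENNReal.mul_lt_top (ENNReal.pow_lt_top hF1) hH2)
        exact (ENNReal.pow_lt_top_iff.1 (h1.trans_lt (ENNReal.mul_lt_top hk2 h2))).resolve_right
          two_ne_zero

/-- Convolution with a function in the weighted `L¹` space commutes with weak differentiation. -/
lemma HasWeakDerivOn.convolution_right {a : ℝ} {F H v : ℝ → ℂ} (hF : AEStronglyMeasurable F)
    (hF1 : weightedL1 a F < ⊤) (hH2 : weightedL2Sq a H < ⊤) (hv2 : weightedL2Sq a v < ⊤)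
    (h : HasWeakDerivOn univ H v) :
    HasWeakDerivOn univ (convolution F H (ContinuousLinearMap.mul ℂ ℂ) volume)
      (convolution F v (ContinuousLinearMap.mul ℂ ℂ) volume) := by
  have hH : AEStronglyMeasurable H := (locallyIntegrableOn_univ.1 h.locInt_fun).aestronglyMeasurable
  have hv : AEStronglyMeasurable v :=
    (locallyIntegrableOn_univ.1 h.locInt_deriv).aestronglyMeasurable
  have hloc : ∀ G : ℝ → ℂ, AEStronglyMeasurable G → weightedL2Sq a G < ⊤ → LocallyIntegrableOn
      (convolution F G (ContinuousLinearMap.mul ℂ ℂ) volume) univ := fun G hG hG2 =>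
    locallyIntegrableOn_univ.2 (locallyIntegrable_of_weightedL2Sq_lt_top
      (aestronglyMeasurable_convolution hF hG) ((weightedL2Sq_convolution_le a hF hG).trans_lt
        (ENNReal.mul_lt_top (ENNReal.pow_lt_top hF1) hG2)))
  refine ⟨hloc H hH hH2, hloc v hv hv2, fun χ hχ hc _ => ?_⟩
  rw [setIntegral_univ, setIntegral_univ]
  have hswap : ∀ (G : ℝ → ℂ), AEStronglyMeasurable G → weightedL2Sq a G < ⊤ → ∀ k : ℝ → ℂ,
      Continuous k → HasCompactSupport k →
      ∫ τ, k τ * (convolution F G (ContinuousLinearMap.mul ℂ ℂ) volume) τ =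
        ∫ t, F t * ∫ τ, k (τ + t) * G τ := by
    intro G hG hG2 k hk hkc
    have hint := integrable_test_mul_convolution hF hG hF1 hG2 hk hkc
    calc _ = ∫ τ, ∫ t, k τ * (F t * G (τ - t)) := by
          refine integral_congr_ae (ae_of_all _ fun τ => ?_)
          simp only [convolution_def, ContinuousLinearMap.mul_apply']
          rw [integral_const_mul]
      _ = ∫ t, ∫ τ, k τ * (F t * G (τ - t)) :=
          integral_integral_swap (f := fun τ t => k τ * (F t * G (τ - t))) hint
      _ = _ := by
          refine integral_congr_ae (ae_of_all _ fun t => ?_)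
          simp only
          rw [← integral_const_mul, ← integral_add_right_eq_self _ t]
          refine integral_congr_ae (ae_of_all _ fun τ => ?_)
          simp only [add_sub_cancel_right]
          ring
  have hχ'c : Continuous (deriv χ) := hχ.continuous_deriv (by simp)
  have hχc : Continuous χ := hχ.continuous
  rw [hswap H hH hH2 (fun τ => ((deriv χ τ : ℝ) : ℂ)) (by fun_prop)
      (hc.deriv.comp_left (g := fun r : ℝ => (r : ℂ)) (by simp)),
    hswap v hv hv2 (fun τ => (χ τ : ℂ)) (by fun_prop)
      (hc.comp_left (g := fun r : ℝ => (r : ℂ)) (by simp)), ← integral_neg]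
  refine integral_congr_ae (ae_of_all _ fun t => ?_)
  have hcs : HasCompactSupport fun τ => χ (τ + t) :=
    hc.comp_homeomorph (Homeomorph.addRight t)
  have h1 := h.integral_eq (fun τ => χ (τ + t)) (hχ.comp (by fun_prop)) hcs (subset_univ _)
  rw [setIntegral_univ, setIntegral_univ] at h1
  simp only [deriv_comp_add_const] at h1
  simp only
  rw [h1]
  ring

/-- Young's inequality for the weighted `H¹` norm. -/
lemma weightedH1Sq_convolution_le {a : ℝ} {F H : ℝ → ℂ} (hF : AEStronglyMeasurable F)
    (hF1 : weightedL1 a F < ⊤) (hH1 : weightedH1Sq univ (expWeight a) H < ⊤) :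
    weightedH1Sq univ (expWeight a) (convolution F H (ContinuousLinearMap.mul ℂ ℂ) volume) ≤
      weightedL1 a F ^ 2 * weightedH1Sq univ (expWeight a) H := by
  have key : ∀ R : ℝ≥0∞, weightedH1Sq univ (expWeight a) H < R →
      weightedH1Sq univ (expWeight a) (convolution F H (ContinuousLinearMap.mul ℂ ℂ) volume) ≤
        weightedL1 a F ^ 2 * R := by
    intro R hR
    obtain ⟨v, hw, hlt⟩ := exists_hasWeakDerivOn_of_weightedH1Sq_lt hR
    have hHm : AEStronglyMeasurable H :=
      (locallyIntegrableOn_univ.1 hw.locInt_fun).aestronglyMeasurable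
    have hvm : AEStronglyMeasurable v :=
      (locallyIntegrableOn_univ.1 hw.locInt_deriv).aestronglyMeasurable
    rw [lintegral_weight_eq_add hHm] at hlt
    obtain ⟨hH2, hv2⟩ := ENNReal.add_lt_top.1 (hlt.trans_le le_top)
    refine (iInf₂_le _ (hw.convolution_right hF hF1 hH2 hv2)).trans ?_
    rw [lintegral_weight_eq_add (aestronglyMeasurable_convolution hF hHm)]
    refine (add_le_add (weightedL2Sq_convolution_le a hF hHm)
      (weightedL2Sq_convolution_le a hF hvm)).trans ?_
    rw [← mul_add]
    gcongr
  have : (𝓝[>] weightedH1Sq univ (expWeight a) H).NeBot := nhdsGT_neBot_of_exists_gt ⟨⊤, hH1⟩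
  refine ge_of_tendsto (b := weightedH1Sq univ (expWeight a) (convolution F H
    (ContinuousLinearMap.mul ℂ ℂ) volume)) (f := fun R => weightedL1 a F ^ 2 * R)
    (x := 𝓝[>] weightedH1Sq univ (expWeight a) H) ?_ ?_
  · exact ENNReal.Tendsto.const_mul (tendsto_id.mono_left nhdsWithin_le_nhds)
      (Or.inr (ENNReal.pow_ne_top hF1.ne))
  · filter_upwards [self_mem_nhdsWithin] with R hR using key R hR

lemma HasWeakDerivOn.sub {Ω : Set ℝ} {u₁ u₂ v₁ v₂ : ℝ → ℂ}
    (h₁ : HasWeakDerivOn Ω u₁ v₁) (h₂ : HasWeakDerivOn Ω u₂ v₂) :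
    HasWeakDerivOn Ω (u₁ - u₂) (v₁ - v₂) where
  locInt_fun := h₁.locInt_fun.sub h₂.locInt_fun
  locInt_deriv := h₁.locInt_deriv.sub h₂.locInt_deriv
  integral_eq χ hχ hc hs := by
    have hint : ∀ (w : ℝ → ℂ), LocallyIntegrableOn w Ω → ∀ k : ℝ → ℝ, Continuous k →
        HasCompactSupport k → tsupport k ⊆ Ω → IntegrableOn (fun τ => (k τ : ℂ) * w τ) Ω := by
      intro w hw k hk hkc hks
      have h1 : IntegrableOn (fun τ => (k τ : ℂ) * w τ) (tsupport k) := by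
        refine IntegrableOn.continuousOn_mul (Continuous.continuousOn (by fun_prop))
          (hw.integrableOn_compact_subset hks hkc) hkc
      refine (integrableOn_iff_integrable_of_support_subset ?_).1 h1 |>.integrableOn
      intro τ hτ
      refine subset_tsupport _ fun h0 => hτ ?_
      simp [h0]
    have hχ'c : Continuous (deriv χ) := hχ.continuous_deriv (by simp)
    have hds : tsupport (deriv χ) ⊆ Ω := (tsupport_deriv_subset (𝕜 := ℝ)).trans hs
    simp only [Pi.sub_apply, mul_sub]
    rw [integral_sub (hint _ h₁.locInt_fun _ hχ'c hc.deriv hds)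
        (hint _ h₂.locInt_fun _ hχ'c hc.deriv hds),
      integral_sub (hint _ h₁.locInt_deriv _ hχ.continuous hc hs)
        (hint _ h₂.locInt_deriv _ hχ.continuous hc hs), h₁.integral_eq χ hχ hc hs,
      h₂.integral_eq χ hχ hc hs]
    ring

lemma weightedH1Sq_sub_le (a : ℝ) (p q : ℝ → ℂ) :
    weightedH1Sq univ (expWeight a) (p - q) ≤
      2 * (weightedH1Sq univ (expWeight a) p + weightedH1Sq univ (expWeight a) q) := by
  have hneg : ∀ w : ℝ → ℂ, weightedL2Sq a (-w) = weightedL2Sq a w := fun w => by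
    simp [weightedL2Sq]
  have key : ∀ v₁ v₂, HasWeakDerivOn univ p v₁ → HasWeakDerivOn univ q v₂ →
      weightedH1Sq univ (expWeight a) (p - q) ≤
        2 * ((∫⁻ τ in univ, ENNReal.ofReal (expWeight a τ ^ 2 * (‖p τ‖ ^ 2 + ‖v₁ τ‖ ^ 2))) +
          ∫⁻ τ in univ, ENNReal.ofReal (expWeight a τ ^ 2 * (‖q τ‖ ^ 2 + ‖v₂ τ‖ ^ 2))) := by
    intro v₁ v₂ h₁ h₂
    have hp : AEStronglyMeasurable p :=
      (locallyIntegrableOn_univ.1 h₁.locInt_fun).aestronglyMeasurable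
    have hq : AEStronglyMeasurable q :=
      (locallyIntegrableOn_univ.1 h₂.locInt_fun).aestronglyMeasurable
    have hv₁ : AEStronglyMeasurable v₁ :=
      (locallyIntegrableOn_univ.1 h₁.locInt_deriv).aestronglyMeasurable
    refine (iInf₂_le _ (h₁.sub h₂)).trans ?_
    rw [lintegral_weight_eq_add (hp.sub hq), lintegral_weight_eq_add hp,
      lintegral_weight_eq_add hq, sub_eq_add_neg, sub_eq_add_neg]
    refine (add_le_add (weightedL2Sq_add_le hp) (weightedL2Sq_add_le hv₁)).trans_eq ?_
    rw [hneg, hneg]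
    ring
  rcases eq_or_ne (weightedH1Sq univ (expWeight a) p) ⊤ with h | h1
  · simp [h]
  rcases eq_or_ne (weightedH1Sq univ (expWeight a) q) ⊤ with h | h2
  · simp [h]
  refine ENNReal.le_of_forall_pos_le_add fun ε hε _ => ?_
  have hε4 : (ε / 4 : ℝ≥0∞) ≠ 0 := by
    simp [hε.ne']
  obtain ⟨v₁, w₁, l₁⟩ := exists_hasWeakDerivOn_of_weightedH1Sq_lt (ENNReal.lt_add_right h1 hε4)
  obtain ⟨v₂, w₂, l₂⟩ := exists_hasWeakDerivOn_of_weightedH1Sq_lt (ENNReal.lt_add_right h2 hε4)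
  refine (key v₁ v₂ w₁ w₂).trans ((mul_le_mul_right (add_le_add l₁.le l₂.le) _).trans_eq ?_)
  have h4 : 4 * ((ε : ℝ≥0∞) / 4) = ε := ENNReal.mul_div_cancel (by norm_num) (by norm_num)
  conv_rhs => rw [← h4]
  ring

/-- `e^{aτ} ≤ e^{-ε|τ|} (e^{(a+ε)τ} + e^{(a-ε)τ})` and the Cauchy-Schwarz inequality bound the
weighted `L¹` norm by two weighted `L²` norms. -/
lemma exists_weightedL1_sq_le (a : ℝ) {ε : ℝ} (hε : 0 < ε) :
    ∃ C : ℝ≥0∞, C < ⊤ ∧ ∀ u : ℝ → ℂ, AEStronglyMeasurable u →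
      weightedL1 a u ^ 2 ≤ C * (weightedL2Sq (a + ε) u + weightedL2Sq (a - ε) u) := by
  set k : ℝ → ℝ≥0∞ := fun τ => ENNReal.ofReal (Real.exp (-ε * |τ|)) with hk
  have hkm : Measurable k := (ENNReal.continuous_ofReal.comp (by fun_prop)).measurable
  have hkfin : ∫⁻ τ, k τ ^ 2 < ⊤ := by
    have hI : Integrable fun τ : ℝ => Real.exp (-ε * |τ|) ^ 2 := by
      rw [← integrableOn_univ, ← Iic_union_Ioi (a := (0 : ℝ)), integrableOn_union]
      constructor
      · refine (integrableOn_exp_mul_Iic (a := 2 * ε) (by positivity) 0).congr_fun (fun τ hτ => ?_)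
          measurableSet_Iic
        simp only
        rw [← Real.exp_nat_mul, abs_of_nonpos hτ]
        push_cast
        ring_nf
      · refine (integrableOn_exp_mul_Ioi (a := -(2 * ε)) (by linarith) 0).congr_fun (fun τ hτ => ?_)
          measurableSet_Ioi
        simp only
        rw [← Real.exp_nat_mul, abs_of_pos hτ]
        push_cast
        ring_nf
    have := hI.lintegral_lt_top
    refine lt_of_le_of_lt (le_of_eq (lintegral_congr fun τ => ?_)) this
    rw [hk, ENNReal.ofReal_pow (Real.exp_pos _).le]
  refine ⟨(∫⁻ τ, k τ ^ 2) * 2, ENNReal.mul_lt_top hkfin ENNReal.ofNat_lt_top, fun u hu => ?_⟩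
  set e₁ : ℝ → ℝ≥0∞ := fun τ => ENNReal.ofReal (expWeight (a + ε) τ)
  set e₂ : ℝ → ℝ≥0∞ := fun τ => ENNReal.ofReal (expWeight (a - ε) τ)
  have he₁ : Measurable e₁ := measurable_ofReal_expWeight _
  have he₂ : Measurable e₂ := measurable_ofReal_expWeight _
  have hle : ∀ τ, ENNReal.ofReal (expWeight a τ) * ‖u τ‖ₑ ≤ k τ * ((e₁ τ + e₂ τ) * ‖u τ‖ₑ) := by
    intro τ
    rw [← mul_assoc]
    gcongr
    simp only [hk, e₁, e₂]
    rw [← ENNReal.ofReal_add (expWeight_pos _ _).le (expWeight_pos _ _).le,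
      ← ENNReal.ofReal_mul (Real.exp_pos _).le]
    refine ENNReal.ofReal_le_ofReal ?_
    rw [mul_add]
    simp only [expWeight]
    rw [← Real.exp_add, ← Real.exp_add]
    rcases le_total 0 τ with h0 | h0
    · rw [abs_of_nonneg h0, show -ε * τ + (a + ε) * τ = a * τ by ring]
      exact le_add_of_nonneg_right (Real.exp_pos _).le
    · rw [abs_of_nonpos h0, show -ε * -τ + (a - ε) * τ = a * τ by ring]
      exact le_add_of_nonneg_left (Real.exp_pos _).le
  calc weightedL1 a u ^ 2 ≤ (∫⁻ τ, k τ * ((e₁ τ + e₂ τ) * ‖u τ‖ₑ)) ^ 2 :=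
        pow_le_pow_left' (lintegral_mono hle) 2
    _ ≤ (∫⁻ τ, k τ ^ 2) * ∫⁻ τ, ((e₁ τ + e₂ τ) * ‖u τ‖ₑ) ^ 2 :=
        lintegral_mul_sq_le hkm.aemeasurable ((he₁.add he₂).aemeasurable.mul hu.enorm)
    _ ≤ (∫⁻ τ, k τ ^ 2) * ∫⁻ τ, (2 * (e₁ τ ^ 2 * ‖u τ‖ₑ ^ 2) + 2 * (e₂ τ ^ 2 * ‖u τ‖ₑ ^ 2)) := by
        gcongr with τ
        rw [mul_pow, ← mul_add, ← add_mul, ← mul_assoc]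
        gcongr
        simp only [e₁, e₂, ENNReal.ofReal]
        exact_mod_cast add_sq_le (a := (expWeight (a + ε) τ).toNNReal)
          (b := (expWeight (a - ε) τ).toNNReal)
    _ = _ := by
        have hm : AEMeasurable fun τ => 2 * (e₁ τ ^ 2 * ‖u τ‖ₑ ^ 2) :=
          ((he₁.pow_const 2).aemeasurable.mul (hu.enorm.pow_const 2)).const_mul 2
        rw [lintegral_add_left' hm, lintegral_const_mul' _ _ ENNReal.ofNat_ne_top,
          lintegral_const_mul' _ _ ENNReal.ofNat_ne_top, ← weightedL2Sq_eq, ← weightedL2Sq_eq]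
        ring

/-! ### Summability of the defect -/

/-- There are `k + 1` pairs with `i + j = k`, and `(i + 1) (j + 1) ≥ k + 1` for each of them. -/
lemma tsum_div_mul_le (h : ℕ → ℝ≥0∞) :
    ∑' (i : ℕ) (j : ℕ), h (i + j) / (((i + 1 : ℕ) : ℝ≥0∞) * ((j + 1 : ℕ) : ℝ≥0∞)) ≤ ∑' k, h k := by
  rw [← ENNReal.tsum_prod (f := fun i j => h (i + j) / (((i + 1 : ℕ) : ℝ≥0∞) *
    ((j + 1 : ℕ) : ℝ≥0∞))), ← Equiv.tsum_eq (Finset.HasAntidiagonal.sigmaAntidiagonalEquivProd (A := ℕ)), ENNReal.tsum_sigma']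
  refine ENNReal.tsum_le_tsum fun k => ?_
  rw [tsum_fintype]
  calc _ ≤ ∑ _x : Finset.HasAntidiagonal.antidiagonal k, h k / ((k + 1 : ℕ) : ℝ≥0∞) := by
        refine Finset.sum_le_sum fun x _ => ?_
        obtain ⟨⟨i, j⟩, hij⟩ := x
        rw [Finset.HasAntidiagonal.mem_antidiagonal] at hij
        simp only at hij
        simp only [Finset.HasAntidiagonal.sigmaAntidiagonalEquivProd_apply, hij]
        refine ENNReal.div_le_div_left ?_ _
        have : k + 1 ≤ (i + 1) * (j + 1) := by nlinarith
        exact_mod_cast this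
    _ = h k := by
        rw [Finset.sum_const, Finset.card_univ, Fintype.card_coe, Finset.Nat.card_antidiagonal,
          nsmul_eq_mul]
        exact ENNReal.mul_div_cancel (by simp) (ENNReal.natCast_ne_top _)

/-- Summability of the weighted `H¹` norms of `u_{n+m} ∗ u_0 - u_n ∗ u_m`. In the first term the
derivative falls on `u_{n+m}`, in the second on `u_m`. -/
lemma tsum_weightedH1Sq_defect_lt_top {u : ℕ → ℝ → ℂ} {a ε : ℝ} (hε : 0 < ε)
    (hu : ∀ ℓ, AEStronglyMeasurable (u ℓ))
    (h0p : weightedL2Sq (a + ε) (u 0) < ⊤) (h0m : weightedL2Sq (a - ε) (u 0) < ⊤)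
    (hp : ∑' i, weightedL2Sq (a + ε) (u (i + 1)) < ⊤)
    (hm : ∑' i, weightedL2Sq (a - ε) (u (i + 1)) < ⊤)
    (hH : ∑' i, weightedH1Sq univ (expWeight a) (u (i + 1)) < ⊤) :
    ∑' (i : ℕ) (j : ℕ), weightedH1Sq univ (expWeight a)
      (convolution (u ((i + 1) + (j + 1))) (u 0) (ContinuousLinearMap.mul ℂ ℂ) volume -
        convolution (u (i + 1)) (u (j + 1)) (ContinuousLinearMap.mul ℂ ℂ) volume) /
      (((i + 1 : ℕ) : ℝ≥0∞) * ((j + 1 : ℕ) : ℝ≥0∞)) < ⊤ := by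
  obtain ⟨C, hC, hL1⟩ := exists_weightedL1_sq_le a hε
  set h : ℕ → ℝ≥0∞ := fun i => weightedH1Sq univ (expWeight a) (u (i + 1)) with hh
  set b : ℕ → ℝ≥0∞ := fun i => C * (weightedL2Sq (a + ε) (u i) + weightedL2Sq (a - ε) (u i)) with hb
  have hb0 : b 0 < ⊤ := ENNReal.mul_lt_top hC (ENNReal.add_lt_top.2 ⟨h0p, h0m⟩)
  have hbsum : ∑' i, b (i + 1) < ⊤ := by
    simp only [hb]
    rw [ENNReal.tsum_mul_left, ENNReal.tsum_add]
    exact ENNReal.mul_lt_top hC (ENNReal.add_lt_top.2 ⟨hp, hm⟩)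
  have hbfin : ∀ i, b i < ⊤ := by
    intro i
    rcases i with _ | i
    · exact hb0
    · exact (ENNReal.le_tsum i).trans_lt hbsum
  have hhfin : ∀ i, h i < ⊤ := fun i => (ENNReal.le_tsum i).trans_lt hH
  have hL1fin : ∀ i, weightedL1 a (u i) < ⊤ := fun i =>
    (ENNReal.pow_lt_top_iff.1 ((hL1 (u i) (hu i)).trans_lt (hbfin i))).resolve_right two_ne_zero
  have hconv : ∀ i j : ℕ, weightedH1Sq univ (expWeight a)
      (convolution (u i) (u (j + 1)) (ContinuousLinearMap.mul ℂ ℂ) volume) ≤ b i * h j := by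
    intro i j
    refine (weightedH1Sq_convolution_le (hu i) (hL1fin i) (hhfin j)).trans ?_
    exact mul_le_mul_left (hL1 (u i) (hu i)) _
  have hterm : ∀ i j : ℕ, weightedH1Sq univ (expWeight a)
      (convolution (u ((i + 1) + (j + 1))) (u 0) (ContinuousLinearMap.mul ℂ ℂ) volume -
        convolution (u (i + 1)) (u (j + 1)) (ContinuousLinearMap.mul ℂ ℂ) volume) /
      (((i + 1 : ℕ) : ℝ≥0∞) * ((j + 1 : ℕ) : ℝ≥0∞)) ≤
      2 * b 0 * (h (i + j + 1) / (((i + 1 : ℕ) : ℝ≥0∞) * ((j + 1 : ℕ) : ℝ≥0∞))) +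
        2 * (b (i + 1) * h j) := by
    intro i j
    have e : convolution (u ((i + 1) + (j + 1))) (u 0) (ContinuousLinearMap.mul ℂ ℂ) volume =
        convolution (u 0) (u ((i + j + 1) + 1)) (ContinuousLinearMap.mul ℂ ℂ) volume := by
      rw [← convolution_flip, ContinuousLinearMap.flip_mul,
        show (i + 1) + (j + 1) = (i + j + 1) + 1 by ring]
    rw [e]
    have h1 := (weightedH1Sq_sub_le a
      (convolution (u 0) (u ((i + j + 1) + 1)) (ContinuousLinearMap.mul ℂ ℂ) volume)
      (convolution (u (i + 1)) (u (j + 1)) (ContinuousLinearMap.mul ℂ ℂ) volume)).trans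
      (mul_le_mul_right (add_le_add (hconv 0 (i + j + 1)) (hconv (i + 1) j)) 2)
    refine (ENNReal.div_le_div_right h1 _).trans ?_
    rw [mul_add, ENNReal.add_div]
    refine add_le_add (le_of_eq ?_) ?_
    · simp only [div_eq_mul_inv]
      ring
    · refine ENNReal.div_le_of_le_mul (le_mul_of_one_le_right' ?_)
      have : 1 ≤ (i + 1) * (j + 1) := Nat.succ_le_of_lt (by positivity)
      exact_mod_cast this
  refine (ENNReal.tsum_le_tsum fun i => ENNReal.tsum_le_tsum fun j => hterm i j).trans_lt ?_
  simp_rw [ENNReal.tsum_add, ENNReal.tsum_mul_left]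
  refine ENNReal.add_lt_top.2 ⟨ENNReal.mul_lt_top (ENNReal.mul_lt_top ENNReal.ofNat_lt_top hb0) ?_,
    ENNReal.mul_lt_top ENNReal.ofNat_lt_top ?_⟩
  · refine (tsum_div_mul_le fun k => h (k + 1)).trans_lt ?_
    exact (ENNReal.tsum_comp_le_tsum_of_injective (add_left_injective 1) h).trans_lt hH
  · rw [ENNReal.tsum_mul_right]
    exact ENNReal.mul_lt_top hbsum hH

/-! ### Fourier modes of solutions of the Kuramoto equation -/

/-- The order parameter `∫ e^{iθ} μ(dθ, dω)`. -/
noncomputable def orderParameter (μ : ProbabilityMeasure Cylinder) : ℂ :=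
  ∫ p : Cylinder, fourier 1 p.1 ∂(μ : Measure Cylinder)

/-- The pairing of the `ℓ`-th angular mode of `μ` with a function of the frequency. -/
noncomputable def modePairing (μ : ProbabilityMeasure Cylinder) (ℓ : ℤ) (c : ℝ → ℂ) : ℂ :=
  ∫ p : Cylinder, fourier (-ℓ) p.1 * c p.2 ∂(μ : Measure Cylinder)

lemma norm_fourier_apply {T : ℝ} (n : ℤ) (x : AddCircle T) : ‖fourier n x‖ = 1 := by
  rw [fourier_apply]
  exact Circle.norm_coe _

lemma integrable_of_continuous_of_bound {α E : Type*} [TopologicalSpace α] [MeasurableSpace α]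
    [OpensMeasurableSpace α] [NormedAddCommGroup E] [SecondCountableTopology E] (μ : Measure α)
    [IsFiniteMeasure μ] {h : α → E} {C : ℝ} (hh : Continuous h) (hC : ∀ p, ‖h p‖ ≤ C) :
    Integrable h μ := by
  borelize E
  exact (integrable_const C).mono' hh.measurable.stronglyMeasurable.aestronglyMeasurable
    (ae_of_all _ hC)

lemma integrable_mode (μ : ProbabilityMeasure Cylinder) (n : ℤ) {c : ℝ → ℂ} {C : ℝ}
    (hc : Continuous c) (hC : ∀ ω, ‖c ω‖ ≤ C) :
    Integrable (fun p : Cylinder => fourier n p.1 * c p.2) (μ : Measure Cylinder) := by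
  refine integrable_of_continuous_of_bound (C := C) _ (by fun_prop) fun p => ?_
  rw [norm_mul, norm_fourier_apply, one_mul]
  exact hC _

lemma norm_orderParameter_le (μ : ProbabilityMeasure Cylinder) : ‖orderParameter μ‖ ≤ 1 := by
  refine (norm_integral_le_of_norm_le_const (C := 1) (ae_of_all _ fun p => ?_)).trans ?_
  · rw [norm_fourier_apply]
  · simp

lemma norm_modePairing_le (μ : ProbabilityMeasure Cylinder) (ℓ : ℤ) {c : ℝ → ℂ} {C : ℝ}
    (hC : ∀ ω, ‖c ω‖ ≤ C) : ‖modePairing μ ℓ c‖ ≤ C := by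
  refine (norm_integral_le_of_norm_le_const (C := C) (ae_of_all _ fun p => ?_)).trans ?_
  · rw [norm_mul, norm_fourier_apply, one_mul]
    exact hC _
  · simp

lemma angle_sin_eq_im_fourier (x : AddCircle (2 * Real.pi)) :
    Real.Angle.sin x = (fourier 1 x).im := by
  induction x using QuotientAddGroup.induction_on with
  | H r =>
    have h1 : (fourier 1 ((r : ℝ) : AddCircle (2 * Real.pi)) : ℂ) = Complex.exp (r * Complex.I) := by
      rw [fourier_coe_apply]
      congr 1
      have : (Real.pi : ℂ) ≠ 0 := by exact_mod_cast Real.pi_ne_zero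
      push_cast
      field_simp
    refine (Real.Angle.sin_coe r).trans ?_
    rw [show ((QuotientAddGroup.mk r : AddCircle (2 * Real.pi))) =
      ((r : ℝ) : AddCircle (2 * Real.pi)) from rfl, h1, Complex.exp_ofReal_mul_I_im]

lemma fourier_one_sub (x y : AddCircle (2 * Real.pi)) :
    (fourier 1 (x - y) : ℂ) = fourier 1 x * fourier (-1) y := by
  simp only [fourier_apply]
  rw [one_zsmul, one_zsmul, neg_one_zsmul, sub_eq_add_neg, AddCircle.toCircle_add, Circle.coe_mul]

/-- The velocity field depends on the measure only through its order parameter. -/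
lemma kuramotoVelocity_eq (K : ℝ) (μ : ProbabilityMeasure Cylinder) (p : Cylinder) :
    kuramotoVelocity K μ p = p.2 + K * (orderParameter μ * fourier (-1) p.1).im := by
  have h1 : Integrable (fun q : Cylinder => (fourier 1 q.1 : ℂ) * fourier (-1) p.1)
      (μ : Measure Cylinder) := by
    refine integrable_of_continuous_of_bound (C := 1) _ (by fun_prop) fun q => ?_
    rw [norm_mul, norm_fourier_apply, norm_fourier_apply, one_mul]
  rw [kuramotoVelocity, orderParameter, ← integral_mul_const,
    ← Complex.imCLM_apply, ← Complex.imCLM.integral_comp_comm h1]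
  congr 2
  refine integral_congr_ae (ae_of_all _ fun q => ?_)
  simp only
  rw [angle_sin_eq_im_fourier, fourier_one_sub]
  rfl

lemma hasDerivAt_fourier_add (n : ℤ) (x : AddCircle (2 * Real.pi)) :
    HasDerivAt (fun s : ℝ => (fourier n (x + (s : AddCircle (2 * Real.pi))) : ℂ))
      (Complex.I * n * fourier n x) 0 := by
  have h1 := hasDerivAt_fourier (2 * Real.pi) n 0
  have h2 := h1.const_mul (fourier n x : ℂ)
  have h3 : (fun s : ℝ => (fourier n (x + (s : AddCircle (2 * Real.pi))) : ℂ)) =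
      fun s : ℝ => (fourier n x : ℂ) * fourier n (s : AddCircle (2 * Real.pi)) := by
    funext s
    simp only [fourier_apply]
    rw [zsmul_add, AddCircle.toCircle_add, Circle.coe_mul]
  rw [h3]
  refine h2.congr_deriv ?_
  have : (Real.pi : ℂ) ≠ 0 := by exact_mod_cast Real.pi_ne_zero
  have h0 : (fourier n ((0 : ℝ) : AddCircle (2 * Real.pi)) : ℂ) = 1 := by
    rw [AddCircle.coe_zero, fourier_eval_zero]
  rw [h0]
  push_cast
  field_simp

instance : Fact (0 < 2 * Real.pi) := ⟨Real.two_pi_pos⟩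

lemma isCylinderTest_re_mode (n : ℤ) {c : ℝ → ℂ} (hc : ContDiff ℝ ((⊤ : ℕ∞) : WithTop ℕ∞) c)
    (hcc : HasCompactSupport c) :
    IsCylinderTest fun p => ((fourier n p.1 : ℂ) * c p.2).re where
  smooth := by
    have h1 : ContDiff ℝ ((⊤ : ℕ∞) : WithTop ℕ∞) fun x : ℝ × ℝ =>
        Complex.exp (2 * Real.pi * Complex.I * n * (x.1 : ℂ) / ((2 * Real.pi : ℝ) : ℂ)) := by
      have h2 : ContDiff ℝ ((⊤ : ℕ∞) : WithTop ℕ∞) fun x : ℝ × ℝ => (x.1 : ℂ) :=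
        Complex.ofRealCLM.contDiff.comp contDiff_fst
      exact ((contDiff_const.mul h2).div_const _).cexp
    have h3 : ContDiff ℝ ((⊤ : ℕ∞) : WithTop ℕ∞) fun x : ℝ × ℝ =>
        (Complex.exp (2 * Real.pi * Complex.I * n * (x.1 : ℂ) / ((2 * Real.pi : ℝ) : ℂ)) *
          c x.2).re :=
      Complex.reCLM.contDiff.comp (h1.mul (hc.comp contDiff_snd))
    simpa only [fourier_coe_apply] using h3
  compact := by
    refine HasCompactSupport.intro (K := univ ×ˢ tsupport c) (isCompact_univ.prod hcc) fun p hp => ?_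
    have : p.2 ∉ tsupport c := fun h => hp ⟨mem_univ _, h⟩
    simp [image_eq_zero_of_notMem_tsupport this]

lemma angularDeriv_re_mode (n : ℤ) (c : ℝ → ℂ) (p : Cylinder) :
    angularDeriv (fun p => ((fourier n p.1 : ℂ) * c p.2).re) p =
      (Complex.I * n * fourier n p.1 * c p.2).re := by
  have h1 := ((hasDerivAt_fourier_add n p.1).mul_const (c p.2))
  have h2 := (Complex.reCLM.hasFDerivAt.comp_hasDerivAt (0 : ℝ) h1)
  exact h2.deriv

/-- The right-hand side of the equation for the pairings of the `ℓ`-th mode. -/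
noncomputable def modeFlux (K : ℝ) (μ : ProbabilityMeasure Cylinder) (ℓ : ℤ) (c : ℝ → ℂ) : ℂ :=
  -(Complex.I * ℓ) * modePairing μ ℓ (fun ω => ω * c ω) +
    (K * ℓ / 2) * (conj (orderParameter μ) * modePairing μ (ℓ - 1) c -
      orderParameter μ * modePairing μ (ℓ + 1) c)

lemma integral_velocity_mul_angularDeriv (K : ℝ) (μ : ProbabilityMeasure Cylinder) (ℓ : ℤ)
    {c : ℝ → ℂ} (hc : Continuous c) (hcc : HasCompactSupport c) :
    ∫ p, kuramotoVelocity K μ p * angularDeriv (fun p => ((fourier (-ℓ) p.1 : ℂ) * c p.2).re) p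
      ∂(μ : Measure Cylinder) = (modeFlux K μ ℓ c).re := by
  obtain ⟨C, hC⟩ := hcc.exists_bound_of_continuous hc
  have hωc : Continuous fun ω : ℝ => (ω : ℂ) * c ω := by fun_prop
  obtain ⟨C', hC'⟩ := (hcc.mul_left (f := fun ω : ℝ => (ω : ℂ))).exists_bound_of_continuous hωc
  set z := orderParameter μ with hz
  have i1 := (integrable_mode μ (-ℓ) hωc hC').const_mul (-(Complex.I * ℓ))
  have i2 := (integrable_mode μ (-(ℓ - 1)) hc hC).const_mul (conj z)
  have i3 := (integrable_mode μ (-(ℓ + 1)) hc hC).const_mul z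
  have i4 : Integrable (fun p : Cylinder => (K * ℓ / 2 : ℂ) *
      (conj z * (fourier (-(ℓ - 1)) p.1 * c p.2) - z * (fourier (-(ℓ + 1)) p.1 * c p.2)))
      (μ : Measure Cylinder) := (i2.sub i3).const_mul ((K * ℓ / 2 : ℂ))
  have hpt : ∀ p : Cylinder, kuramotoVelocity K μ p *
      angularDeriv (fun p => ((fourier (-ℓ) p.1 : ℂ) * c p.2).re) p =
      Complex.reCLM (-(Complex.I * ℓ) * (fourier (-ℓ) p.1 * (p.2 * c p.2)) +
        (K * ℓ / 2) * (conj z * (fourier (-(ℓ - 1)) p.1 * c p.2) -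
          z * (fourier (-(ℓ + 1)) p.1 * c p.2))) := by
    intro p
    rw [kuramotoVelocity_eq, angularDeriv_re_mode, Complex.reCLM_apply, ← Complex.re_ofReal_mul]
    congr 1
    have e1 : (fourier (-(ℓ - 1)) p.1 : ℂ) = fourier 1 p.1 * fourier (-ℓ) p.1 := by
      rw [← fourier_add]
      congr 2
      ring
    have e2 : (fourier (-(ℓ + 1)) p.1 : ℂ) = fourier (-1) p.1 * fourier (-ℓ) p.1 := by
      rw [← fourier_add]
      congr 2
      ring
    have e3 : ((z * fourier (-1) p.1).im : ℂ) =
        (z * fourier (-1) p.1 - conj z * fourier 1 p.1) / (2 * Complex.I) := by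
      have h := Complex.im_eq_sub_conj (z * fourier (-1) p.1)
      rw [h, map_mul, fourier_neg, Complex.conj_conj]
    rw [e1, e2]
    push_cast
    rw [← hz, e3]
    have hI : Complex.I ≠ 0 := Complex.I_ne_zero
    have hI2 : Complex.I ^ 2 = -1 := Complex.I_sq
    field_simp
    ring
  simp_rw [hpt]
  refine (Complex.reCLM.integral_comp_comm (i1.add i4)).trans ?_
  rw [integral_add' i1 i4, integral_const_mul, integral_const_mul, integral_sub i2 i3,
    integral_const_mul, integral_const_mul]
  rfl

namespace IsKuramotoSolution

variable {K : ℝ} {f : ℝ≥0 → ProbabilityMeasure Cylinder}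

lemma continuous_integral (hf : IsKuramotoSolution K f) {h : Cylinder → ℂ} {C : ℝ}
    (hh : Continuous h) (hC : ∀ p, ‖h p‖ ≤ C) :
    Continuous fun s : ℝ => ∫ p, h p ∂(f s.toNNReal : Measure Cylinder) := by
  have hc : Continuous fun s : ℝ => f s.toNNReal := hf.continuous.comp continuous_real_toNNReal
  refine continuous_iff_continuousAt.2 fun s => ?_
  exact (ProbabilityMeasure.tendsto_iff_forall_integral_rclike_tendsto ℂ).1 (hc.tendsto s)
    (BoundedContinuousFunction.ofNormedAddCommGroup h hh C hC)

lemma continuous_orderParameter (hf : IsKuramotoSolution K f) :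
    Continuous fun s : ℝ => orderParameter (f s.toNNReal) :=
  hf.continuous_integral (C := 1) (by fun_prop) fun p => (norm_fourier_apply _ _).le

lemma continuous_modePairing (hf : IsKuramotoSolution K f) (ℓ : ℤ) {c : ℝ → ℂ} {C : ℝ}
    (hc : Continuous c) (hC : ∀ ω, ‖c ω‖ ≤ C) :
    Continuous fun s : ℝ => modePairing (f s.toNNReal) ℓ c :=
  hf.continuous_integral (C := C) (by fun_prop) fun p => by
    rw [norm_mul, norm_fourier_apply, one_mul]
    exact hC _

lemma continuous_modeFlux (hf : IsKuramotoSolution K f) (ℓ : ℤ) {c : ℝ → ℂ} (hc : Continuous c)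
    (hcc : HasCompactSupport c) : Continuous fun s : ℝ => modeFlux K (f s.toNNReal) ℓ c := by
  obtain ⟨C, hC⟩ := hcc.exists_bound_of_continuous hc
  have hωc : Continuous fun ω : ℝ => (ω : ℂ) * c ω := by fun_prop
  obtain ⟨C', hC'⟩ := (hcc.mul_left (f := fun ω : ℝ => (ω : ℂ))).exists_bound_of_continuous hωc
  have h1 := hf.continuous_modePairing ℓ hωc hC'
  have h2 := hf.continuous_modePairing (ℓ - 1) hc hC
  have h3 := hf.continuous_modePairing (ℓ + 1) hc hC
  have h4 := hf.continuous_orderParameter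
  unfold modeFlux
  fun_prop

/-- The weak equation for the complex test functions `e^{-iℓθ} c(ω)`, which is stated in
`IsKuramotoSolution` for real ones only. -/
lemma modePairing_eq (hf : IsKuramotoSolution K f) (ℓ : ℤ) {c : ℝ → ℂ}
    (hc : ContDiff ℝ ((⊤ : ℕ∞) : WithTop ℕ∞) c) (hcc : HasCompactSupport c) {t : ℝ} (ht : 0 ≤ t) :
    modePairing (f t.toNNReal) ℓ c = modePairing (f 0) ℓ c +
      ∫ s in (0 : ℝ)..t, modeFlux K (f s.toNNReal) ℓ c := by
  have hre : ∀ c : ℝ → ℂ, ContDiff ℝ ((⊤ : ℕ∞) : WithTop ℕ∞) c → HasCompactSupport c →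
      (modePairing (f t.toNNReal) ℓ c).re = (modePairing (f 0) ℓ c).re +
        (∫ s in (0 : ℝ)..t, modeFlux K (f s.toNNReal) ℓ c).re := by
    intro c hc hcc
    obtain ⟨C, hC⟩ := hcc.exists_bound_of_continuous hc.continuous
    have h := hf.weak_eq _ (isCylinderTest_re_mode (-ℓ) hc hcc) t.toNNReal
    simp_rw [integral_velocity_mul_angularDeriv K _ ℓ hc.continuous hcc] at h
    have hX : ∀ μ : ProbabilityMeasure Cylinder,
        ∫ p, ((fourier (-ℓ) p.1 : ℂ) * c p.2).re ∂(μ : Measure Cylinder) =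
          (modePairing μ ℓ c).re := fun μ =>
      Complex.reCLM.integral_comp_comm (integrable_mode μ (-ℓ) hc.continuous hC)
    have hY : ∫ s in (0 : ℝ)..t, (modeFlux K (f s.toNNReal) ℓ c).re =
        (∫ s in (0 : ℝ)..t, modeFlux K (f s.toNNReal) ℓ c).re :=
      Complex.reCLM.intervalIntegral_comp_comm
        ((hf.continuous_modeFlux ℓ hc.continuous hcc).intervalIntegrable _ _)
    rwa [hX, hX, Real.coe_toNNReal t ht, hY] at h
  refine Complex.ext (by rw [Complex.add_re]; exact hre c hc hcc) ?_
  -- the imaginary part is the real part for the test function `-i c`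
  have him := hre (fun ω => -Complex.I * c ω) (contDiff_const.mul hc) hcc.mul_left
  have hP : ∀ (μ : ProbabilityMeasure Cylinder) (n : ℤ) (c : ℝ → ℂ),
      modePairing μ n (fun ω => -Complex.I * c ω) = -Complex.I * modePairing μ n c := by
    intro μ n c
    rw [modePairing, modePairing, ← integral_const_mul]
    refine integral_congr_ae (ae_of_all _ fun p => ?_)
    simp only
    ring
  have hF : ∀ μ : ProbabilityMeasure Cylinder,
      modeFlux K μ ℓ (fun ω => -Complex.I * c ω) = -Complex.I * modeFlux K μ ℓ c := by
    intro μ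
    have e : (fun ω : ℝ => (ω : ℂ) * (-Complex.I * c ω)) = fun ω : ℝ => -Complex.I * (ω * c ω) := by
      funext ω
      ring
    simp only [modeFlux]
    rw [e, hP, hP, hP]
    ring
  simp_rw [hP, hF] at him
  rw [intervalIntegral.integral_const_mul] at him
  simpa using him

end IsKuramotoSolution

/-! ### Fourier coefficients along characteristics -/

/-- The character `ω ↦ e^{-iσω}` of the frequency variable. -/
noncomputable def freqExp (σ ω : ℝ) : ℂ := Complex.exp (-(Complex.I * σ * ω))

lemma norm_freqExp (σ ω : ℝ) : ‖freqExp σ ω‖ = 1 := by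
  rw [freqExp, show -(Complex.I * (σ : ℂ) * ω) = ((-(σ * ω) : ℝ) : ℂ) * Complex.I by push_cast; ring,
    Complex.norm_exp_ofReal_mul_I]

lemma contDiff_freqExp (σ : ℝ) : ContDiff ℝ ((⊤ : ℕ∞) : WithTop ℕ∞) (freqExp σ) := by
  have h : ContDiff ℝ ((⊤ : ℕ∞) : WithTop ℕ∞) fun ω : ℝ => (ω : ℂ) := Complex.ofRealCLM.contDiff
  exact (contDiff_const.mul h).neg.cexp

lemma continuous_freqExp (σ : ℝ) : Continuous (freqExp σ) := (contDiff_freqExp σ).continuous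

lemma cylinderFourier_eq_modePairing (μ : ProbabilityMeasure Cylinder) (ℓ : ℤ) (τ : ℝ) :
    cylinderFourier μ ℓ τ = modePairing μ ℓ (freqExp τ) := rfl

lemma norm_cylinderFourier_le (μ : ProbabilityMeasure Cylinder) (ℓ : ℤ) (τ : ℝ) :
    ‖cylinderFourier μ ℓ τ‖ ≤ 1 :=
  norm_modePairing_le μ ℓ fun ω => (norm_freqExp τ ω).le

/-- Smooth cutoffs of the frequency variable, equal to `1` on `[-(k + 1), k + 1]`. -/
noncomputable def freqCutoff (k : ℕ) : ContDiffBump (0 : ℝ) where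
  rIn := k + 1
  rOut := k + 2
  rIn_pos := by positivity
  rIn_lt_rOut := by linarith

lemma norm_freqCutoff_le (k : ℕ) (ω : ℝ) : ‖((freqCutoff k ω : ℝ) : ℂ)‖ ≤ 1 := by
  rw [Complex.norm_real, Real.norm_of_nonneg (freqCutoff k).nonneg]
  exact (freqCutoff k).le_one

lemma tendsto_freqCutoff (ω : ℝ) :
    Tendsto (fun k => ((freqCutoff k ω : ℝ) : ℂ)) atTop (𝓝 1) := by
  refine tendsto_const_nhds.congr' ?_
  filter_upwards [tendsto_natCast_atTop_atTop.eventually_ge_atTop |ω|] with k hk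
  have : ω ∈ Metric.closedBall (0 : ℝ) (freqCutoff k).rIn := by
    rw [mem_closedBall_zero_iff, Real.norm_eq_abs]
    exact hk.trans (by simp [freqCutoff])
  rw [(freqCutoff k).one_of_mem_closedBall this, Complex.ofReal_one]

lemma hasCompactSupport_mul_freqCutoff (c : ℝ → ℂ) (k : ℕ) :
    HasCompactSupport fun ω => c ω * ((freqCutoff k ω : ℝ) : ℂ) :=
  HasCompactSupport.mul_left (f' := fun ω => ((freqCutoff k ω : ℝ) : ℂ))
    ((freqCutoff k).hasCompactSupport.comp_left (g := fun r : ℝ => (r : ℂ)) (by simp))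

lemma contDiff_mul_freqCutoff {c : ℝ → ℂ} (hc : ContDiff ℝ ((⊤ : ℕ∞) : WithTop ℕ∞) c) (k : ℕ) :
    ContDiff ℝ ((⊤ : ℕ∞) : WithTop ℕ∞) fun ω => c ω * ((freqCutoff k ω : ℝ) : ℂ) :=
  hc.mul (Complex.ofRealCLM.contDiff.comp (freqCutoff k).contDiff)

lemma norm_mul_freqCutoff_le {c : ℝ → ℂ} {C : ℝ} (hC : ∀ ω, ‖c ω‖ ≤ C) (k : ℕ) (ω : ℝ) :
    ‖c ω * ((freqCutoff k ω : ℝ) : ℂ)‖ ≤ C := by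
  rw [norm_mul]
  exact (mul_le_of_le_one_right (norm_nonneg _) (norm_freqCutoff_le k ω)).trans (hC ω)

lemma tendsto_modePairing_mul_freqCutoff (μ : ProbabilityMeasure Cylinder) (ℓ : ℤ) {c : ℝ → ℂ}
    {C : ℝ} (hc : Continuous c) (hC : ∀ ω, ‖c ω‖ ≤ C) :
    Tendsto (fun k => modePairing μ ℓ fun ω => c ω * ((freqCutoff k ω : ℝ) : ℂ)) atTop
      (𝓝 (modePairing μ ℓ c)) := by
  refine tendsto_integral_of_dominated_convergence (fun _ => C) (fun k => ?_)
    (integrable_const C) (fun k => ae_of_all _ fun p => ?_) (ae_of_all _ fun p => ?_)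
  · have := (freqCutoff k).continuous
    exact (integrable_mode μ (-ℓ) (c := fun ω => c ω * ((freqCutoff k ω : ℝ) : ℂ))
      (by fun_prop) (norm_mul_freqCutoff_le hC k)).aestronglyMeasurable
  · rw [norm_mul, norm_fourier_apply, one_mul]
    exact norm_mul_freqCutoff_le hC k _
  · have := ((tendsto_freqCutoff p.2).const_mul (c p.2)).const_mul (fourier (-ℓ) p.1 : ℂ)
    simpa using this

namespace IsKuramotoSolution

variable {K : ℝ} {f : ℝ≥0 → ProbabilityMeasure Cylinder}

/-- The zeroth angular mode is constant in time, since its flux vanishes. -/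
lemma modePairing_zero_eq (hf : IsKuramotoSolution K f) (t : ℝ≥0) {c : ℝ → ℂ} {C : ℝ}
    (hc : ContDiff ℝ ((⊤ : ℕ∞) : WithTop ℕ∞) c) (hC : ∀ ω, ‖c ω‖ ≤ C) :
    modePairing (f t) 0 c = modePairing (f 0) 0 c := by
  refine tendsto_nhds_unique (tendsto_modePairing_mul_freqCutoff (f t) 0 hc.continuous hC) ?_
  refine (tendsto_modePairing_mul_freqCutoff (f 0) 0 hc.continuous hC).congr fun k => ?_
  have h := hf.modePairing_eq 0 (contDiff_mul_freqCutoff hc k)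
    (hasCompactSupport_mul_freqCutoff c k) (t := (t : ℝ)) t.coe_nonneg
  have h0 : ∀ μ : ProbabilityMeasure Cylinder,
      modeFlux K μ 0 (fun ω => c ω * ((freqCutoff k ω : ℝ) : ℂ)) = 0 := fun μ => by simp [modeFlux]
  simp only [h0, intervalIntegral.integral_zero, add_zero] at h
  rw [Real.toNNReal_coe] at h
  exact h.symm

/-- The frequency marginal is conserved. -/
lemma map_snd_eq (hf : IsKuramotoSolution K f) (t : ℝ≥0) :
    (f t : Measure Cylinder).map Prod.snd = (f 0 : Measure Cylinder).map Prod.snd := by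
  have : ∀ s, IsFiniteMeasure ((f s : Measure Cylinder).map Prod.snd) := fun s => inferInstance
  refine Measure.ext_of_charFun ?_
  funext τ
  have h : ∀ s, charFun ((f s : Measure Cylinder).map Prod.snd) τ =
      modePairing (f s) 0 (freqExp (-τ)) := by
    intro s
    rw [charFun_apply_real, integral_map measurable_snd.aemeasurable
      (Continuous.aestronglyMeasurable (by fun_prop)), modePairing]
    refine integral_congr_ae (ae_of_all _ fun p => ?_)
    simp only [neg_zero, fourier_zero, one_mul, freqExp]
    congr 1
    push_cast
    ring
  rw [h, h, hf.modePairing_zero_eq t (contDiff_freqExp _) fun ω => (norm_freqExp _ ω).le]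

/-- Joint continuity in time and in the dual frequency. Conservation of the frequency marginal
makes the integrals equicontinuous in `σ`, although the frequencies are unbounded. -/
lemma continuous_integral_mul_freqExp (hf : IsKuramotoSolution K f) {h : Cylinder → ℂ} {C : ℝ}
    (hh : Continuous h) (hC : ∀ p, ‖h p‖ ≤ C) :
    Continuous fun x : ℝ × ℝ =>
      ∫ p, h p * freqExp x.2 p.2 ∂(f x.1.toNNReal : Measure Cylinder) := by
  set G : ℝ × ℝ → ℂ := fun x => ∫ p, h p * freqExp x.2 p.2 ∂(f x.1.toNNReal : Measure Cylinder)
    with hG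
  set ν := (f 0 : Measure Cylinder).map Prod.snd with hν
  have : IsFiniteMeasure ν := by rw [hν]; infer_instance
  set m : ℝ → ℝ := fun r => ∫ ω, ‖freqExp r ω - 1‖ ∂ν with hm
  have hmc : Continuous m := by
    refine continuous_of_dominated (bound := fun _ => 2) (fun r => ?_)
      (fun r => ae_of_all _ fun ω => ?_) (integrable_const _) (ae_of_all _ fun ω => ?_)
    · have := continuous_freqExp r
      exact Continuous.aestronglyMeasurable (by fun_prop)
    · rw [norm_norm]
      refine (norm_sub_le _ _).trans ?_
      rw [norm_freqExp, norm_one]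
      norm_num
    · unfold freqExp
      fun_prop
  have hm0 : m 0 = 0 := by simp [hm, freqExp]
  have hC0 : 0 ≤ C := (norm_nonneg _).trans (hC (0, 0))
  have hbd : ∀ σ p, ‖h p * freqExp σ p.2‖ ≤ C := fun σ p => by
    rw [norm_mul, norm_freqExp, mul_one]
    exact hC p
  have hcont : ∀ σ, Continuous fun p : Cylinder => h p * freqExp σ p.2 := fun σ => by
    have := continuous_freqExp σ
    fun_prop
  have hint : ∀ (s : ℝ≥0) σ, Integrable (fun p : Cylinder => h p * freqExp σ p.2)
      (f s : Measure Cylinder) := fun s σ =>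
    integrable_of_continuous_of_bound _ (hcont σ) (hbd σ)
  have hequi : ∀ s σ σ₀, ‖G (s, σ) - G (s, σ₀)‖ ≤ C * m (σ - σ₀) := by
    intro s σ σ₀
    simp only [hG]
    rw [← integral_sub (hint _ _) (hint _ _)]
    have hmi : ∫ p : Cylinder, C * ‖freqExp (σ - σ₀) p.2 - 1‖ ∂(f s.toNNReal : Measure Cylinder) =
        C * m (σ - σ₀) := by
      rw [integral_const_mul, hm, hν, ← hf.map_snd_eq s.toNNReal]
      congr 1
      simp only
      rw [integral_map measurable_snd.aemeasurable]
      have := continuous_freqExp (σ - σ₀)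
      exact Continuous.aestronglyMeasurable (by fun_prop)
    rw [← hmi]
    refine norm_integral_le_of_norm_le ?_ (ae_of_all _ fun p => ?_)
    · have := continuous_freqExp (σ - σ₀)
      refine (integrable_of_continuous_of_bound (C := 2) _ (by fun_prop) fun p => ?_).const_mul C
      rw [norm_norm]
      refine (norm_sub_le _ _).trans ?_
      rw [norm_freqExp, norm_one]
      norm_num
    · have e : h p * freqExp σ p.2 - h p * freqExp σ₀ p.2 =
          h p * freqExp σ₀ p.2 * (freqExp (σ - σ₀) p.2 - 1) := by
        have : freqExp σ p.2 = freqExp σ₀ p.2 * freqExp (σ - σ₀) p.2 := by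
          rw [freqExp, freqExp, freqExp, ← Complex.exp_add]
          congr 1
          push_cast
          ring
        rw [this]
        ring
      rw [e, norm_mul]
      exact mul_le_mul_of_nonneg_right (hbd _ _) (norm_nonneg _)
  refine continuous_iff_continuousAt.2 fun x₀ => ?_
  refine tendsto_iff_norm_sub_tendsto_zero.2 ?_
  have h1 : Tendsto (fun x : ℝ × ℝ => C * m (x.2 - x₀.2) + ‖G (x.1, x₀.2) - G x₀‖) (𝓝 x₀)
      (𝓝 0) := by
    have hs : Continuous fun s : ℝ => G (s, x₀.2) := hf.continuous_integral (hcont _) (hbd _)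
    have hfull : Continuous fun x : ℝ × ℝ => C * m (x.2 - x₀.2) + ‖G (x.1, x₀.2) - G x₀‖ := by
      have h2 : Continuous fun x : ℝ × ℝ => G (x.1, x₀.2) := hs.comp continuous_fst
      exact ((hmc.comp (by fun_prop : Continuous fun x : ℝ × ℝ => x.2 - x₀.2)).const_mul C).add
        (h2.sub continuous_const).norm
    have := hfull.tendsto x₀
    simpa [hm0] using this
  refine squeeze_zero (fun x => norm_nonneg _) (fun x => ?_) h1
  calc ‖G x - G x₀‖ = ‖(G (x.1, x.2) - G (x.1, x₀.2)) + (G (x.1, x₀.2) - G x₀)‖ := by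
        congr 1
        simp
    _ ≤ _ := (norm_add_le _ _).trans (add_le_add (hequi _ _ _) le_rfl)

lemma continuous_cylinderFourier (hf : IsKuramotoSolution K f) (ℓ : ℤ) :
    Continuous fun x : ℝ × ℝ => cylinderFourier (f x.1.toNNReal) ℓ x.2 :=
  hf.continuous_integral_mul_freqExp (h := fun p : Cylinder => fourier (-ℓ) p.1) (C := 1)
    (by fun_prop) fun p => (norm_fourier_apply _ _).le

lemma continuous_modePairing_freqExp_mul (hf : IsKuramotoSolution K f) (ℓ : ℤ) {c : ℝ → ℂ} {C : ℝ}
    (hc : Continuous c) (hC : ∀ ω, ‖c ω‖ ≤ C) :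
    Continuous fun x : ℝ × ℝ => modePairing (f x.1.toNNReal) ℓ fun ω => freqExp x.2 ω * c ω := by
  have h := hf.continuous_integral_mul_freqExp
    (h := fun p : Cylinder => fourier (-ℓ) p.1 * c p.2) (C := C) (by fun_prop) fun p => by
      rw [norm_mul, norm_fourier_apply, one_mul]
      exact hC _
  refine h.congr fun x => integral_congr_ae (ae_of_all _ fun p => ?_)
  simp only
  ring

lemma hasDerivAt_modePairing_freqExp_mul (μ : ProbabilityMeasure Cylinder) (ℓ : ℤ) {c : ℝ → ℂ}
    (hc : Continuous c) (hcc : HasCompactSupport c) (σ : ℝ) :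
    HasDerivAt (fun σ => modePairing μ ℓ fun ω => freqExp σ ω * c ω)
      (-Complex.I * modePairing μ ℓ fun ω => freqExp σ ω * (ω * c ω)) σ := by
  obtain ⟨C, hC⟩ := hcc.exists_bound_of_continuous hc
  have hωc : Continuous fun ω : ℝ => (ω : ℂ) * c ω := by fun_prop
  obtain ⟨C', hC'⟩ := (hcc.mul_left (f := fun ω : ℝ => (ω : ℂ))).exists_bound_of_continuous hωc
  have hi : ∀ σ (c : ℝ → ℂ) (C : ℝ), Continuous c → (∀ ω, ‖c ω‖ ≤ C) → Integrable
      (fun p : Cylinder => fourier (-ℓ) p.1 * (freqExp σ p.2 * c p.2)) (μ : Measure Cylinder) := by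
    intro σ c C hc hC
    have := continuous_freqExp σ
    refine integrable_mode μ (-ℓ) (c := fun ω => freqExp σ ω * c ω) (C := C) (by fun_prop)
      fun ω => ?_
    rw [norm_mul, norm_freqExp, one_mul]
    exact hC ω
  have h := (hasDerivAt_integral_of_dominated_loc_of_deriv_le (μ := (μ : Measure Cylinder))
    (F := fun σ (p : Cylinder) => fourier (-ℓ) p.1 * (freqExp σ p.2 * c p.2))
    (F' := fun σ (p : Cylinder) => -Complex.I * (fourier (-ℓ) p.1 * (freqExp σ p.2 * (p.2 * c p.2))))
    (bound := fun _ => C') (x₀ := σ) univ_mem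
    (Eventually.of_forall fun σ => (hi σ c C hc hC).aestronglyMeasurable) (hi σ c C hc hC)
    ((hi σ _ C' hωc hC').const_mul _).aestronglyMeasurable
    (ae_of_all _ fun p σ _ => ?_) (integrable_const _) (ae_of_all _ fun p σ _ => ?_)).2
  · refine h.congr_deriv ?_
    rw [integral_const_mul]
    rfl
  · rw [norm_mul, norm_mul, norm_mul, norm_neg, Complex.norm_I, norm_fourier_apply, norm_freqExp,
      one_mul, one_mul, one_mul]
    exact hC' _
  · have h1 : HasDerivAt (fun σ : ℝ => freqExp σ p.2)
        (freqExp σ p.2 * -(Complex.I * 1 * p.2)) σ := by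
      have h0 : HasDerivAt (fun σ : ℝ => (σ : ℂ)) 1 σ := Complex.ofRealCLM.hasDerivAt
      exact ((h0.const_mul Complex.I).mul_const (p.2 : ℂ)).neg.cexp
    refine ((h1.mul_const (c p.2)).const_mul (fourier (-ℓ) p.1 : ℂ)).congr_deriv ?_
    ring

/-- The modes tested against a compactly supported frequency cutoff, along characteristics. The
cutoff makes them differentiable in the dual frequency, which the Fourier coefficients themselves
need not be; the transport term then cancels along the line `σ = ξ - ℓ s`. -/
lemma modePairing_characteristic (hf : IsKuramotoSolution K f) (ℓ : ℤ) {c : ℝ → ℂ}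
    (hc : ContDiff ℝ ((⊤ : ℕ∞) : WithTop ℕ∞) c) (hcc : HasCompactSupport c) {t : ℝ} (ht : 0 ≤ t)
    (ξ : ℝ) :
    modePairing (f t.toNNReal) ℓ (fun ω => freqExp (ξ - ℓ * t) ω * c ω) =
      modePairing (f 0) ℓ (fun ω => freqExp ξ ω * c ω) +
      ∫ s in (0 : ℝ)..t, (K * ℓ / 2 : ℂ) * (conj (orderParameter (f s.toNNReal)) *
          modePairing (f s.toNNReal) (ℓ - 1) (fun ω => freqExp (ξ - ℓ * s) ω * c ω) -
        orderParameter (f s.toNNReal) *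
          modePairing (f s.toNNReal) (ℓ + 1) (fun ω => freqExp (ξ - ℓ * s) ω * c ω)) := by
  obtain ⟨C, hC⟩ := hcc.exists_bound_of_continuous hc.continuous
  have hcont := hc.continuous
  have hωc : Continuous fun ω : ℝ => (ω : ℂ) * c ω := by fun_prop
  obtain ⟨C', hC'⟩ := (hcc.mul_left (f := fun ω : ℝ => (ω : ℂ))).exists_bound_of_continuous hωc
  have hz := hf.continuous_orderParameter
  have hzp : Continuous fun x : ℝ × ℝ => orderParameter (f x.1.toNNReal) := hz.comp continuous_fst
  have hQc := fun n : ℤ => hf.continuous_modePairing_freqExp_mul n hcont hC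
  have hQωc := hf.continuous_modePairing_freqExp_mul ℓ hωc hC'
  -- partial derivatives in time and in the dual frequency
  set D₁ : ℝ → ℝ → ℂ := fun s σ => modeFlux K (f s.toNNReal) ℓ fun ω => freqExp σ ω * c ω with hD₁
  set D₂ : ℝ → ℝ → ℂ := fun s σ =>
    -Complex.I * modePairing (f s.toNNReal) ℓ fun ω => freqExp σ ω * (ω * c ω) with hD₂
  have hD₁eq : ∀ s σ, D₁ s σ = ℓ * D₂ s σ + (K * ℓ / 2 : ℂ) *
      (conj (orderParameter (f s.toNNReal)) *
        modePairing (f s.toNNReal) (ℓ - 1) (fun ω => freqExp σ ω * c ω) -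
      orderParameter (f s.toNNReal) *
        modePairing (f s.toNNReal) (ℓ + 1) (fun ω => freqExp σ ω * c ω)) := by
    intro s σ
    have e : (fun ω : ℝ => (ω : ℂ) * (freqExp σ ω * c ω)) =
        fun ω : ℝ => freqExp σ ω * (ω * c ω) := by
      funext ω
      ring
    simp only [hD₁, hD₂, modeFlux]
    rw [e]
    ring
  have hD₂c : Continuous fun x : ℝ × ℝ => D₂ x.1 x.2 := continuous_const.mul hQωc
  have hD₁c : Continuous fun x : ℝ × ℝ => D₁ x.1 x.2 := by
    simp only [hD₁eq]
    have := hQc (ℓ - 1)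
    have := hQc (ℓ + 1)
    fun_prop
  have hs : ∀ s σ, 0 < s → HasDerivAt (fun s : ℝ => modePairing (f s.toNNReal) ℓ
      fun ω => freqExp σ ω * c ω) (D₁ s σ) s := by
    intro s σ hs
    have hσc : Continuous fun s => D₁ s σ :=
      hD₁c.comp (f := fun s : ℝ => (s, σ)) (by fun_prop)
    have h1 := (intervalIntegral.integral_hasDerivAt_right (hσc.intervalIntegrable 0 s)
      (hσc.stronglyMeasurableAtFilter _ _) hσc.continuousAt).const_add
        (modePairing (f 0) ℓ fun ω => freqExp σ ω * c ω)
    refine h1.congr_of_eventuallyEq ?_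
    filter_upwards [Ioi_mem_nhds hs] with r hr
    exact hf.modePairing_eq ℓ ((contDiff_freqExp σ).mul hc) hcc.mul_left (le_of_lt hr)
  have htot : ∀ s, 0 < s → HasDerivAt (fun s : ℝ => modePairing (f s.toNNReal) ℓ
      fun ω => freqExp (ξ - ℓ * s) ω * c ω) ((K * ℓ / 2 : ℂ) *
      (conj (orderParameter (f s.toNNReal)) *
        modePairing (f s.toNNReal) (ℓ - 1) (fun ω => freqExp (ξ - ℓ * s) ω * c ω) -
      orderParameter (f s.toNNReal) *
        modePairing (f s.toNNReal) (ℓ + 1) (fun ω => freqExp (ξ - ℓ * s) ω * c ω))) s := by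
    intro s hs0
    have hF := hasStrictFDerivAt_uncurry_coprod (𝕜 := ℝ) (u := ((s, ξ - ℓ * s) : ℝ × ℝ))
      (f := fun s σ => modePairing (f s.toNNReal) ℓ fun ω => freqExp σ ω * c ω)
      (f₁ := fun s σ => ContinuousLinearMap.toSpanSingleton ℝ (D₁ s σ))
      (f₂ := fun s σ => ContinuousLinearMap.toSpanSingleton ℝ (D₂ s σ))
      (by
        filter_upwards [continuous_fst.tendsto (s, ξ - ℓ * s) (Ioi_mem_nhds hs0)] with x hx
        exact (hs x.1 x.2 hx).hasFDerivAt)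
      (Eventually.of_forall fun x =>
        (hasDerivAt_modePairing_freqExp_mul _ ℓ hcont hcc x.2).hasFDerivAt)
      (((ContinuousLinearMap.toSpanSingletonCLE (𝕜 := ℝ) (E := ℂ)).continuous.comp
        hD₁c).continuousAt)
      (((ContinuousLinearMap.toSpanSingletonCLE (𝕜 := ℝ) (E := ℂ)).continuous.comp
        hD₂c).continuousAt)
    have hline : HasDerivAt (fun s : ℝ => ((s, ξ - ℓ * s) : ℝ × ℝ)) ((1, -ℓ) : ℝ × ℝ) s := by
      refine (hasDerivAt_id s).prodMk ?_
      simpa using ((hasDerivAt_id s).const_mul (ℓ : ℝ)).const_sub ξ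
    refine (hF.hasFDerivAt.comp_hasDerivAt s hline).congr_deriv ?_
    change (1 : ℝ) • D₁ s (ξ - ℓ * s) + (-ℓ : ℝ) • D₂ s (ξ - ℓ * s) = _
    rw [hD₁eq, one_smul, Complex.real_smul]
    push_cast
    ring
  have hcurve : ∀ n : ℤ, Continuous fun s : ℝ => modePairing (f s.toNNReal) n
      fun ω => freqExp (ξ - ℓ * s) ω * c ω := fun n =>
    (hQc n).comp (f := fun s : ℝ => (s, ξ - ℓ * s)) (by fun_prop)
  rw [intervalIntegral.integral_eq_sub_of_hasDerivAt_of_le ht (hcurve ℓ).continuousOn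
    fun s hs => htot s hs.1]
  · simp
  · have := hcurve (ℓ - 1)
    have := hcurve (ℓ + 1)
    exact Continuous.intervalIntegrable (by fun_prop) _ _

/-- Duhamel's formula for the Fourier coefficients along characteristics. It involves no derivative
in the dual frequency, so the frequency cutoff can be removed by dominated convergence. -/
lemma cylinderFourier_characteristic (hf : IsKuramotoSolution K f) (ℓ : ℤ) {t : ℝ} (ht : 0 ≤ t)
    (ξ : ℝ) :
    cylinderFourier (f t.toNNReal) ℓ (ξ - ℓ * t) = cylinderFourier (f 0) ℓ ξ +
      ∫ s in (0 : ℝ)..t, (K * ℓ / 2 : ℂ) * (conj (orderParameter (f s.toNNReal)) *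
          cylinderFourier (f s.toNNReal) (ℓ - 1) (ξ - ℓ * s) -
        orderParameter (f s.toNNReal) * cylinderFourier (f s.toNNReal) (ℓ + 1) (ξ - ℓ * s)) := by
  have hψ : ∀ k, ContDiff ℝ ((⊤ : ℕ∞) : WithTop ℕ∞) fun ω => ((freqCutoff k ω : ℝ) : ℂ) := fun k =>
    Complex.ofRealCLM.contDiff.comp (freqCutoff k).contDiff
  have hψc : ∀ k, HasCompactSupport fun ω => ((freqCutoff k ω : ℝ) : ℂ) := fun k =>
    (freqCutoff k).hasCompactSupport.comp_left (g := fun r : ℝ => (r : ℂ)) (by simp)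
  have hlim : ∀ (μ : ProbabilityMeasure Cylinder) (n : ℤ) σ, Tendsto (fun k => modePairing μ n
      fun ω => freqExp σ ω * ((freqCutoff k ω : ℝ) : ℂ)) atTop (𝓝 (cylinderFourier μ n σ)) :=
    fun μ n σ => tendsto_modePairing_mul_freqCutoff μ n (continuous_freqExp σ)
      fun ω => (norm_freqExp σ ω).le
  refine tendsto_nhds_unique (hlim _ _ _) ?_
  simp_rw [fun k => hf.modePairing_characteristic ℓ (hψ k) (hψc k) ht ξ]
  refine (hlim _ _ _).add ?_
  have hz := hf.continuous_orderParameter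
  have hbd : ∀ (μ : ProbabilityMeasure Cylinder) (n : ℤ) σ k,
      ‖modePairing μ n fun ω => freqExp σ ω * ((freqCutoff k ω : ℝ) : ℂ)‖ ≤ 1 := fun μ n σ k =>
    norm_modePairing_le μ n (norm_mul_freqCutoff_le (fun ω => (norm_freqExp σ ω).le) k)
  refine intervalIntegral.tendsto_integral_filter_of_dominated_convergence
    (fun _ => ‖(K * ℓ / 2 : ℂ)‖ * 2) (Eventually.of_forall fun k => ?_)
    (Eventually.of_forall fun k => ae_of_all _ fun s _ => ?_)
    intervalIntegrable_const (ae_of_all _ fun s _ => ?_)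
  · have h1 : ∀ n : ℤ, Continuous fun s : ℝ => modePairing (f s.toNNReal) n
        fun ω => freqExp (ξ - ℓ * s) ω * ((freqCutoff k ω : ℝ) : ℂ) := fun n =>
      (hf.continuous_modePairing_freqExp_mul n (hψ k).continuous (norm_freqCutoff_le k)).comp
        (f := fun s : ℝ => (s, ξ - ℓ * s)) (by fun_prop)
    have := h1 (ℓ - 1)
    have := h1 (ℓ + 1)
    exact Continuous.aestronglyMeasurable (by fun_prop)
  · rw [norm_mul]
    refine mul_le_mul_of_nonneg_left ((norm_sub_le _ _).trans ?_) (norm_nonneg _)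
    rw [norm_mul, norm_mul, RCLike.norm_conj]
    have h1 := norm_orderParameter_le (f s.toNNReal)
    have h2 := mul_le_mul h1 (hbd (f s.toNNReal) (ℓ - 1) (ξ - ℓ * s) k) (norm_nonneg _) zero_le_one
    have h3 := mul_le_mul h1 (hbd (f s.toNNReal) (ℓ + 1) (ξ - ℓ * s) k) (norm_nonneg _) zero_le_one
    linarith
  · exact (((hlim _ _ _).const_mul _).sub ((hlim _ _ _).const_mul _)).const_mul _

/-- The Fourier coefficients of a solution of the Kuramoto equation solve the hierarchy. -/
theorem isModeHierarchy (hf : IsKuramotoSolution K f) :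
    IsModeHierarchy K (fun s => orderParameter (f s.toNNReal))
      fun ℓ s τ => cylinderFourier (f s.toNNReal) ℓ τ where
  continuous ℓ := hf.continuous_cylinderFourier ℓ
  bounded := ⟨1, fun ℓ s τ => norm_cylinderFourier_le _ _ _⟩
  zero_mode s τ := by
    simp only [cylinderFourier_eq_modePairing, Nat.cast_zero, Real.toNNReal_zero]
    exact hf.modePairing_zero_eq _ (contDiff_freqExp τ) fun ω => (norm_freqExp τ ω).le
  transport ℓ s ξ hs := by
    have hz := hf.continuous_orderParameter
    have hcurve : ∀ n : ℤ, Continuous fun s : ℝ => cylinderFourier (f s.toNNReal) n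
        (ξ - ((ℓ : ℝ) + 1) * s) := fun n =>
      (hf.continuous_cylinderFourier n).comp (f := fun s : ℝ => (s, ξ - ((ℓ : ℝ) + 1) * s))
        (by fun_prop)
    set g : ℝ → ℂ := fun s => ((K * ((ℓ : ℝ) + 1) / 2 : ℝ) : ℂ) *
      (conj (orderParameter (f s.toNNReal)) *
        cylinderFourier (f s.toNNReal) (ℓ : ℕ) (ξ - ((ℓ : ℝ) + 1) * s) -
      orderParameter (f s.toNNReal) *
        cylinderFourier (f s.toNNReal) ((ℓ + 2 : ℕ) : ℤ) (ξ - ((ℓ : ℝ) + 1) * s)) with hg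
    have hgc : Continuous g := by
      have := hcurve (ℓ : ℕ)
      have := hcurve ((ℓ + 2 : ℕ) : ℤ)
      simp only [hg]
      fun_prop
    have h1 := (intervalIntegral.integral_hasDerivAt_right (hgc.intervalIntegrable 0 s)
      (hgc.stronglyMeasurableAtFilter _ _) hgc.continuousAt).const_add
        (cylinderFourier (f 0) ((ℓ + 1 : ℕ) : ℤ) ξ)
    refine h1.congr_of_eventuallyEq ?_
    filter_upwards [Ioi_mem_nhds hs] with r hr
    have h2 := hf.cylinderFourier_characteristic ((ℓ + 1 : ℕ) : ℤ) (le_of_lt hr) ξ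
    have e1 : (((ℓ + 1 : ℕ) : ℤ) : ℝ) = (ℓ : ℝ) + 1 := by push_cast; ring
    have e2 : ((ℓ + 1 : ℕ) : ℤ) - 1 = (ℓ : ℕ) := by push_cast; ring
    have e3 : ((ℓ + 1 : ℕ) : ℤ) + 1 = ((ℓ + 2 : ℕ) : ℤ) := by push_cast; ring
    rw [e1, e2, e3] at h2
    rw [h2]
    congr 1
    refine intervalIntegral.integral_congr fun σ _ => ?_
    simp only [hg]
    push_cast
    ring

end IsKuramotoSolution

/-! ### Translation in time -/

/-- Continuity can be tested on the universal cover, because the projection is an open quotient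
map. -/
lemma IsCylinderTest.continuous_angularDeriv {χ : Cylinder → ℝ} (hχ : IsCylinderTest χ) :
    Continuous (angularDeriv χ) := by
  have hq : IsOpenQuotientMap (Prod.map (fun x : ℝ => (x : AddCircle (2 * Real.pi)))
      (id : ℝ → ℝ)) :=
    IsOpenQuotientMap.prodMap QuotientAddGroup.isOpenQuotientMap_mk IsOpenQuotientMap.id
  rw [← hq.continuous_comp_iff]
  set u : ℝ × ℝ → ℝ := fun x => χ ((x.1 : AddCircle (2 * Real.pi)), x.2) with hu
  have e : angularDeriv χ ∘ Prod.map (fun x : ℝ => (x : AddCircle (2 * Real.pi))) (id : ℝ → ℝ) =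
      fun x => fderiv ℝ u x (1, 0) := by
    funext x
    have h1 : HasFDerivAt u (fderiv ℝ u x) x :=
      (hχ.smooth.differentiable (by simp) x).hasFDerivAt
    have h2 : HasDerivAt (fun s : ℝ => ((x.1 + s, x.2) : ℝ × ℝ)) ((1, 0) : ℝ × ℝ) 0 :=
      ((hasDerivAt_id (0 : ℝ)).const_add x.1).prodMk (hasDerivAt_const _ _)
    have h3 := HasFDerivAt.comp_hasDerivAt (x := (0 : ℝ)) (l := u)
      (f := fun s : ℝ => ((x.1 + s, x.2) : ℝ × ℝ)) (by simpa using h1) h2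
    exact h3.deriv
  rw [e]
  exact (hχ.smooth.continuous_fderiv (by simp)).clm_apply continuous_const

lemma IsCylinderTest.hasCompactSupport_angularDeriv {χ : Cylinder → ℝ} (hχ : IsCylinderTest χ) :
    HasCompactSupport (angularDeriv χ) := by
  refine hχ.compact.mono' fun p hp => ?_
  by_contra hps
  refine hp ?_
  have h1 := notMem_tsupport_iff_eventuallyEq.1 hps
  have h2 : Continuous fun s : ℝ => ((p.1 + (s : AddCircle (2 * Real.pi)), p.2) : Cylinder) := by
    have : Continuous fun s : ℝ => (s : AddCircle (2 * Real.pi)) := AddCircle.continuous_mk' _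
    fun_prop
  have h3 : Tendsto (fun s : ℝ => ((p.1 + (s : AddCircle (2 * Real.pi)), p.2) : Cylinder)) (𝓝 0)
      (𝓝 p) := by
    simpa using h2.tendsto 0
  have h4 : (fun s : ℝ => χ (p.1 + (s : AddCircle (2 * Real.pi)), p.2)) =ᶠ[𝓝 0] fun _ => 0 :=
    h3.eventually h1
  rw [angularDeriv, h4.deriv_eq, deriv_const]

namespace IsKuramotoSolution

variable {K : ℝ} {f : ℝ≥0 → ProbabilityMeasure Cylinder}

/-- The flux in the weak equation is continuous in time, hence integrable on bounded intervals. -/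
lemma continuous_integral_velocity_mul_angularDeriv (hf : IsKuramotoSolution K f)
    {χ : Cylinder → ℝ} (hχ : IsCylinderTest χ) :
    Continuous fun s : ℝ => ∫ p, kuramotoVelocity K (f s.toNNReal) p * angularDeriv χ p
      ∂(f s.toNNReal : Measure Cylinder) := by
  have hd := hχ.continuous_angularDeriv
  have hdc := hχ.hasCompactSupport_angularDeriv
  set d := angularDeriv χ
  have h1 : Continuous fun p : Cylinder => ((p.2 * d p : ℝ) : ℂ) := by fun_prop
  have h2 : Continuous fun p : Cylinder => (fourier (-1) p.1 : ℂ) * (d p : ℂ) := by fun_prop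
  obtain ⟨C, hC⟩ := (hdc.mul_left (f := fun p : Cylinder => p.2)).exists_bound_of_continuous
    (by fun_prop)
  obtain ⟨C', hC'⟩ := hdc.exists_bound_of_continuous hd
  have b1 : ∀ p : Cylinder, ‖((p.2 * d p : ℝ) : ℂ)‖ ≤ C := fun p => by
    rw [Complex.norm_real]
    exact hC p
  have b2 : ∀ p : Cylinder, ‖(fourier (-1) p.1 : ℂ) * (d p : ℂ)‖ ≤ C' := fun p => by
    rw [norm_mul, norm_fourier_apply, one_mul, Complex.norm_real]
    exact hC' p
  have key : ∀ μ : ProbabilityMeasure Cylinder,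
      ∫ p, kuramotoVelocity K μ p * d p ∂(μ : Measure Cylinder) =
        (∫ p : Cylinder, ((p.2 * d p : ℝ) : ℂ) ∂(μ : Measure Cylinder)).re +
        K * (orderParameter μ * ∫ p : Cylinder, (fourier (-1) p.1 : ℂ) * (d p : ℂ)
          ∂(μ : Measure Cylinder)).im := by
    intro μ
    have i1 := integrable_of_continuous_of_bound (μ : Measure Cylinder) h1 b1
    have i2 := (integrable_of_continuous_of_bound (μ : Measure Cylinder) h2 b2).const_mul
      (orderParameter μ)
    rw [← integral_const_mul, ← Complex.reCLM_apply, ← Complex.imCLM_apply,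
      ← Complex.reCLM.integral_comp_comm i1, ← Complex.imCLM.integral_comp_comm i2,
      ← integral_const_mul, ← integral_add (Complex.reCLM.integrable_comp i1)
        ((Complex.imCLM.integrable_comp i2).const_mul K)]
    refine integral_congr_ae (ae_of_all _ fun p => ?_)
    simp only [Complex.reCLM_apply, Complex.imCLM_apply]
    rw [kuramotoVelocity_eq, Complex.ofReal_re, ← mul_assoc (orderParameter μ), Complex.im_mul_ofReal]
    ring
  simp_rw [key]
  have c1 := hf.continuous_integral h1 b1
  have c2 := hf.continuous_integral h2 b2
  have c3 := hf.continuous_orderParameter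
  fun_prop

lemma shift (hf : IsKuramotoSolution K f) (t : ℝ≥0) : IsKuramotoSolution K fun s => f (t + s) where
  continuous := hf.continuous.comp (by fun_prop)
  weak_eq χ hχ s := by
    have hc := hf.continuous_integral_velocity_mul_angularDeriv hχ
    set Γ : ℝ → ℝ := fun s => ∫ p, kuramotoVelocity K (f s.toNNReal) p * angularDeriv χ p
      ∂(f s.toNNReal : Measure Cylinder) with hΓ
    have h1 := hf.weak_eq χ hχ (t + s)
    have h2 := hf.weak_eq χ hχ t
    have h3 : ∫ r in (0 : ℝ)..s, ∫ p, kuramotoVelocity K (f (t + r.toNNReal)) p *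
        angularDeriv χ p ∂(f (t + r.toNNReal) : Measure Cylinder) =
        ∫ r in (0 : ℝ)..s, Γ (t + r) := by
      refine intervalIntegral.integral_congr fun r hr => ?_
      rw [uIcc_of_le s.coe_nonneg] at hr
      simp only [hΓ]
      rw [Real.toNNReal_add t.coe_nonneg hr.1, Real.toNNReal_coe]
    have h4 : (∫ r in (0 : ℝ)..(t + s : ℝ≥0), Γ r) - ∫ r in (0 : ℝ)..t, Γ r =
        ∫ r in (0 : ℝ)..s, Γ (t + r) := by
      rw [intervalIntegral.integral_interval_sub_left (hc.intervalIntegrable _ _)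
        (hc.intervalIntegrable _ _), intervalIntegral.integral_comp_add_left Γ, add_zero,
        NNReal.coe_add]
    rw [h3, add_zero, ← h4]
    change _ = _ + ∫ r in (0 : ℝ)..(t + s : ℝ≥0), Γ r at h1
    change _ = _ + ∫ r in (0 : ℝ)..t, Γ r at h2
    linarith

end IsKuramotoSolution

/-! ### Frequency density -/

namespace HasFrequencyDensity

variable {μ : ProbabilityMeasure Cylinder} {g : ℝ → ℝ}

lemma of_map_snd_eq (hg : HasFrequencyDensity μ g) {ν : ProbabilityMeasure Cylinder}
    (h : (ν : Measure Cylinder).map Prod.snd = (μ : Measure Cylinder).map Prod.snd) :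
    HasFrequencyDensity ν g :=
  ⟨hg.integrable, hg.nonneg, h.trans hg.marginal⟩

/-- The zeroth angular mode is the Fourier transform of the frequency density. -/
lemma cylinderFourier_zero (hg : HasFrequencyDensity μ g) :
    cylinderFourier μ 0 = densityFourier g := by
  funext τ
  have h1 : cylinderFourier μ 0 τ = ∫ ω, freqExp τ ω ∂((μ : Measure Cylinder).map Prod.snd) := by
    rw [integral_map measurable_snd.aemeasurable (continuous_freqExp τ).aestronglyMeasurable]
    refine integral_congr_ae (ae_of_all _ fun p => ?_)
    simp only [neg_zero, fourier_zero, one_mul, freqExp]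
  rw [h1, hg.marginal, integral_withDensity_eq_integral_toReal_smul₀
    hg.integrable.aemeasurable.ennreal_ofReal (ae_of_all _ fun _ => ENNReal.ofReal_lt_top)]
  refine integral_congr_ae ?_
  filter_upwards [hg.nonneg] with ω hω
  rw [ENNReal.toReal_ofReal hω, Complex.real_smul, freqExp]

end HasFrequencyDensity

lemma densityFourier_neg (g : ℝ → ℝ) (τ : ℝ) :
    densityFourier g (-τ) = conj (densityFourier g τ) := by
  rw [densityFourier, densityFourier, ← integral_conj]
  refine integral_congr_ae (ae_of_all _ fun ω => ?_)
  simp only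
  rw [map_mul, ← Complex.exp_conj, Complex.conj_ofReal]
  congr 2
  simp

/-! ### Propagation of the hypotheses -/

/-- The weighted `H¹` norm of the Fourier coefficients stays finite along a solution. -/
lemma IsKuramotoSolution.tsum_weightedH1Sq_lt_top {K a : ℝ} {g : ℝ → ℝ}
    {f : ℝ≥0 → ProbabilityMeasure Cylinder} (hf : IsKuramotoSolution K f) (hK : 0 ≤ K) (ha : 0 < a)
    (hg : HasFrequencyDensity (f 0) g)
    (hgnorm : normH1HalfLine (expWeight a) (densityFourier g) < ⊤)
    (hfnorm : normH1Seq (expWeight a) (fun ℓ : ℕ+ => cylinderFourier (f 0) (ℓ : ℕ)) < ⊤) (t : ℝ≥0) :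
    ∑' i : ℕ, weightedH1Sq univ (expWeight a) (cylinderFourier (f t) ((i + 1 : ℕ) : ℤ)) < ⊤ := by
  have hu0 : cylinderFourier (f (0 : ℝ).toNNReal) ((0 : ℕ) : ℤ) = densityFourier g := by
    rw [Real.toNNReal_zero, Nat.cast_zero]
    exact hg.cylinderFourier_zero
  have h0 : weightedH1Sq (Ioi 0) (expWeight a) (densityFourier g) < ⊤ :=
    (ENNReal.rpow_lt_top_iff_of_pos (by norm_num)).1 hgnorm
  have hi : ∑' i : ℕ, weightedH1Sq univ (expWeight a)
      (cylinderFourier (f (0 : ℝ).toNNReal) ((i + 1 : ℕ) : ℤ)) < ⊤ := by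
    rw [Real.toNNReal_zero, ← tsum_pnat_eq_tsum_succ (f := fun n : ℕ =>
      weightedH1Sq univ (expWeight a) (cylinderFourier (f 0) (n : ℤ)))]
    exact (ENNReal.rpow_lt_top_iff_of_pos (by norm_num)).1 hfnorm
  have h := hf.isModeHierarchy.tsum_weightedH1Sq_lt_top hK hf.continuous_orderParameter
    (fun s => norm_orderParameter_le _) ha t.coe_nonneg (fun τ => ?_) ?_ hi
  · simpa only [Real.toNNReal_coe] using h
  · rw [hu0]
    exact densityFourier_neg g τ
  · change weightedH1Sq (Ioi 0) (expWeight a) (cylinderFourier (f (0 : ℝ).toNNReal) ((0 : ℕ) : ℤ)) < ⊤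
    rwa [hu0]

theorem mainTheorem2 (K : ℝ) (hK : 0 ≤ K) (a ε : ℝ) (ha : 0 < a) (hε : 0 < ε)
    (g : ℝ → ℝ) (f : ℝ≥0 → ProbabilityMeasure Cylinder)
    (hf : IsKuramotoSolution K f) (hg : HasFrequencyDensity (f 0) g)
    (hgnorm : ∀ a' ∈ Set.Icc (a - ε) (a + ε),
      normH1HalfLine (expWeight a') (densityFourier g) < ⊤)
    (hfnorm : ∀ a' ∈ Set.Icc (a - ε) (a + ε),
      normH1Seq (expWeight a') (fun ℓ : ℕ+ => cylinderFourier (f 0) (ℓ : ℕ)) < ⊤) :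
    ∀ t : ℝ≥0, 0 < t → SatisfiesOAHypotheses K a g (f t) := by
  intro t _
  have hgt : HasFrequencyDensity (f t) g := hg.of_map_snd_eq (hf.map_snd_eq t)
  -- the energy estimate needs positive rates, so the window around `a` is shrunk below `a`
  obtain ⟨δ, hδ, hδε, hδa⟩ : ∃ δ, 0 < δ ∧ δ ≤ ε ∧ 0 < a - δ :=
    ⟨min ε (a / 2), lt_min hε (half_pos ha), min_le_left _ _,
      by linarith [min_le_right ε (a / 2)]⟩
  have hH : ∀ a' ∈ Set.Icc (a - δ) (a + δ), ∑' i : ℕ,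
      weightedH1Sq univ (expWeight a') (cylinderFourier (f t) ((i + 1 : ℕ) : ℤ)) < ⊤ := by
    intro a' ha'
    have hmem : a' ∈ Set.Icc (a - ε) (a + ε) := ⟨by linarith [ha'.1], by linarith [ha'.2]⟩
    exact hf.tsum_weightedH1Sq_lt_top hK (hδa.trans_le ha'.1) hg (hgnorm a' hmem)
      (hfnorm a' hmem) t
  have hL : ∀ a' ∈ Set.Icc (a - δ) (a + δ), ∑' i : ℕ,
      weightedL2Sq a' (cylinderFourier (f t) ((i + 1 : ℕ) : ℤ)) < ⊤ := fun a' ha' =>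
    (ENNReal.tsum_le_tsum fun i => weightedL2Sq_le_weightedH1Sq _ _).trans_lt (hH a' ha')
  have hL0 : ∀ a' ∈ Set.Icc (a - δ) (a + δ), weightedL2Sq a' (densityFourier g) < ⊤ := by
    intro a' ha'
    have hmem : a' ∈ Set.Icc (a - ε) (a + ε) := ⟨by linarith [ha'.1], by linarith [ha'.2]⟩
    exact weightedL2Sq_lt_top_of_conj_symm (hδa.trans_le ha'.1).le (densityFourier_neg g)
      ((ENNReal.rpow_lt_top_iff_of_pos (by norm_num)).1 (hgnorm a' hmem))
  have hmode0 : cylinderFourier (f t) ((0 : ℕ) : ℤ) = densityFourier g := hgt.cylinderFourier_zero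
  have hcont : ∀ ℓ : ℤ, Continuous (cylinderFourier (f t) ℓ) := fun ℓ => by
    have := (hf.continuous_cylinderFourier ℓ).comp (f := fun τ : ℝ => ((t : ℝ), τ)) (by fun_prop)
    simpa only [Function.comp_def, Real.toNNReal_coe] using this
  have hmodes : ∀ n : ℕ, weightedL2Sq a (cylinderFourier (f t) (n : ℤ)) < ⊤ := by
    have hmem : a ∈ Set.Icc (a - δ) (a + δ) := ⟨by linarith, by linarith⟩
    intro n
    cases n with
    | zero =>
      rw [hmode0]
      exact hL0 a hmem
    | succ n => exact (ENNReal.le_tsum n).trans_lt (hL a hmem)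
  have hmeas : ∀ ℓ : ℤ, AEStronglyMeasurable (cylinderFourier (f t) ℓ) := fun ℓ =>
    (hcont ℓ).aestronglyMeasurable
  have hconv : ∀ n m : ℕ, ConvolutionExists (cylinderFourier (f t) n) (cylinderFourier (f t) m)
      (ContinuousLinearMap.mul ℂ ℂ) volume := fun n m =>
    convolutionExists_of_weightedL2Sq_lt_top (hmeas _) (hmeas _) (hmodes n) (hmodes m)
  refine ⟨ha, hgt, fun n m => ?_, hconv, ?_, fun s => f (t + s), hf.shift t, congrArg f (add_zero t)⟩
  -- the convolution with `ĝ` is the one with the zeroth mode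
  · have h := hconv (n + m) 0
    rwa [hmode0, Nat.cast_add] at h
  · have hlo : a - δ ∈ Set.Icc (a - δ) (a + δ) := ⟨le_rfl, by linarith⟩
    have hhi : a + δ ∈ Set.Icc (a - δ) (a + δ) := ⟨by linarith, le_rfl⟩
    have hmid : a ∈ Set.Icc (a - δ) (a + δ) := ⟨by linarith, by linarith⟩
    have h := tsum_weightedH1Sq_defect_lt_top (u := fun n : ℕ => cylinderFourier (f t) (n : ℤ)) hδ
      (fun n => hmeas n) (by rw [hmode0]; exact hL0 _ hhi) (by rw [hmode0]; exact hL0 _ hlo)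
      (hL _ hhi) (hL _ hlo) (hH a hmid)
    refine ENNReal.rpow_lt_top_of_nonneg (by norm_num) (ne_of_lt ?_)
    refine lt_of_le_of_lt (le_of_eq ?_) h
    rw [tsum_pnat_eq_tsum_succ (f := fun n : ℕ => ∑' m : ℕ+,
      weightedH1Sq univ (expWeight a) (oaDefect g (f t) n m) / ((n : ℝ≥0∞) * (m : ℝ≥0∞)))]
    refine tsum_congr fun i => ?_
    rw [tsum_pnat_eq_tsum_succ (f := fun m : ℕ =>
      weightedH1Sq univ (expWeight a) (oaDefect g (f t) (i + 1 : ℕ) m) /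
        (((i + 1 : ℕ) : ℝ≥0∞) * (m : ℝ≥0∞)))]
    refine tsum_congr fun j => ?_
    rw [hmode0, oaDefect, ← Nat.cast_add (i + 1) (j + 1)]
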